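/- Let $X$ be a complex manifold and $E\to X$ a holomorphic vector bundle of rank $r$, with sheaf of holomorphic sections $\mathcal E$. Write $\mathcal A_X^{p,q}$ for the sheaf of complex-valued $(p,q)$-forms with real analytic coefficients, and $\mathcal A_X=\mathcal A_X^{0,0}$. Let $\nabla:\mathcal A_X\otimes\mathcal E\to\mathcal A_X^{1,0}\otimes\mathcal E$ be a real analytic connection of type $(1,0)$, that is, $\nabla$ is additive and $\nabla(fs)=\partial f\otimes s+f\nabla s$, and assume that it is flat: $\nabla^2=0$, where $\nabla$ is extended to forms by $\nabla(\omega\otimes s)=\partial\omega\otimes s+(-1)^{|\omega|}\omega\wedge\nabla s$. Denote by $\nabla$ also the induced $(1,0)$-connection on $E^\vee$, $\langle\nabla\sigma,s\rangle=\partial\langle\sigma,s\rangle-\langle\sigma,\nabla s\rangle$, and let $R:\mathcal E^\vee\to\mathcal A_X^{1,1}\otimes\mathcal E^\vee$ be the curvature of the connection $\nabla+\bar\partial$ on $E^\vee$. Let $\tau\in\Gamma(X,\mathcal E^\vee)$ be a holomorphic section, and let $\iota_\tau:\bigwedge^{p}\mathcal E\to\bigwedge^{p-1}\mathcal E$ be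 contraction with $\tau$ (the Koszul differential). Let $\iota_{\nabla\tau}$ be the even superderivation of $\mathcal A_X^*\,\widehat\otimes\,\bigwedge\mathcal E$ which vanishes on $\mathcal A_X^*$ and sends $e\in\mathcal E$ to $\langle\nabla\tau,e\rangle\in\mathcal A_X^{1,0}$. For $0\le p\le r$ let $\phi_p:\bigwedge^p\mathcal E\to\mathcal Hom(\bigwedge^{r-p}\mathcal E,\bigwedge^r\mathcal E)\cong\bigwedge^{r-p}\mathcal E^\vee\otimes\bigwedge^r\mathcal E$ be the isomorphism $\alpha\mapsto(\beta\mapsto\beta\wedge\alpha)$, followed by the canonical identification, let $\bigwedge^{q}R$ be the map $e^1\wedge\dots\wedge e^{q}\mapsto R(e^1)\wedge\dots\wedge R(e^{q})$ on $\bigwedge^{q}\mathcal E^\vee$ (which is well defined), and put $$\psi_p=\tfrac1{p!}(\iota_{\nabla\tau})^p\circ(\phi_p^{-1}\otimes1)\circ(\textstyle\bigwedge^{r-p}R\otimes1)\circ\phi_p .$$ Then $\psi_p$ maps $\bigwedge^p\mathcal E$ to $\mathcal A_X^{r,r-p}$ for $0\le p\le r$, and for $1\le p\le r$ $$\bar\partial\circ\psi_p=\psi_{p-1}\circ\iota_\tau\qquad\text{on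 }\textstyle\bigwedge^p\mathcal E ,$$ so that the $\psi_p$ form a commuting ladder from $$\textstyle\bigwedge^r\mathcal E\xrightarrow{\iota_\tau}\bigwedge^{r-1}\mathcal E\to\cdots\to\mathcal E\xrightarrow{\iota_\tau}\mathcal O_X\quad\text{to}\quad\mathcal A_X^{r,0}\xrightarrow{\bar\partial}\mathcal A_X^{r,1}\to\cdots\xrightarrow{\bar\partial}\mathcal A_X^{r,r}.$$ Moreover $\psi_r=\frac1{r!}(\iota_{\nabla\tau})^r$, and $\psi_0$ is multiplication by the $(r,r)$-form $\det(R)$, the determinant of the matrix of $R$ in any local frame of $E^\vee$. -/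

import Mathlib

open scoped TensorProduct Manifold ContDiff

noncomputable section

namespace KoszulDolbeault

/-! ### Linear algebra in one fibre

`V` is a fibre of the bundle and `L` is the algebra of forms at the point, so that `L ⊗ V`,
`L ⊗ ⋀ V`, ... are the fibres of the bundles of forms with values in `V`, `⋀ V`, ... -/

section FibreAlgebra

variable {V : Type*} [AddCommGroup V] [Module ℂ V]

/-- The map `φ_p : ⋀^p V → Hom(⋀^q V, ⋀^r V)`, `α ↦ (β ↦ β ∧ α)`, for `q + p = r`. -/
def wedgeRight (p q r : ℕ) (h : q + p = r) :
    ⋀[ℂ]^p V →ₗ[ℂ] (⋀[ℂ]^q V →ₗ[ℂ] ⋀[ℂ]^r V) :=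
  LinearMap.mk₂ ℂ
    (fun α β => ⟨(β : ExteriorAlgebra ℂ V) * (α : ExteriorAlgebra ℂ V), by
      subst h; exact SetLike.mul_mem_graded β.2 α.2⟩)
    (fun a a' b => by ext; simp [mul_add])
    (fun c a b => by ext; simp)
    (fun a b b' => by ext; simp [add_mul])
    (fun c a b => by ext; simp)

/-- Contraction with a covector lowers the degree of a multivector by one. -/
theorem contract_mem (f : Module.Dual ℂ V) (p : ℕ) (x : ExteriorAlgebra ℂ V)
    (hx : x ∈ ⋀[ℂ]^(p + 1) V) : CliffordAlgebra.contractLeft f x ∈ ⋀[ℂ]^p V := by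
  induction p generalizing x with
  | zero =>
    rw [ExteriorAlgebra.exteriorPower, zero_add, pow_one] at hx
    obtain ⟨v, rfl⟩ := hx
    rw [ExteriorAlgebra.exteriorPower, pow_zero]
    erw [CliffordAlgebra.contractLeft_ι]
    exact Submodule.algebraMap_mem _
  | succ p ih =>
    rw [ExteriorAlgebra.exteriorPower, pow_succ'] at hx
    induction hx using Submodule.mul_induction_on' with
    | mem_mul_mem m hm y hy =>
      obtain ⟨v, rfl⟩ := hm
      erw [CliffordAlgebra.contractLeft_ι_mul]
      refine Submodule.sub_mem _ (Submodule.smul_mem _ _ hy) ?_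
      rw [ExteriorAlgebra.exteriorPower, pow_succ']
      exact Submodule.mul_mem_mul ⟨v, rfl⟩ (ih y hy)
    | add a _ b _ ha hb =>
      rw [map_add]
      exact Submodule.add_mem _ ha hb

/-- The Koszul differential `ι_f : ⋀^(p+1) V → ⋀^p V`, contraction with the covector `f`. -/
def koszul (f : Module.Dual ℂ V) (p : ℕ) : ⋀[ℂ]^(p + 1) V →ₗ[ℂ] ⋀[ℂ]^p V :=
  (CliffordAlgebra.contractLeft f).restrict (contract_mem f p)

/-- The projection of the exterior algebra onto its part of degree `q`. -/
def gradeProj (q : ℕ) : ExteriorAlgebra ℂ V →ₗ[ℂ] ⋀[ℂ]^q V :=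
  DirectSum.component ℂ ℕ (fun i => ⋀[ℂ]^i V) q ∘ₗ
    (DirectSum.decomposeLinearEquiv (fun i => ⋀[ℂ]^i V)).toLinearMap

section Finite

variable [Module.Finite ℂ V]

theorem wedgeRight_injective {p q r : ℕ} (h : q + p = r) (hV : Module.finrank ℂ V = r) :
    Function.Injective (wedgeRight (V := V) p q r h) := by
  classical
  have b : Module.Basis (Fin r) ℂ V := Module.finBasisOfFinrankEq ℂ V hV
  refine (injective_iff_map_eq_zero _).mpr fun α hα => ?_
  apply (b.exteriorPower p).repr.injective
  ext s
  rw [map_zero, Finsupp.zero_apply]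
  have hc : (s : Finset (Fin r))ᶜ.card = q := by
    rw [Finset.card_compl, Fintype.card_fin, s.2]; omega
  let t : Set.powersetCard (Fin r) q := ⟨(s : Finset (Fin r))ᶜ, hc⟩
  have h1 : (b.ExteriorAlgebra t) * (α : ExteriorAlgebra ℂ V) = 0 := by
    have := congrArg (fun x : ⋀[ℂ]^r V => (x : ExteriorAlgebra ℂ V))
      (LinearMap.congr_fun hα (b.exteriorPower q t))
    simpa [wedgeRight, ExteriorAlgebra.basis_eq_coe_basis] using this
  have h2 : (α : ExteriorAlgebra ℂ V) =
      ∑ u, (b.exteriorPower p).repr α u • b.ExteriorAlgebra u := by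
    conv_lhs => rw [← (b.exteriorPower p).sum_repr α]
    simp [ExteriorAlgebra.basis_eq_coe_basis]
  rw [h2, Finset.mul_sum, Finset.sum_eq_single s] at h1
  · have hd : Disjoint t.val s.val := disjoint_compl_left
    rw [mul_smul_comm, ExteriorAlgebra.basis_mul_of_disjoint b t s hd] at h1
    have hne : b.ExteriorAlgebra (Set.powersetCard.disjUnion hd) ≠ 0 := b.ExteriorAlgebra.ne_zero _
    rcases Int.units_eq_one_or (Set.powersetCard.permOfDisjoint hd).sign with e | e <;>
      rw [e] at h1 <;> simp only [Units.neg_smul, one_smul, smul_neg, neg_eq_zero, smul_eq_zero] at h1 <;>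
      exact h1.resolve_right hne
  · intro u _ hus
    have hd : ¬ Disjoint t.val u.val := by
      intro hd
      apply hus
      have hsub : u.val ⊆ s.val := by
        have := disjoint_compl_left_iff.mp (show Disjoint (s : Finset (Fin r))ᶜ u.val from hd)
        exact this
      apply Subtype.ext
      exact Finset.eq_of_subset_of_card_le hsub (by rw [s.2, u.2])
    rw [mul_smul_comm, ExteriorAlgebra.basis_mul_of_not_disjoint b t u hd, smul_zero]
  · simp

theorem wedgeRight_bijective {p q r : ℕ} (h : q + p = r) (hV : Module.finrank ℂ V = r) :
    Function.Bijective (wedgeRight (V := V) p q r h) := by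
  have hf : Module.finrank ℂ (⋀[ℂ]^p V) = Module.finrank ℂ (⋀[ℂ]^q V →ₗ[ℂ] ⋀[ℂ]^r V) := by
    rw [Module.finrank_linearMap, exteriorPower.finrank_eq, exteriorPower.finrank_eq,
      exteriorPower.finrank_eq, hV, Nat.choose_self, mul_one, ← h, Nat.choose_symm_add]
  have hi := wedgeRight_injective (V := V) h hV
  refine ⟨hi, ?_⟩
  exact (LinearMap.injective_iff_surjective_of_finrank_eq_finrank (K := ℂ) (V := ⋀[ℂ]^p V)
    (V₂ := ⋀[ℂ]^q V →ₗ[ℂ] ⋀[ℂ]^r V) hf).mp hi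

theorem pairingDual_bijective (q : ℕ) :
    Function.Bijective (exteriorPower.pairingDual ℂ V q) := by
  classical
  let b := Module.finBasis ℂ V
  have hb : ⇑b.dualBasis = b.coord := by ext; simp
  let e : ⋀[ℂ]^q (Module.Dual ℂ V) ≃ₗ[ℂ] Module.Dual ℂ (⋀[ℂ]^q V) :=
    (b.dualBasis.exteriorPower q).equiv (b.exteriorPower q).dualBasis (Equiv.refl _)
  have : exteriorPower.pairingDual ℂ V q = e.toLinearMap := by
    apply (b.dualBasis.exteriorPower q).ext
    intro s
    simp only [LinearEquiv.coe_coe, e, Module.Basis.equiv_apply, Equiv.refl_apply]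
    have h2 := congrFun (b.exteriorPower q).coe_dualBasis s
    rw [exteriorPower.basis_apply, hb, h2, exteriorPower.basis_coord]
    rfl
  rw [this]
  exact e.bijective

/-- The isomorphism `φ_p`, for `V` of dimension `r` and `q = r - p`. -/
def phi (p q r : ℕ) (h : q + p = r) (hV : Module.finrank ℂ V = r) :
    ⋀[ℂ]^p V ≃ₗ[ℂ] (⋀[ℂ]^q V →ₗ[ℂ] ⋀[ℂ]^r V) :=
  LinearEquiv.ofBijective (wedgeRight p q r h) (wedgeRight_bijective h hV)

/-- The canonical isomorphism `⋀^q V^∨ ⊗ ⋀^r V ≃ Hom(⋀^q V, ⋀^r V)`, given by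
`(f₁ ∧ ... ∧ f_q) ⊗ w ↦ (v₁ ∧ ... ∧ v_q ↦ det (f_i (v_j)) w)`. -/
def homEquiv (q r : ℕ) :
    (⋀[ℂ]^q (Module.Dual ℂ V) ⊗[ℂ] ⋀[ℂ]^r V) ≃ₗ[ℂ] (⋀[ℂ]^q V →ₗ[ℂ] ⋀[ℂ]^r V) :=
  (TensorProduct.congr
      (LinearEquiv.ofBijective (exteriorPower.pairingDual ℂ V q) (pairingDual_bijective q))
      (LinearEquiv.refl ℂ (⋀[ℂ]^r V))).trans
    (dualTensorHomEquiv ℂ (⋀[ℂ]^q V) (⋀[ℂ]^r V))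

/-- `φ_p`, after the canonical identification of its target with `⋀^q V^∨ ⊗ ⋀^r V`. -/
def phiTensor (p q r : ℕ) (h : q + p = r) (hV : Module.finrank ℂ V = r) :
    ⋀[ℂ]^p V ≃ₗ[ℂ] (⋀[ℂ]^q (Module.Dual ℂ V) ⊗[ℂ] ⋀[ℂ]^r V) :=
  (phi p q r h hV).trans (homEquiv q r).symm

end Finite

variable {L : Type*} [Ring L] [Algebra ℂ L]

/-- Evaluate the `V`-factor of an element of `L ⊗ V` at a covector: `η ⊗ v ↦ f(v) η`. -/
def evalAt (f : Module.Dual ℂ V) : L ⊗[ℂ] V →ₗ[ℂ] L :=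
  (TensorProduct.rid ℂ L).toLinearMap ∘ₗ LinearMap.lTensor L f

/-- `L ⊗ V → L ⊗ ⋀ V`, the inclusion in degree one. -/
def inclOne : L ⊗[ℂ] V →ₗ[ℂ] L ⊗[ℂ] ExteriorAlgebra ℂ V :=
  LinearMap.lTensor L (ExteriorAlgebra.ι ℂ)

/-- `⋀^q R : ⋀^q V → L ⊗ ⋀^q V`, `v₁ ∧ ... ∧ v_q ↦ R v₁ ∧ ... ∧ R v_q`, for a map `R : V → L ⊗ V`
whose values have coefficients of even degree. For such an `R` the product `R v₁ ∧ ... ∧ R v_q`,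
formed in the algebra `L ⊗ ⋀ V`, is alternating in `v₁, ..., v_q`, hence it equals its
antisymmetrisation, by which it is written here so that the formula makes sense for every `R`. -/
def wedgePow (R : V →ₗ[ℂ] L ⊗[ℂ] V) (q : ℕ) : ⋀[ℂ]^q V →ₗ[ℂ] L ⊗[ℂ] ⋀[ℂ]^q V :=
  LinearMap.lTensor L (gradeProj q) ∘ₗ
    exteriorPower.alternatingMapLinearEquiv
      (((q.factorial : ℂ)⁻¹) • MultilinearMap.alternatization
        ((MultilinearMap.mkPiAlgebraFin ℂ q (L ⊗[ℂ] ExteriorAlgebra ℂ V)).compLinearMap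
          (fun _ => inclOne ∘ₗ R)))

/-- Contraction `ι_Θ` of `L ⊗ ⋀ V` with `Θ ∈ L ⊗ V^∨`:
`ι_{η ⊗ f} (ω ⊗ s) = (ω ∧ η) ⊗ ι_f s`. When `η` has degree one this is the superderivation of even
degree of the super tensor product of `L` and `⋀ V` which vanishes on `L` and sends `v ∈ V` to
`f(v) η`. -/
def contractForm : L ⊗[ℂ] Module.Dual ℂ V →ₗ[ℂ] Module.End ℂ (L ⊗[ℂ] ExteriorAlgebra ℂ V) :=
  TensorProduct.lift (LinearMap.mk₂ ℂ
    (fun η f => TensorProduct.map (LinearMap.mulRight ℂ η) (CliffordAlgebra.contractLeft f))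
    (fun η η' f => by ext; simp [mul_add, TensorProduct.add_tmul])
    (fun c η f => by ext; simp [TensorProduct.smul_tmul'])
    (fun η f f' => by ext; simp [TensorProduct.tmul_add])
    (fun c η f => by ext; simp))

/-- The identification of `L ⊗ ⋀^0 V` with `L` (extended by zero to `L ⊗ ⋀ V`). -/
def degreeZero : L ⊗[ℂ] ExteriorAlgebra ℂ V →ₗ[ℂ] L :=
  (TensorProduct.rid ℂ L).toLinearMap ∘ₗ
    LinearMap.lTensor L (ExteriorAlgebra.algebraMapInv (R := ℂ) (M := V)).toLinearMap

/-- `(1/p!) (ι_Θ)^p`, on `L ⊗ ⋀^p V`, with values in `L ⊗ ⋀^0 V = L`. -/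
def contractPow (Θ : L ⊗[ℂ] Module.Dual ℂ V) (p : ℕ) : L ⊗[ℂ] ⋀[ℂ]^p V →ₗ[ℂ] L :=
  ((p.factorial : ℂ)⁻¹) •
    (degreeZero ∘ₗ (contractForm Θ ^ p) ∘ₗ LinearMap.lTensor L (⋀[ℂ]^p V).subtype)

/-- `(φ_p⁻¹ ⊗ 1) ∘ (⋀^q R ⊗ 1) ∘ φ_p : ⋀^p V → L ⊗ ⋀^p V`, where `R : V^∨ → L ⊗ V^∨`. -/
def twist [Module.Finite ℂ V] (R : Module.Dual ℂ V →ₗ[ℂ] L ⊗[ℂ] Module.Dual ℂ V)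
    (p q r : ℕ) (h : q + p = r) (hV : Module.finrank ℂ V = r) :
    ⋀[ℂ]^p V →ₗ[ℂ] L ⊗[ℂ] ⋀[ℂ]^p V :=
  LinearMap.lTensor L (phiTensor p q r h hV).symm.toLinearMap ∘ₗ
    (TensorProduct.assoc ℂ L (⋀[ℂ]^q (Module.Dual ℂ V)) (⋀[ℂ]^r V)).toLinearMap ∘ₗ
    LinearMap.rTensor (⋀[ℂ]^r V) (wedgePow R q) ∘ₗ
    (phiTensor p q r h hV).toLinearMap

/-- The determinant of a square matrix whose entries lie in `L` and commute with each other (such as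
forms of even degree). -/
def detForm {k : ℕ} (M : Matrix (Fin k) (Fin k) L) : L :=
  ∑ σ : Equiv.Perm (Fin k),
    ((Equiv.Perm.sign σ : ℤ) : L) * (List.ofFn fun i => M i (σ i)).prod

end FibreAlgebra

/-! ### Calculus in a complex vector space -/

section Flat

variable {E : Type*} [NormedAddCommGroup E] [NormedSpace ℂ E]

instance instFiniteCotangent [FiniteDimensional ℂ E] : Module.Finite ℂ (E →L[ℝ] ℂ) := by
  have : FiniteDimensional ℝ E := FiniteDimensional.complexToReal E
  exact Module.Finite.of_restrictScalars_finite ℝ ℂ _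

instance instFiniteExterior {W : Type*} [AddCommGroup W] [Module ℂ W] [Module.Finite ℂ W] :
    Module.Finite ℂ (ExteriorAlgebra ℂ W) :=
  Module.Finite.of_basis (Module.finBasis ℂ W).ExteriorAlgebra

variable {W : Type*} [AddCommGroup W] [Module ℂ W] [Module.Finite ℂ W]

/-- The real directional derivative, along `v` and at `z`, of a map with values in a
finite-dimensional complex vector space, taken in coordinates. -/
def dirDeriv (f : E → W) (z v : E) : W :=
  (Module.finBasis ℂ W).equivFun.symm
    (fderiv ℝ (fun y => (Module.finBasis ℂ W).equivFun (f y)) z v)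

/-- Real analyticity of a map with values in a finite-dimensional complex vector space. -/
def RealAnalyticAt (f : E → W) (z : E) : Prop :=
  AnalyticAt ℝ (fun y => (Module.finBasis ℂ W).equivFun (f y)) z

variable [FiniteDimensional ℂ E]

/-- The differential `dz_k` of the `k`-th coordinate of `E`. -/
def dz (k : Fin (Module.finrank ℂ E)) : E →L[ℝ] ℂ :=
  (LinearMap.toContinuousLinearMap ((Module.finBasis ℂ E).coord k)).restrictScalars ℝ

/-- The complex conjugate of `dz_k`. -/
def dzbar (k : Fin (Module.finrank ℂ E)) : E →L[ℝ] ℂ :=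
  (Complex.conjCLE : ℂ →L[ℝ] ℂ).comp (dz k)

/-- `∂f = ∑ k, dz_k ∧ ∂f/∂z_k`, with `∂f/∂z_k = (∂f/∂x_k - i ∂f/∂y_k) / 2`, for a form `f` on `E`. -/
def flatDel (f : E → ExteriorAlgebra ℂ (E →L[ℝ] ℂ)) (z : E) : ExteriorAlgebra ℂ (E →L[ℝ] ℂ) :=
  ∑ k, ExteriorAlgebra.ι ℂ (dz k) * ((1 / 2 : ℂ) •
    (dirDeriv f z (Module.finBasis ℂ E k) -
      Complex.I • dirDeriv f z (Complex.I • Module.finBasis ℂ E k)))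

/-- The operator `∂̄f = ∑ k, dz̄_k ∧ ∂f/∂z̄_k`, with `∂f/∂z̄_k = (∂f/∂x_k + i ∂f/∂y_k) / 2`,
for a form `f` on `E`. -/
def flatDelbar (f : E → ExteriorAlgebra ℂ (E →L[ℝ] ℂ)) (z : E) :
    ExteriorAlgebra ℂ (E →L[ℝ] ℂ) :=
  ∑ k, ExteriorAlgebra.ι ℂ (dzbar k) * ((1 / 2 : ℂ) •
    (dirDeriv f z (Module.finBasis ℂ E k) +
      Complex.I • dirDeriv f z (Complex.I • Module.finBasis ℂ E k)))

end Flat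

/-- Pullback of complex-valued real covectors along a complex linear map. -/
def pullCovector {E₁ E₂ : Type*} [AddCommGroup E₁] [Module ℂ E₁] [TopologicalSpace E₁]
    [AddCommGroup E₂] [Module ℂ E₂] [TopologicalSpace E₂] (A : E₁ →L[ℂ] E₂) :
    (E₂ →L[ℝ] ℂ) →ₗ[ℂ] (E₁ →L[ℝ] ℂ) where
  toFun c := c.comp (A.restrictScalars ℝ)
  map_add' _ _ := rfl
  map_smul' _ _ := rfl

/-! ### Forms on a complex manifold -/

section Forms

variable (E : Type*) [NormedAddCommGroup E] [NormedSpace ℂ E]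
  {X : Type*} [TopologicalSpace X] [ChartedSpace E X]

/-- The complexified real cotangent space of `X` at `x`. -/
abbrev CovectorAt (x : X) : Type _ := TangentSpace 𝓘(ℂ, E) x →L[ℝ] ℂ

/-- The algebra of complex-valued real differential forms at the point `x`. -/
abbrev FormAt (x : X) : Type _ := ExteriorAlgebra ℂ (CovectorAt E x)

/-- The forms of type `(p, q)` at `x`: sums of products of `p` complex linear and `q` conjugate
linear covectors. -/
def formType (p q : ℕ) (x : X) : Submodule ℂ (FormAt E x) :=
  (Submodule.span ℂ {η | ∃ c : CovectorAt E x,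
      (∀ v, c (Complex.I • v) = Complex.I * c v) ∧ η = ExteriorAlgebra.ι ℂ c}) ^ p *
  (Submodule.span ℂ {η | ∃ c : CovectorAt E x,
      (∀ v, c (Complex.I • v) = -(Complex.I * c v)) ∧ η = ExteriorAlgebra.ι ℂ c}) ^ q

/-- The expression of a form `η` on `X` in the chart at `x`: the pullback of `η` under the inverse
of this chart. -/
def inChart (η : Π y : X, FormAt E y) (x : X) (z : E) : ExteriorAlgebra ℂ (E →L[ℝ] ℂ) :=
  ExteriorAlgebra.map (pullCovector (E₁ := E)
    (mfderiv 𝓘(ℂ, E) 𝓘(ℂ, E) (extChartAt 𝓘(ℂ, E) x).symm z)) (η ((extChartAt 𝓘(ℂ, E) x).symm z))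

/-- The pullback to `X`, at the point `x`, of a form in the chart at `x`. -/
def fromChart (x : X) (u : ExteriorAlgebra ℂ (E →L[ℝ] ℂ)) : FormAt E x :=
  ExteriorAlgebra.map (pullCovector (E₂ := E)
    (mfderiv 𝓘(ℂ, E) 𝓘(ℂ, E) (extChartAt 𝓘(ℂ, E) x) x)) u

variable [FiniteDimensional ℂ E]

/-- Real analyticity, near `x`, of a form on `X`. -/
def FormAnalyticAt (η : Π y : X, FormAt E y) (x : X) : Prop :=
  RealAnalyticAt (inChart E η x) (extChartAt 𝓘(ℂ, E) x x)

/-- The operator `∂` on forms on `X`. -/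
def del (η : Π y : X, FormAt E y) (x : X) : FormAt E x :=
  fromChart E x (flatDel (inChart E η x) (extChartAt 𝓘(ℂ, E) x x))

/-- The operator `∂̄` on forms on `X`. -/
def delbar (η : Π y : X, FormAt E y) (x : X) : FormAt E x :=
  fromChart E x (flatDelbar (inChart E η x) (extChartAt 𝓘(ℂ, E) x x))

/-- The exterior derivative `d = ∂ + ∂̄`. -/
def extD (η : Π y : X, FormAt E y) (x : X) : FormAt E x := del E η x + delbar E η x

/-- A complex-valued function, as a form of degree `0`. -/
def funForm (f : X → ℂ) (x : X) : FormAt E x := algebraMap ℂ (FormAt E x) (f x)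

end Forms

/-! ### Connections

The operators of a bundle are written in local holomorphic frames. All operators act on arbitrary
sections; what they do to sections that are not real analytic plays no role. -/

/-- A choice, for every point `x` of `X`, of a family of sections `sec x i` of `W` (a frame near
`x`) and of its coordinate functions `coord x i`. -/
structure LocalFrames {X : Type*} (W : X → Type*) [∀ x, AddCommGroup (W x)] [∀ x, Module ℂ (W x)]
    (r : ℕ) where
  sec : X → Fin r → Π y, W y
  coord : X → Fin r → Π y, W y →ₗ[ℂ] ℂ

/-- The dual frames of the dual bundle. -/
def LocalFrames.dual {X : Type*} {W : X → Type*} [∀ x, AddCommGroup (W x)] [∀ x, Module ℂ (W x)]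
    {r : ℕ} (fr : LocalFrames W r) : LocalFrames (fun x => Module.Dual ℂ (W x)) r where
  sec := fr.coord
  coord x i y := Module.Dual.eval ℂ (W y) (fr.sec x i y)

section Connections

variable {E : Type*} [NormedAddCommGroup E] [NormedSpace ℂ E] [FiniteDimensional ℂ E]
  {X : Type*} [TopologicalSpace X] [ChartedSpace E X]
  {W : X → Type*} [∀ x, AddCommGroup (W x)] [∀ x, Module ℂ (W x)] {r : ℕ}

/-- Real analyticity, near `x`, of a form with values in the bundle `W`. -/
def BundleFormAnalyticAt (fr : LocalFrames W r) (Ψ : Π y, FormAt E y ⊗[ℂ] W y) (x : X) : Prop :=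
  ∀ i, FormAnalyticAt E (fun y => evalAt (fr.coord x i y) (Ψ y)) x

/-- The operator `∂̄` on sections of the holomorphic bundle `W`: it is `∂̄` of the coefficients in a
holomorphic frame. -/
def delbarSection (fr : LocalFrames W r) (s : Π y, W y) (x : X) : FormAt E x ⊗[ℂ] W x :=
  ∑ i, delbar E (funForm E fun y => fr.coord x i y (s y)) x ⊗ₜ[ℂ] fr.sec x i x

/-- The extension of an operator `D` from sections of `W` to forms with values in `W`, by the rule
`D (ω ⊗ s) = dω ⊗ s + (-1)^|ω| ω ∧ D s`, where `d` is an operator on forms. -/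
def extendToForms (fr : LocalFrames W r) (d : (Π y : X, FormAt E y) → Π y : X, FormAt E y)
    (D : (Π y, W y) → Π y : X, FormAt E y ⊗[ℂ] W y) (Ψ : Π y : X, FormAt E y ⊗[ℂ] W y) (x : X) :
    FormAt E x ⊗[ℂ] W x :=
  ∑ i, (d (fun y => evalAt (fr.coord x i y) (Ψ y)) x ⊗ₜ[ℂ] fr.sec x i x +
    CliffordAlgebra.involute (evalAt (fr.coord x i x) (Ψ x)) • D (fr.sec x i) x)

/-- The total connection `∇ + ∂̄` on sections of `W`. -/
def totalConnection (fr : LocalFrames W r) (D : (Π y, W y) → Π y : X, FormAt E y ⊗[ℂ] W y)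
    (s : Π y, W y) (x : X) : FormAt E x ⊗[ℂ] W x :=
  D s x + delbarSection fr s x

/-- The curvature `(∇ + ∂̄)²` of the total connection, at the point `x`, as a map from `W x` to
forms with values in `W x`. It is the linear map with the right values on the frame at `x`. -/
def curvature (fr : LocalFrames W r) (D : (Π y, W y) → Π y : X, FormAt E y ⊗[ℂ] W y) (x : X) :
    W x →ₗ[ℂ] FormAt E x ⊗[ℂ] W x :=
  ∑ i, (fr.coord x i x).smulRight
    (extendToForms fr (extD E) (totalConnection fr D) (totalConnection fr D (fr.sec x i)) x)

/-- The connection on the dual bundle induced by a `(1,0)`-connection `D`, given by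
`⟨D τ, s⟩ = ∂⟨τ, s⟩ - ⟨τ, D s⟩`. -/
def dualConnection (fr : LocalFrames W r) (D : (Π y, W y) → Π y : X, FormAt E y ⊗[ℂ] W y)
    (t : Π y, Module.Dual ℂ (W y)) (x : X) : FormAt E x ⊗[ℂ] Module.Dual ℂ (W x) :=
  ∑ i, (del E (funForm E fun y => t y (fr.sec x i y)) x - evalAt (t x) (D (fr.sec x i) x)) ⊗ₜ[ℂ]
    fr.coord x i x

end Connections

/-! ### The holomorphic vector bundle -/

section VectorBundle

open Bundle

variable (E : Type*) [NormedAddCommGroup E] [NormedSpace ℂ E]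
  {X : Type*} [TopologicalSpace X] [ChartedSpace E X]
  (F : Type*) [NormedAddCommGroup F] [NormedSpace ℂ F]
  {V : X → Type*} [TopologicalSpace (TotalSpace F V)]
  [∀ x, AddCommGroup (V x)] [∀ x, Module ℂ (V x)] [∀ x, TopologicalSpace (V x)] [FiberBundle F V]

/-- Holomorphic sections of `V` over `U`. -/
def HolSection (s : Π x, V x) (U : Set X) : Prop :=
  ContMDiffOn 𝓘(ℂ, E) (𝓘(ℂ, E).prod 𝓘(ℂ, F)) ω (fun x => TotalSpace.mk' F x (s x)) U

/-- Sections of `V` that are real analytic near `x`. -/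
def SectionAnalyticAt (s : Π x, V x) (x : X) : Prop :=
  ContMDiffAt 𝓘(ℝ, E) (𝓘(ℝ, E).prod 𝓘(ℝ, F)) ω (fun x => TotalSpace.mk' F x (s x)) x

/-- Holomorphic sections over `U` of the bundle `⋀^p V`: locally, sums of products of `p`
holomorphic sections of `V`, with holomorphic functions as coefficients. -/
def HolMultiSection (p : ℕ) (α : Π x, ⋀[ℂ]^p (V x)) (U : Set X) : Prop :=
  ∀ x ∈ U, ∃ U' : Set X, IsOpen U' ∧ x ∈ U' ∧ ∃ (m : ℕ) (g : Fin m → X → ℂ)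
    (s : Fin m → Fin p → Π y, V y),
    (∀ i, ContMDiffOn 𝓘(ℂ, E) 𝓘(ℂ, ℂ) ω (g i) U') ∧ (∀ i j, HolSection E F (s i j) U') ∧
    ∀ y ∈ U', α y = ∑ i, g i y • exteriorPower.ιMulti ℂ p (fun j => s i j y)

variable [VectorBundle ℂ F V] [FiniteDimensional ℂ F]

/-- The holomorphic local frames of `V` given by its local trivialisations. -/
def bundleFrames : LocalFrames V (Module.finrank ℂ F) where
  sec x i y := (trivializationAt F V x).symmₗ ℂ y (Module.finBasis ℂ F i)
  coord x i y := (Module.finBasis ℂ F).coord i ∘ₗ (trivializationAt F V x).linearMapAt ℂ y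

theorem finite_fibre (x : X) :
    Module.Finite ℂ (V x) ∧ Module.finrank ℂ (V x) = Module.finrank ℂ F :=
  let e := (trivializationAt F V x).linearEquivAt ℂ x (mem_baseSet_trivializationAt F V x)
  ⟨Module.Finite.equiv e.symm, e.finrank_eq⟩

variable {E} [FiniteDimensional ℂ E]

/-- `D` is a real analytic connection of type `(1,0)` on `V`: on real analytic sections it takes
real analytic values in the `(1,0)`-forms with values in `V`, is additive, and satisfies the Leibniz
rule `D (f s) = ∂f ⊗ s + f D s`. -/
structure IsConnection (D : (Π y, V y) → Π y : X, FormAt E y ⊗[ℂ] V y) : Prop where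
  add : ∀ (s t : Π y, V y) (x : X), SectionAnalyticAt E F s x → SectionAnalyticAt E F t x →
    D (fun y => s y + t y) x = D s x + D t x
  leibniz : ∀ (f : X → ℂ) (s : Π y, V y) (x : X), ContMDiffAt 𝓘(ℝ, E) 𝓘(ℝ, ℂ) ω f x →
    SectionAnalyticAt E F s x →
    D (fun y => f y • s y) x = del E (funForm E f) x ⊗ₜ[ℂ] s x + f x • D s x
  type : ∀ (s : Π y, V y) (x : X), SectionAnalyticAt E F s x →
    D s x ∈ LinearMap.range (LinearMap.rTensor (V x) (formType E 1 0 x).subtype)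
  analytic : ∀ (s : Π y, V y) (x : X), SectionAnalyticAt E F s x →
    BundleFormAnalyticAt (bundleFrames F) (D s) x

/-- `D` is flat, `D² = 0`, where `D` is extended to forms by
`D (ω ⊗ s) = ∂ω ⊗ s + (-1)^|ω| ω ∧ D s`. -/
def IsFlat (D : (Π y, V y) → Π y : X, FormAt E y ⊗[ℂ] V y) : Prop :=
  ∀ (s : Π y, V y) (x : X), SectionAnalyticAt E F s x →
    extendToForms (bundleFrames F) (del E) D (D s) x = 0

/-- The curvature `R` of the connection on the dual bundle that is induced by `D` and `∂̄`. -/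
def dualCurvature (D : (Π y, V y) → Π y : X, FormAt E y ⊗[ℂ] V y) (x : X) :
    Module.Dual ℂ (V x) →ₗ[ℂ] FormAt E x ⊗[ℂ] Module.Dual ℂ (V x) :=
  curvature (bundleFrames F).dual (dualConnection (bundleFrames F) D) x

/-- `D τ`, for a section `τ` of the dual bundle. -/
def nablaDual (D : (Π y, V y) → Π y : X, FormAt E y ⊗[ℂ] V y) (τ : Π y, V y →L[ℂ] ℂ) (x : X) :
    FormAt E x ⊗[ℂ] Module.Dual ℂ (V x) :=
  dualConnection (bundleFrames F) D (fun y => (τ y : V y →ₗ[ℂ] ℂ)) x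

/-- `ψ_p = (1/p!) (ι_{∇τ})^p ∘ (φ_p⁻¹ ⊗ 1) ∘ (⋀^{r-p} R ⊗ 1) ∘ φ_p`, at the point `x`. -/
def psi (D : (Π y, V y) → Π y : X, FormAt E y ⊗[ℂ] V y) (τ : Π y, V y →L[ℂ] ℂ)
    (p : ℕ) (hp : p ≤ Module.finrank ℂ F) (x : X) : ⋀[ℂ]^p (V x) →ₗ[ℂ] FormAt E x :=
  haveI : Module.Finite ℂ (V x) := (finite_fibre F x).1
  contractPow (nablaDual F D τ x) p ∘ₗ
    twist (dualCurvature F D x) p (Module.finrank ℂ F - p) (Module.finrank ℂ F)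
      (Nat.sub_add_cancel hp) (finite_fibre F x).2

end VectorBundle

end KoszulDolbeault

end

/-!
The maps `ψ_p` commute with the differentials because of three facts.

*Fibrewise algebra.* The isomorphism `φ` carries contraction with a covector `f` to exterior
multiplication with `f`, up to a sign (`phiTensor_koszul`). Hence, if `R` has central
coefficients, conjugating `⋀ R` by `φ` turns contraction with `f` into contraction with `R f`
(`twist_koszul`), and a multivector `ι_{f₁} ⋯ ι_{f_q} w`, with `w` of top degree, goes to
`ι_{R f₁} ⋯ ι_{R f_q} w` (`twist_contractList`). Such multivectors span (`mem_span_contractList`),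
so that `ψ_p (ι_{f₁} ⋯ ι_{f_q} w) = (1/p!) (ι_{∇τ})^p ι_{R f₁} ⋯ ι_{R f_q} w` determines `ψ_p`.

*Geometry in a holomorphic frame.* Let `A` be the connection matrix. Flatness of `∇` cancels the
`(2,0)`-part of the curvature of `∇ + ∂̄` on the dual bundle, and leaves the matrix `-∂̄A`
(`dualCurvature_coord`). Therefore `R` has type `(1,1)`, so its coefficients are central, and for
a constant covector `f` the form `R f` is `∂̄`-closed (`flatCurvature_closed`). Moreover
`∂̄(∇τ) = R τ`, because `∂̄∂` of a holomorphic function vanishes (`thetaForm_analytic`).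

*The Leibniz rule.* Contraction with `∂̄(∇τ) = R τ` has even coefficients and `∇τ` odd ones, so
that all `p + 1` terms of `∂̄` of `(ι_{∇τ})^(p+1)` agree (`tensorDelbar_contractForm_pow`). With
the closed form `ι_{R f₁} ⋯ ι_{R f_q} w` as argument the result is `(p + 1) (ι_{∇τ})^p ι_{R τ}
ι_{R f₁} ⋯ ι_{R f_q} w`, and after division by `(p + 1)!` this is `ψ_p` of
`ι_τ ι_{f₁} ⋯ ι_{f_q} w` (`flatDelbar_flatPsi`).

On a manifold, `∂` and `∂̄` are defined at each point by the preferred chart at this point, and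
the curvature by the preferred frame. The Leibniz rule above takes place in one fixed chart and
frame. The passage between the two rests on the invariance of `∂̄` of `(1,0)`-forms under
holomorphic changes of charts (`inChart_delbar`) and on the tensorial behaviour of `∂̄A` under
changes of frames (`IsConnection.delbar_connMatrix`). As both sides of the ladder are linear over
holomorphic functions, it suffices to treat multivector fields that are constant in a
trivialisation (`HolMultiSection.exists_eq_sum`, `delbar_psi_constMulti`).
-/

noncomputable section

namespace KoszulDolbeault

/-! ### Contraction and the map `φ_p` -/

section Koszul

variable {V : Type*} [AddCommGroup V] [Module ℂ V]

theorem contractLeft_ι_mul' (f : Module.Dual ℂ V) (v : V) (x : ExteriorAlgebra ℂ V) :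
    CliffordAlgebra.contractLeft f (ExteriorAlgebra.ι ℂ v * x) =
      f v • x - ExteriorAlgebra.ι ℂ v * CliffordAlgebra.contractLeft f x :=
  CliffordAlgebra.contractLeft_ι_mul (Q := (0 : QuadraticForm ℂ V)) (d := f) v x

theorem contractLeft_one' (f : Module.Dual ℂ V) :
    CliffordAlgebra.contractLeft f (1 : ExteriorAlgebra ℂ V) = 0 :=
  CliffordAlgebra.contractLeft_one (Q := (0 : QuadraticForm ℂ V)) f

theorem involute_ι' (v : V) :
    CliffordAlgebra.involute (ExteriorAlgebra.ι ℂ v) = -ExteriorAlgebra.ι ℂ v :=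
  CliffordAlgebra.involute_ι (Q := (0 : QuadraticForm ℂ V)) v

/-- Products of vectors generate the exterior algebra; induction on the first factor. -/
theorem exterior_induction {P : ExteriorAlgebra ℂ V → Prop} (x : ExteriorAlgebra ℂ V)
    (one : P 1) (add : ∀ a b, P a → P b → P (a + b)) (smul : ∀ (c : ℂ) a, P a → P (c • a))
    (ι_mul : ∀ v a, P a → P (ExteriorAlgebra.ι ℂ v * a)) : P x := by
  induction x using CliffordAlgebra.left_induction with
  | algebraMap r => rw [Algebra.algebraMap_eq_smul_one]; exact smul _ _ one
  | add a b ha hb => exact add _ _ ha hb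
  | ι_mul a v ha => exact ι_mul v a ha

/-- Contraction with a covector is a superderivation of odd degree. -/
theorem contractLeft_mul (f : Module.Dual ℂ V) (x y : ExteriorAlgebra ℂ V) :
    CliffordAlgebra.contractLeft f (x * y) = CliffordAlgebra.contractLeft f x * y +
      CliffordAlgebra.involute x * CliffordAlgebra.contractLeft f y := by
  induction x using exterior_induction with
  | one => rw [contractLeft_one']; simp
  | add a b ha hb => simp only [add_mul, map_add, ha, hb]; abel
  | smul c a ha => simp only [smul_mul_assoc, map_smul, ha, smul_add]
  | ι_mul v a ha =>
    rw [mul_assoc, contractLeft_ι_mul', contractLeft_ι_mul', ha, map_mul, involute_ι']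
    simp only [mul_add, sub_mul, smul_mul_assoc, neg_mul, mul_assoc]
    abel

theorem involute_of_mem {n : ℕ} {x : ExteriorAlgebra ℂ V} (hx : x ∈ ⋀[ℂ]^n V) :
    CliffordAlgebra.involute x = (-1 : ℂ) ^ n • x := by
  induction n generalizing x with
  | zero =>
    rw [ExteriorAlgebra.exteriorPower, pow_zero] at hx
    obtain ⟨c, rfl⟩ := hx
    simp
  | succ p ih =>
    rw [ExteriorAlgebra.exteriorPower, pow_succ'] at hx
    induction hx using Submodule.mul_induction_on' with
    | mem_mul_mem m hm y hy =>
      obtain ⟨v, rfl⟩ := hm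
      rw [map_mul, involute_ι', ih hy, pow_succ']
      simp
    | add a _ b _ ha hb => rw [map_add, ha, hb, smul_add]

theorem mul_ι_eq (v : V) (x : ExteriorAlgebra ℂ V) :
    x * ExteriorAlgebra.ι ℂ v = ExteriorAlgebra.ι ℂ v * CliffordAlgebra.involute x := by
  induction x using exterior_induction with
  | one => simp
  | add a b ha hb => simp only [add_mul, map_add, ha, hb, mul_add]
  | smul c a ha => simp only [smul_mul_assoc, map_smul, ha, mul_smul_comm]
  | ι_mul u a ha =>
    have h := eq_neg_of_add_eq_zero_left (ExteriorAlgebra.ι_add_mul_swap (R := ℂ) u v)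
    rw [mul_assoc, ha, ← mul_assoc, h, map_mul, involute_ι']
    simp only [neg_mul, mul_neg, mul_assoc]

/-- Elements fixed by the grading involution commute with everything. -/
theorem commute_of_involute_eq {x : ExteriorAlgebra ℂ V} (hx : CliffordAlgebra.involute x = x)
    (y : ExteriorAlgebra ℂ V) : x * y = y * x := by
  induction y using exterior_induction with
  | one => simp
  | add a b ha hb => simp only [add_mul, ha, hb, mul_add]
  | smul c a ha => simp only [smul_mul_assoc, ha, mul_smul_comm]
  | ι_mul u a ha => rw [← mul_assoc, mul_ι_eq, hx, mul_assoc, ha, mul_assoc]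

theorem wedge_top_succ_eq_zero [Module.Finite ℂ V] {n : ℕ} (hn : Module.finrank ℂ V < n)
    {x : ExteriorAlgebra ℂ V} (hx : x ∈ ⋀[ℂ]^n V) : x = 0 := by
  have h : Module.finrank ℂ (⋀[ℂ]^n V) = 0 := by
    rw [exteriorPower.finrank_eq, Nat.choose_eq_zero_of_lt hn]
  have := Module.finrank_zero_iff.mp h
  exact congrArg Subtype.val (Subsingleton.elim (⟨x, hx⟩ : ⋀[ℂ]^n V) 0)

/-- In a product of degree `r + 1`, contraction can be moved from one factor to the other at the
cost of a sign: the product itself vanishes, so this is the derivation rule for its contraction. -/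
theorem mul_koszul [Module.Finite ℂ V] {p q r : ℕ} (h : q + (p + 1) = r)
    (hV : Module.finrank ℂ V = r) (f : Module.Dual ℂ V)
    (β : ⋀[ℂ]^(q + 1) V) (α : ⋀[ℂ]^(p + 1) V) :
    (β : ExteriorAlgebra ℂ V) * CliffordAlgebra.contractLeft f (α : ExteriorAlgebra ℂ V) =
      (-1 : ℂ) ^ q • (CliffordAlgebra.contractLeft f (β : ExteriorAlgebra ℂ V) * α) := by
  have h0 : (β : ExteriorAlgebra ℂ V) * (α : ExteriorAlgebra ℂ V) = 0 :=
    wedge_top_succ_eq_zero (n := (q + 1) + (p + 1)) (by omega) (SetLike.mul_mem_graded β.2 α.2)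
  have h1 := contractLeft_mul f (β : ExteriorAlgebra ℂ V) (α : ExteriorAlgebra ℂ V)
  rw [h0, map_zero, involute_of_mem β.2, smul_mul_assoc, pow_succ, mul_neg, mul_one, neg_smul,
    ← sub_eq_add_neg, eq_comm, sub_eq_zero] at h1
  rw [h1, smul_smul, ← mul_pow]
  simp

/-- Left multiplication by a vector, as a map between exterior powers. -/
def wedgeLeft (q : ℕ) : V →ₗ[ℂ] ⋀[ℂ]^q V →ₗ[ℂ] ⋀[ℂ]^(q + 1) V :=
  LinearMap.mk₂ ℂ
    (fun v x => ⟨ExteriorAlgebra.ι ℂ v * x, by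
      rw [ExteriorAlgebra.exteriorPower, pow_succ']
      exact Submodule.mul_mem_mul ⟨v, rfl⟩ x.2⟩)
    (fun v v' x => by ext; simp [add_mul])
    (fun c v x => by ext; simp)
    (fun v x x' => by ext; simp [mul_add])
    (fun c v x => by ext; simp)

@[simp] theorem coe_wedgeLeft (v : V) (q : ℕ) (x : ⋀[ℂ]^q V) :
    (wedgeLeft q v x : ExteriorAlgebra ℂ V) = ExteriorAlgebra.ι ℂ v * x := rfl

@[simp] theorem coe_koszul (f : Module.Dual ℂ V) (p : ℕ) (x : ⋀[ℂ]^(p + 1) V) :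
    (koszul f p x : ExteriorAlgebra ℂ V) =
      CliffordAlgebra.contractLeft f (x : ExteriorAlgebra ℂ V) := rfl

theorem wedgeLeft_ιMulti (v : V) (q : ℕ) (e : Fin q → V) :
    wedgeLeft q v (exteriorPower.ιMulti ℂ q e) = exteriorPower.ιMulti ℂ (q + 1) (Fin.cons v e) := by
  ext
  simp [ExteriorAlgebra.ιMulti_succ_apply, Matrix.vecTail, Function.comp_def]

theorem koszul_ιMulti (f : Module.Dual ℂ V) (p : ℕ) (e : Fin (p + 1) → V) :
    koszul f p (exteriorPower.ιMulti ℂ (p + 1) e) =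
      ∑ i : Fin (p + 1), ((-1 : ℂ) ^ (i : ℕ) * f (e i)) •
        exteriorPower.ιMulti ℂ p (fun j => e (i.succAbove j)) := by
  ext
  simp only [coe_koszul, exteriorPower.ιMulti_apply_coe, Submodule.coe_sum, Submodule.coe_smul]
  induction p with
  | zero =>
    simp [ExteriorAlgebra.ιMulti_succ_apply, Algebra.algebraMap_eq_smul_one]
  | succ p ih =>
    rw [ExteriorAlgebra.ιMulti_succ_apply, contractLeft_ι_mul', ih (Matrix.vecTail e),
      Fin.sum_univ_succ (n := p + 1), Finset.mul_sum, sub_eq_add_neg, ← Finset.sum_neg_distrib]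
    simp only [Fin.val_zero, pow_zero, one_mul, Fin.succAbove_zero, Fin.val_succ]
    refine congrArg₂ _ rfl (Finset.sum_congr rfl fun i _ => ?_)
    rw [ExteriorAlgebra.ιMulti_succ_apply (v := fun j => e (i.succ.succAbove j))]
    simp [Matrix.vecTail, Function.comp_def, pow_succ]

/-- Exterior multiplication by a covector is the transpose of contraction with it. -/
theorem pairingDual_wedgeLeft (f : Module.Dual ℂ V) (q : ℕ) (ξ : ⋀[ℂ]^q (Module.Dual ℂ V))
    (β : ⋀[ℂ]^(q + 1) V) :
    exteriorPower.pairingDual ℂ V (q + 1) (wedgeLeft q f ξ) β =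
      exteriorPower.pairingDual ℂ V q ξ (koszul f q β) := by
  suffices h : exteriorPower.pairingDual ℂ V (q + 1) ∘ₗ wedgeLeft q f =
      (koszul f q).dualMap ∘ₗ exteriorPower.pairingDual ℂ V q from
    LinearMap.congr_fun (LinearMap.congr_fun h ξ) β
  apply exteriorPower.linearMap_ext
  ext e v
  simp only [LinearMap.compAlternatingMap_apply, LinearMap.comp_apply, wedgeLeft_ιMulti,
    exteriorPower.pairingDual_ιMulti_ιMulti, LinearMap.dualMap_apply, koszul_ιMulti, map_sum,
    map_smul, smul_eq_mul]
  rw [Matrix.det_succ_column_zero]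
  refine Finset.sum_congr rfl fun i _ => ?_
  simp [Matrix.submatrix]

section Finite

variable [Module.Finite ℂ V]

theorem homEquiv_tmul (q r : ℕ) (ξ : ⋀[ℂ]^q (Module.Dual ℂ V)) (w : ⋀[ℂ]^r V) (β : ⋀[ℂ]^q V) :
    homEquiv q r (ξ ⊗ₜ[ℂ] w) β = exteriorPower.pairingDual ℂ V q ξ β • w := by
  simp [homEquiv]

theorem homEquiv_wedgeLeft (f : Module.Dual ℂ V) (q r : ℕ)
    (x : ⋀[ℂ]^q (Module.Dual ℂ V) ⊗[ℂ] ⋀[ℂ]^r V) :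
    homEquiv (q + 1) r (LinearMap.rTensor _ (wedgeLeft q f) x) = homEquiv q r x ∘ₗ koszul f q := by
  induction x using TensorProduct.induction_on with
  | zero => rw [LinearMap.map_zero, LinearEquiv.map_zero, LinearEquiv.map_zero, LinearMap.zero_comp]
  | add a b ha hb =>
    rw [LinearMap.map_add, LinearEquiv.map_add, ha, hb, LinearEquiv.map_add, LinearMap.add_comp]
  | tmul ξ w =>
    apply LinearMap.ext
    intro β
    rw [LinearMap.rTensor_tmul, LinearMap.comp_apply, homEquiv_tmul, homEquiv_tmul,
      pairingDual_wedgeLeft]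

/-- Under `φ`, the Koszul differential becomes exterior multiplication with the covector, up to
sign. -/
theorem phiTensor_koszul {p q r : ℕ} (h : q + (p + 1) = r) (h' : q + 1 + p = r)
    (hV : Module.finrank ℂ V = r) (f : Module.Dual ℂ V) (α : ⋀[ℂ]^(p + 1) V) :
    phiTensor p (q + 1) r h' hV (koszul f p α) =
      (-1 : ℂ) ^ q • LinearMap.rTensor _ (wedgeLeft q f) (phiTensor (p + 1) q r h hV α) := by
  apply (homEquiv (V := V) (q + 1) r).injective
  rw [map_smul, homEquiv_wedgeLeft]
  simp only [phiTensor, LinearEquiv.trans_apply, LinearEquiv.apply_symm_apply]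
  apply LinearMap.ext
  intro β
  ext
  exact mul_koszul h hV f β α

end Finite

end Koszul

/-! ### Exterior powers of maps with central coefficients -/

section WedgePow

variable {V : Type*} [AddCommGroup V] [Module ℂ V] {L : Type*} [Ring L] [Algebra ℂ L]

/-- The elements of `L ⊗ W` with coefficients in a subspace `S` of `L`. -/
def coeffIn (S : Submodule ℂ L) (W : Type*) [AddCommGroup W] [Module ℂ W] :
    Submodule ℂ (L ⊗[ℂ] W) :=
  LinearMap.range (LinearMap.rTensor W S.subtype)

theorem tmul_mem_coeffIn {S : Submodule ℂ L} {W : Type*} [AddCommGroup W] [Module ℂ W]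
    {s : L} (hs : s ∈ S) (w : W) : s ⊗ₜ[ℂ] w ∈ coeffIn S W :=
  ⟨(⟨s, hs⟩ : S) ⊗ₜ[ℂ] w, rfl⟩

@[elab_as_elim]
theorem coeffIn_induction {S : Submodule ℂ L} {W : Type*} [AddCommGroup W] [Module ℂ W]
    {P : ∀ x : L ⊗[ℂ] W, x ∈ coeffIn S W → Prop} (zero : P 0 (zero_mem _))
    (add : ∀ x y hx hy, P x hx → P y hy → P (x + y) (add_mem hx hy))
    (tmul : ∀ s (hs : s ∈ S) w, P (s ⊗ₜ[ℂ] w) (tmul_mem_coeffIn hs w)) {x : L ⊗[ℂ] W}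
    (hx : x ∈ coeffIn S W) : P x hx := by
  suffices h : ∀ (y : S ⊗[ℂ] W), P (LinearMap.rTensor W S.subtype y) ⟨y, rfl⟩ by
    obtain ⟨y, rfl⟩ := hx
    exact h y
  intro y
  induction y using TensorProduct.induction_on with
  | zero => exact zero
  | add a b ha hb => simpa only [map_add] using add _ _ _ _ ha hb
  | tmul s w => exact tmul _ s.2 _

/-- The centre of `L`, as a subspace. -/
abbrev centre (L : Type*) [Ring L] [Algebra ℂ L] : Submodule ℂ L :=
  Subalgebra.toSubmodule (Subalgebra.center ℂ L)

theorem centre_comm {c : L} (hc : c ∈ centre L) (x : L) : c * x = x * c :=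
  ((Subalgebra.mem_center_iff (R := ℂ)).mp hc x).symm

@[simp] theorem inclOne_tmul (η : L) (v : V) :
    inclOne (η ⊗ₜ[ℂ] v) = η ⊗ₜ[ℂ] ExteriorAlgebra.ι ℂ v := rfl

/-- Vectors with central coefficients anticommute in `L ⊗ ⋀ V`; this is what makes `⋀^q R` well
defined when `R` has coefficients of even degree. -/
theorem inclOne_anticomm {x y : L ⊗[ℂ] V} (hx : x ∈ coeffIn (centre L) V) :
    inclOne x * inclOne y = -(inclOne y * inclOne x) := by
  induction hx using coeffIn_induction with
  | zero => simp
  | add a b _ _ ha hb => simp only [map_add, add_mul, ha, hb, mul_add, neg_add]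
  | tmul c hc v =>
    induction y using TensorProduct.induction_on with
    | zero => simp
    | add a b ha hb => simp only [map_add, add_mul, ha, hb, mul_add, neg_add]
    | tmul η w =>
      have h := eq_neg_of_add_eq_zero_left (ExteriorAlgebra.ι_add_mul_swap (R := ℂ) v w)
      rw [inclOne_tmul, inclOne_tmul, Algebra.TensorProduct.tmul_mul_tmul,
        Algebra.TensorProduct.tmul_mul_tmul, h, centre_comm hc, TensorProduct.tmul_neg]

theorem inclOne_mul_self {x : L ⊗[ℂ] V} (hx : x ∈ coeffIn (centre L) V) :
    inclOne x * inclOne x = 0 := by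
  have h := inclOne_anticomm (y := x) hx
  have h2 : (2 : ℂ) • (inclOne x * inclOne x) = 0 := by
    rw [two_smul]; exact add_eq_zero_iff_eq_neg.mpr h
  exact (smul_eq_zero.mp h2).resolve_left two_ne_zero

/-- The algebra homomorphism `⋀ V → L ⊗ ⋀ V` extending a map `R : V → L ⊗ V` with central
coefficients. -/
def wedgeHom (R : V →ₗ[ℂ] L ⊗[ℂ] V) (hR : ∀ v, R v ∈ coeffIn (centre L) V) :
    ExteriorAlgebra ℂ V →ₐ[ℂ] L ⊗[ℂ] ExteriorAlgebra ℂ V :=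
  ExteriorAlgebra.lift ℂ ⟨inclOne ∘ₗ R, fun v => inclOne_mul_self (hR v)⟩

theorem wedgeHom_ι (R : V →ₗ[ℂ] L ⊗[ℂ] V) (hR : ∀ v, R v ∈ coeffIn (centre L) V) (v : V) :
    wedgeHom R hR (ExteriorAlgebra.ι ℂ v) = inclOne (R v) := by
  simp [wedgeHom]

theorem gradeProj_coe (q : ℕ) (x : ⋀[ℂ]^q V) : gradeProj q (x : ExteriorAlgebra ℂ V) = x := by
  simp only [gradeProj, LinearMap.comp_apply, LinearEquiv.coe_coe,
    DirectSum.decomposeLinearEquiv_apply, DirectSum.decompose_coe]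
  exact DirectSum.of_eq_same (β := fun i => ⋀[ℂ]^i V) q x

/-- Exterior multiplication with an element of `L ⊗ V`. -/
def wedgeLeftForm (q : ℕ) : L ⊗[ℂ] V →ₗ[ℂ] L ⊗[ℂ] ⋀[ℂ]^q V →ₗ[ℂ] L ⊗[ℂ] ⋀[ℂ]^(q + 1) V :=
  TensorProduct.map₂ (LinearMap.mul ℂ L) (wedgeLeft q)

theorem coe_wedgeLeftForm (q : ℕ) (x : L ⊗[ℂ] V) (y : L ⊗[ℂ] ⋀[ℂ]^q V) :
    LinearMap.lTensor L (⋀[ℂ]^(q + 1) V).subtype (wedgeLeftForm q x y) =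
      inclOne x * LinearMap.lTensor L (⋀[ℂ]^q V).subtype y := by
  induction x using TensorProduct.induction_on with
  | zero => simp
  | add a b ha hb => simp only [map_add, add_mul, ← ha, ← hb, LinearMap.add_apply]
  | tmul η v =>
    induction y using TensorProduct.induction_on with
    | zero => simp
    | add a b ha hb => simp only [map_add, mul_add, ← ha, ← hb]
    | tmul ζ ξ => simp [wedgeLeftForm]

theorem wedgeHom_mem (R : V →ₗ[ℂ] L ⊗[ℂ] V) (hR : ∀ v, R v ∈ coeffIn (centre L) V) (q : ℕ)
    (x : ExteriorAlgebra ℂ V) (hx : x ∈ ⋀[ℂ]^q V) :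
    wedgeHom R hR x ∈ LinearMap.range (LinearMap.lTensor L (⋀[ℂ]^q V).subtype) := by
  induction q generalizing x with
  | zero =>
    rw [ExteriorAlgebra.exteriorPower, pow_zero] at hx
    obtain ⟨c, rfl⟩ := hx
    refine ⟨algebraMap ℂ L c ⊗ₜ[ℂ] ⟨1, SetLike.GradedOne.one_mem⟩, ?_⟩
    simp [Algebra.TensorProduct.one_def, Algebra.algebraMap_eq_smul_one, TensorProduct.smul_tmul']
  | succ q ih =>
    rw [ExteriorAlgebra.exteriorPower, pow_succ'] at hx
    induction hx using Submodule.mul_induction_on' with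
    | mem_mul_mem m hm y hy =>
      obtain ⟨v, rfl⟩ := hm
      obtain ⟨y', hy'⟩ := ih y hy
      rw [map_mul, wedgeHom_ι, ← hy', ← coe_wedgeLeftForm]
      exact ⟨_, rfl⟩
    | add a _ b _ ha hb => rw [map_add]; exact Submodule.add_mem _ ha hb

/-- The map `⋀^q R` is the restriction of the algebra homomorphism `⋀ V → L ⊗ ⋀ V` which extends
`R`: for central coefficients the antisymmetrisation is superfluous. -/
theorem coe_wedgePow (R : V →ₗ[ℂ] L ⊗[ℂ] V) (hR : ∀ v, R v ∈ coeffIn (centre L) V) (q : ℕ)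
    (ξ : ⋀[ℂ]^q V) :
    LinearMap.lTensor L (⋀[ℂ]^q V).subtype (wedgePow R q ξ) = wedgeHom R hR ξ := by
  obtain ⟨y, hy⟩ := wedgeHom_mem R hR q ξ ξ.2
  have key : wedgePow R q ξ = LinearMap.lTensor L (gradeProj q) (wedgeHom R hR ξ) := by
    suffices h : wedgePow R q = LinearMap.lTensor L (gradeProj q) ∘ₗ
        (wedgeHom R hR).toLinearMap ∘ₗ (⋀[ℂ]^q V).subtype from LinearMap.congr_fun h ξ
    apply exteriorPower.linearMap_ext
    ext e
    have hm : (MultilinearMap.mkPiAlgebraFin ℂ q (L ⊗[ℂ] ExteriorAlgebra ℂ V)).compLinearMap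
        (fun _ => inclOne ∘ₗ R) = (((wedgeHom R hR).toLinearMap.compAlternatingMap
          (ExteriorAlgebra.ιMulti ℂ q) : V [⋀^Fin q]→ₗ[ℂ] L ⊗[ℂ] ExteriorAlgebra ℂ V) :
          MultilinearMap ℂ (fun _ : Fin q => V) (L ⊗[ℂ] ExteriorAlgebra ℂ V)) := by
      ext e
      simp [ExteriorAlgebra.ιMulti_apply, map_list_prod, List.map_ofFn, Function.comp_def,
        wedgeHom_ι]
    simp only [wedgePow, hm, AlternatingMap.coe_alternatization, LinearMap.compAlternatingMap_apply,
      LinearMap.comp_apply, exteriorPower.alternatingMapLinearEquiv_apply_ιMulti,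
      Fintype.card_fin]
    rw [← Nat.cast_smul_eq_nsmul ℂ, smul_smul,
      inv_mul_cancel₀ (Nat.cast_ne_zero.mpr q.factorial_ne_zero), one_smul]
    rfl
  rw [key, ← hy]
  congr 1
  have : LinearMap.lTensor L (gradeProj q) ∘ₗ LinearMap.lTensor L (⋀[ℂ]^q V).subtype =
      LinearMap.id := by
    rw [← LinearMap.lTensor_comp]
    have : gradeProj q ∘ₗ (⋀[ℂ]^q V).subtype = LinearMap.id :=
      LinearMap.ext fun x => gradeProj_coe q x
    rw [this, LinearMap.lTensor_id]
  exact LinearMap.congr_fun this y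

theorem coe_wedgePow_ιMulti (R : V →ₗ[ℂ] L ⊗[ℂ] V) (hR : ∀ v, R v ∈ coeffIn (centre L) V) (q : ℕ)
    (e : Fin q → V) :
    LinearMap.lTensor L (⋀[ℂ]^q V).subtype (wedgePow R q (exteriorPower.ιMulti ℂ q e)) =
      (List.ofFn fun i => inclOne (R (e i))).prod := by
  rw [coe_wedgePow R hR]
  simp [ExteriorAlgebra.ιMulti_apply, map_list_prod, List.map_ofFn, Function.comp_def, wedgeHom_ι]

theorem lTensor_subtype_injective (q : ℕ) :
    Function.Injective (LinearMap.lTensor L (⋀[ℂ]^q V).subtype) :=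
  Module.Flat.lTensor_preserves_injective_linearMap _ (⋀[ℂ]^q V).injective_subtype

theorem wedgePow_wedgeLeft (R : V →ₗ[ℂ] L ⊗[ℂ] V) (hR : ∀ v, R v ∈ coeffIn (centre L) V) (q : ℕ)
    (v : V) (ξ : ⋀[ℂ]^q V) :
    wedgePow R (q + 1) (wedgeLeft q v ξ) = wedgeLeftForm q (R v) (wedgePow R q ξ) := by
  apply lTensor_subtype_injective
  rw [coe_wedgePow R hR, coe_wedgeLeftForm, coe_wedgePow R hR, coe_wedgeLeft, map_mul, wedgeHom_ι]

@[simp] theorem contractForm_tmul (η : L) (f : Module.Dual ℂ V) (ζ : L) (x : ExteriorAlgebra ℂ V) :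
    contractForm (η ⊗ₜ[ℂ] f) (ζ ⊗ₜ[ℂ] x) = (ζ * η) ⊗ₜ[ℂ] CliffordAlgebra.contractLeft f x := by
  simp [contractForm]

/-- Iterated contraction of a multivector with a list of covectors. -/
def contractList (l : List (Module.Dual ℂ V)) (x : ExteriorAlgebra ℂ V) : ExteriorAlgebra ℂ V :=
  l.foldr (fun f y => CliffordAlgebra.contractLeft f y) x

/-- Iterated contraction of an element of `L ⊗ ⋀ V` with a list of elements of `L ⊗ V^∨`. -/
def contractFormList (l : List (L ⊗[ℂ] Module.Dual ℂ V)) (x : L ⊗[ℂ] ExteriorAlgebra ℂ V) :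
    L ⊗[ℂ] ExteriorAlgebra ℂ V :=
  l.foldr (fun Θ y => contractForm Θ y) x

theorem contractList_mem (l : List (Module.Dual ℂ V)) (p : ℕ) (x : ExteriorAlgebra ℂ V)
    (hx : x ∈ ⋀[ℂ]^(l.length + p) V) : contractList l x ∈ ⋀[ℂ]^p V := by
  induction l generalizing p with
  | nil => simpa [contractList] using hx
  | cons f l ih =>
    refine contract_mem f p _ (ih (p + 1) ?_)
    have e : (f :: l).length + p = l.length + (p + 1) := by simp; omega
    rwa [e] at hx

section Finite

variable [Module.Finite ℂ V]

/-- Contraction, transported to `⋀^q V^∨ ⊗ ⋀^r V` by `φ` and with coefficients in the centre of `L`,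
is exterior multiplication up to sign. -/
theorem contractForm_phiTensor_symm {p q r : ℕ} (h : q + (p + 1) = r) (h' : q + 1 + p = r)
    (hV : Module.finrank ℂ V = r) {Θ : L ⊗[ℂ] Module.Dual ℂ V}
    (hΘ : Θ ∈ coeffIn (centre L) (Module.Dual ℂ V)) (Y : L ⊗[ℂ] ⋀[ℂ]^q (Module.Dual ℂ V))
    (w : ⋀[ℂ]^r V) :
    contractForm Θ (LinearMap.lTensor L (⋀[ℂ]^(p + 1) V).subtype
        (LinearMap.lTensor L (phiTensor (p + 1) q r h hV).symm.toLinearMap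
          (TensorProduct.assoc ℂ L _ _ (Y ⊗ₜ[ℂ] w)))) =
      (-1 : ℂ) ^ q • LinearMap.lTensor L (⋀[ℂ]^p V).subtype
        (LinearMap.lTensor L (phiTensor p (q + 1) r h' hV).symm.toLinearMap
          (TensorProduct.assoc ℂ L _ _ (wedgeLeftForm q Θ Y ⊗ₜ[ℂ] w))) := by
  induction hΘ using coeffIn_induction with
  | zero => simp
  | add a b _ _ ha hb =>
    simp only [map_add, LinearMap.add_apply, TensorProduct.add_tmul, smul_add, ha, hb]
  | tmul c hc g =>
    induction Y using TensorProduct.induction_on with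
    | zero => simp
    | add a b ha hb => simp only [map_add, TensorProduct.add_tmul, smul_add, ha, hb]
    | tmul ζ ξ =>
      have e : (phiTensor p (q + 1) r h' hV).symm (wedgeLeft q g ξ ⊗ₜ[ℂ] w) =
          (-1 : ℂ) ^ q • koszul g p ((phiTensor (p + 1) q r h hV).symm (ξ ⊗ₜ[ℂ] w)) := by
        rw [LinearEquiv.symm_apply_eq, LinearEquiv.map_smul, phiTensor_koszul h h' hV,
          LinearEquiv.apply_symm_apply, smul_smul, ← mul_pow]
        simp
      simp only [wedgeLeftForm, TensorProduct.map₂_apply_tmul, TensorProduct.map_tmul,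
        TensorProduct.assoc_tmul, LinearMap.lTensor_tmul, LinearEquiv.coe_coe, e, contractForm_tmul,
        LinearMap.mul_apply']
      rw [map_smul, TensorProduct.tmul_smul, smul_smul, ← mul_pow]
      simp [centre_comm hc ζ]

/-- The conjugate of `⋀ R` by `φ` turns contraction with `f` into contraction with `R f`. Both
occurrences of `φ` contribute the same sign `(-1)^q`. -/
theorem twist_koszul (R : Module.Dual ℂ V →ₗ[ℂ] L ⊗[ℂ] Module.Dual ℂ V)
    (hR : ∀ f, R f ∈ coeffIn (centre L) (Module.Dual ℂ V)) {p q r : ℕ} (h : q + (p + 1) = r)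
    (h' : q + 1 + p = r) (hV : Module.finrank ℂ V = r) (f : Module.Dual ℂ V) (α : ⋀[ℂ]^(p + 1) V) :
    LinearMap.lTensor L (⋀[ℂ]^p V).subtype (twist R p (q + 1) r h' hV (koszul f p α)) =
      contractForm (R f) (LinearMap.lTensor L (⋀[ℂ]^(p + 1) V).subtype
        (twist R (p + 1) q r h hV α)) := by
  simp only [twist, LinearMap.comp_apply, LinearEquiv.coe_coe, phiTensor_koszul h h' hV, map_smul]
  generalize phiTensor (p + 1) q r h hV α = x
  induction x using TensorProduct.induction_on with
  | zero => simp
  | add a b ha hb => simp only [map_add, smul_add, ha, hb]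
  | tmul ξ w =>
    rw [LinearMap.rTensor_tmul, LinearMap.rTensor_tmul, LinearMap.rTensor_tmul,
      wedgePow_wedgeLeft R hR, contractForm_phiTensor_symm h h' hV (hR f)]

/-- In top degree `⋀^0 R` is the identity, hence so is its conjugate. -/
theorem twist_top (R : Module.Dual ℂ V →ₗ[ℂ] L ⊗[ℂ] Module.Dual ℂ V)
    (hR : ∀ f, R f ∈ coeffIn (centre L) (Module.Dual ℂ V)) {q r : ℕ} (h : q + r = r)
    (hV : Module.finrank ℂ V = r) (α : ⋀[ℂ]^r V) : twist R r q r h hV α = 1 ⊗ₜ[ℂ] α := by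
  obtain rfl : q = 0 := by omega
  have e : phiTensor r 0 r h hV α = exteriorPower.ιMulti ℂ 0 ![] ⊗ₜ[ℂ] α := by
    rw [phiTensor, LinearEquiv.trans_apply, LinearEquiv.symm_apply_eq]
    apply exteriorPower.linearMap_ext
    ext v
    simp [homEquiv_tmul, phi, wedgeRight]
  have e1 : wedgePow R 0 (exteriorPower.ιMulti ℂ 0 ![]) =
      1 ⊗ₜ[ℂ] exteriorPower.ιMulti ℂ 0 ![] := by
    apply lTensor_subtype_injective
    rw [coe_wedgePow_ιMulti R hR]
    simp [Algebra.TensorProduct.one_def]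
  simp only [twist, LinearMap.comp_apply, LinearEquiv.coe_coe, e, LinearMap.rTensor_tmul, e1,
    TensorProduct.assoc_tmul, LinearMap.lTensor_tmul]
  rw [← e, LinearEquiv.symm_apply_apply]

/-- `twist R` replaces contraction of a top degree multivector with `f₁, ..., f_q` by contraction
with `R f₁, ..., R f_q`. -/
theorem twist_contractList (R : Module.Dual ℂ V →ₗ[ℂ] L ⊗[ℂ] Module.Dual ℂ V)
    (hR : ∀ f, R f ∈ coeffIn (centre L) (Module.Dual ℂ V)) {r : ℕ}
    (hV : Module.finrank ℂ V = r) (l : List (Module.Dual ℂ V)) (w : ⋀[ℂ]^r V) (p q : ℕ)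
    (h : q + p = r) (hl : l.length = q) (α : ⋀[ℂ]^p V)
    (hα : (α : ExteriorAlgebra ℂ V) = contractList l w) :
    LinearMap.lTensor L (⋀[ℂ]^p V).subtype (twist R p q r h hV α) =
      contractFormList (l.map R) (1 ⊗ₜ[ℂ] (w : ExteriorAlgebra ℂ V)) := by
  induction l generalizing p q with
  | nil =>
    obtain rfl : p = r := by simp at hl; omega
    obtain rfl : α = w := Subtype.ext hα
    rw [twist_top R hR]
    rfl
  | cons f l ih =>
    obtain ⟨q, rfl⟩ : ∃ k, q = k + 1 := ⟨l.length, by simpa using hl.symm⟩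
    have hl' : l.length = q := by simpa using hl
    let β : ⋀[ℂ]^(p + 1) V := ⟨contractList l w, contractList_mem l (p + 1) w (by
      have e : l.length + (p + 1) = r := by omega
      rw [e]; exact w.2)⟩
    have hβ : α = koszul f p β := Subtype.ext hα
    rw [hβ, twist_koszul R hR (by omega) h hV f β, ih (p + 1) q (by omega) hl' β rfl]
    rfl

end Finite

end WedgePow

/-! ### Determinants and iterated contractions -/

section Determinant

variable {V : Type*} [AddCommGroup V] [Module ℂ V] {L : Type*} [Ring L] [Algebra ℂ L]

@[simp] theorem evalAt_tmul (f : Module.Dual ℂ V) (η : L) (v : V) :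
    evalAt f (η ⊗ₜ[ℂ] v) = f v • η := by
  simp [evalAt]

/-- An element of `L ⊗ V` is determined by its coefficients in a basis of `V`. -/
theorem sum_evalAt_tmul {ι : Type*} [Fintype ι] (b : ι → V) (c : ι → Module.Dual ℂ V)
    (hb : ∀ v, ∑ i, c i v • b i = v) (x : L ⊗[ℂ] V) : ∑ i, evalAt (c i) x ⊗ₜ[ℂ] b i = x := by
  induction x using TensorProduct.induction_on with
  | zero => simp
  | add x y hx hy => simp only [map_add, TensorProduct.add_tmul, Finset.sum_add_distrib, hx, hy]
  | tmul η v =>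
    simp only [evalAt_tmul, TensorProduct.smul_tmul, ← TensorProduct.tmul_sum, hb]

theorem evalAt_mem {S : Submodule ℂ L} (f : Module.Dual ℂ V) {x : L ⊗[ℂ] V}
    (hx : x ∈ coeffIn S V) : evalAt f x ∈ S := by
  induction hx using coeffIn_induction with
  | zero => simp
  | add a b _ _ ha hb => rw [map_add]; exact add_mem ha hb
  | tmul s hs w => rw [evalAt_tmul]; exact S.smul_mem _ hs

theorem prod_ofFn_tmul {A : Type*} [Ring A] [Algebra ℂ A] {n : ℕ} (a : Fin n → L) (c : Fin n → A) :
    (List.ofFn fun i => a i ⊗ₜ[ℂ] c i).prod =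
      (List.ofFn a).prod ⊗ₜ[ℂ] (List.ofFn c).prod := by
  induction n with
  | zero => simp [Algebra.TensorProduct.one_def]
  | succ n ih => simp [List.ofFn_succ, ih]

/-- The exterior product of the rows of a matrix with entries in `L`. -/
theorem prod_inclOne_sum {r : ℕ} (b : Fin r → V) (M : Matrix (Fin r) (Fin r) L) :
    (List.ofFn fun i => inclOne (∑ j, M i j ⊗ₜ[ℂ] b j)).prod =
      detForm M ⊗ₜ[ℂ] ExteriorAlgebra.ιMulti ℂ r b := by
  have h := MultilinearMap.map_sum
    (MultilinearMap.mkPiAlgebraFin ℂ r (L ⊗[ℂ] ExteriorAlgebra ℂ V))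
    (fun i (j : Fin r) => M i j ⊗ₜ[ℂ] ExteriorAlgebra.ι ℂ (b j))
  simp only [MultilinearMap.mkPiAlgebraFin_apply, prod_ofFn_tmul] at h
  simp only [map_sum, inclOne_tmul, h, detForm, TensorProduct.sum_tmul]
  symm
  refine Finset.sum_of_injOn (fun σ : Equiv.Perm (Fin r) => (σ : Fin r → Fin r))
    (fun σ _ τ _ h => Equiv.coe_fn_injective h) (fun _ _ => Finset.mem_univ _)
    (fun k _ hk => ?_) (fun σ _ => ?_)
  · have hk' : ¬ Function.Injective k := fun hinj =>
      hk ⟨Equiv.ofBijective k (Finite.injective_iff_bijective.mp hinj), by simp, rfl⟩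
    have h0 := ExteriorAlgebra.ιMulti_eq_zero_of_not_inj (R := ℂ) (v := fun i => b (k i))
      (fun hinj => hk' fun i j hij => hinj (by simp [hij]))
    rw [ExteriorAlgebra.ιMulti_apply] at h0
    rw [h0, TensorProduct.tmul_zero]
  · have h1 := (ExteriorAlgebra.ιMulti ℂ r).map_perm b σ
    rw [ExteriorAlgebra.ιMulti_apply] at h1
    simp only [Function.comp_apply] at h1
    rw [h1]
    rcases Int.units_eq_one_or (Equiv.Perm.sign σ) with e | e <;> simp [e, TensorProduct.neg_tmul,
      TensorProduct.tmul_neg]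

/-- In top degree, `⋀ R` is multiplication by the determinant of `R`. -/
theorem wedgePow_top (R : V →ₗ[ℂ] L ⊗[ℂ] V) (hR : ∀ v, R v ∈ coeffIn (centre L) V) {r : ℕ}
    (b : Module.Basis (Fin r) ℂ V) (ξ : ⋀[ℂ]^r V) :
    wedgePow R r ξ = detForm (Matrix.of fun i j => evalAt (b.coord j) (R (b i))) ⊗ₜ[ℂ] ξ := by
  set d := detForm (Matrix.of fun i j => evalAt (b.coord j) (R (b i)))
  -- both sides are alternating, so it suffices to compare them on the basis itself
  suffices h : wedgePow R r = TensorProduct.mk ℂ L (⋀[ℂ]^r V) d from LinearMap.congr_fun h ξ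
  apply exteriorPower.linearMap_ext
  refine Module.Basis.ext_alternating b fun v hv => ?_
  obtain ⟨σ, rfl⟩ : ∃ σ : Equiv.Perm (Fin r), v = σ :=
    ⟨Equiv.ofBijective v (Finite.injective_iff_bijective.mp hv), rfl⟩
  have hp := fun g : V [⋀^Fin r]→ₗ[ℂ] L ⊗[ℂ] ⋀[ℂ]^r V => g.map_perm b σ
  simp only [Function.comp_def] at hp
  rw [hp, hp]
  congr 1
  apply lTensor_subtype_injective
  simp only [LinearMap.compAlternatingMap_apply, coe_wedgePow_ιMulti R hR]
  have e : ∀ i, R (b i) = ∑ j, evalAt (b.coord j) (R (b i)) ⊗ₜ[ℂ] b j := fun i =>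
    (sum_evalAt_tmul b b.coord (fun v => by simp) _).symm
  have e' : (List.ofFn fun i => inclOne (R (b i))).prod = (List.ofFn fun i =>
      inclOne (∑ j, (Matrix.of fun i j => evalAt (b.coord j) (R (b i))) i j ⊗ₜ[ℂ] b j)).prod := by
    congr 2
    funext i
    rw [e i]
    simp only [Matrix.of_apply, ← e i]
  rw [e', prod_inclOne_sum]
  rfl

/-- Contractions anticommute, also with form coefficients, as soon as one of them has central
coefficients. -/
theorem contractForm_comm {Θ Ξ : L ⊗[ℂ] Module.Dual ℂ V}
    (hΞ : Ξ ∈ coeffIn (centre L) (Module.Dual ℂ V)) (x : L ⊗[ℂ] ExteriorAlgebra ℂ V) :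
    contractForm Ξ (contractForm Θ x) = -contractForm Θ (contractForm Ξ x) := by
  induction hΞ using coeffIn_induction with
  | zero => simp
  | add a b _ _ ha hb => simp only [map_add, LinearMap.add_apply, ha, hb, neg_add]
  | tmul c hc f =>
    induction Θ using TensorProduct.induction_on with
    | zero => simp
    | add a b ha hb => simp only [map_add, LinearMap.add_apply, ha, hb, neg_add]
    | tmul η g =>
      induction x using TensorProduct.induction_on with
      | zero => simp
      | add a b ha hb => simp only [map_add, ha, hb, neg_add]
      | tmul ζ y =>
        have h := CliffordAlgebra.contractLeft_comm (Q := (0 : QuadraticForm ℂ V)) (d := f)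
          (d' := g) y
        rw [contractForm_tmul, contractForm_tmul, contractForm_tmul, contractForm_tmul, h,
          TensorProduct.tmul_neg, mul_assoc, mul_assoc, centre_comm hc]

theorem contractLeft_map {V' : Type*} [AddCommGroup V'] [Module ℂ V'] (T : V →ₗ[ℂ] V')
    (f : Module.Dual ℂ V') (x : ExteriorAlgebra ℂ V) :
    ExteriorAlgebra.map T (CliffordAlgebra.contractLeft (f ∘ₗ T) x) =
      CliffordAlgebra.contractLeft f (ExteriorAlgebra.map T x) := by
  induction x using exterior_induction with
  | one => rw [contractLeft_one', map_one, contractLeft_one', map_zero]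
  | add a b ha hb => simp only [map_add, ha, hb]
  | smul c a ha => simp only [map_smul, ha]
  | ι_mul v a ha =>
    rw [contractLeft_ι_mul', map_sub, map_mul, map_smul, ha, map_mul, ExteriorAlgebra.map_apply_ι,
      contractLeft_ι_mul', LinearMap.comp_apply]

/-- Contraction commutes with a change of the coefficient algebra and of the vector space. -/
theorem map_contractForm {V' : Type*} [AddCommGroup V'] [Module ℂ V'] {L' : Type*} [Ring L']
    [Algebra ℂ L'] (h : L →ₐ[ℂ] L') (T : V →ₗ[ℂ] V') (Θ : L ⊗[ℂ] Module.Dual ℂ V')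
    (x : L ⊗[ℂ] ExteriorAlgebra ℂ V) :
    TensorProduct.map h.toLinearMap (ExteriorAlgebra.map T).toLinearMap
        (contractForm (LinearMap.lTensor L T.dualMap Θ) x) =
      contractForm (LinearMap.rTensor _ h.toLinearMap Θ)
        (TensorProduct.map h.toLinearMap (ExteriorAlgebra.map T).toLinearMap x) := by
  induction Θ using TensorProduct.induction_on with
  | zero => simp
  | add a b ha hb => simp only [map_add, LinearMap.add_apply, ha, hb]
  | tmul η f =>
    induction x using TensorProduct.induction_on with
    | zero => simp
    | add a b ha hb => simp only [map_add, ha, hb]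
    | tmul ζ y =>
      have e : T.dualMap f = f ∘ₗ T := rfl
      simp [e, contractLeft_map]

theorem degreeZero_map {V' : Type*} [AddCommGroup V'] [Module ℂ V'] {L' : Type*} [Ring L']
    [Algebra ℂ L'] (h : L →ₐ[ℂ] L') (T : V →ₗ[ℂ] V') (x : L ⊗[ℂ] ExteriorAlgebra ℂ V) :
    degreeZero (TensorProduct.map h.toLinearMap (ExteriorAlgebra.map T).toLinearMap x) =
      h (degreeZero x) := by
  induction x using TensorProduct.induction_on with
  | zero => simp
  | add a b ha hb => simp only [map_add, ha, hb]
  | tmul ζ y =>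
    have e : ExteriorAlgebra.algebraMapInv (ExteriorAlgebra.map T y) =
        ExteriorAlgebra.algebraMapInv y := by
      have : ExteriorAlgebra.algebraMapInv.comp (ExteriorAlgebra.map T) =
          (ExteriorAlgebra.algebraMapInv (R := ℂ) (M := V)) := by
        ext v
        simp [ExteriorAlgebra.algebraMapInv]
      exact DFunLike.congr_fun this y
    simp [degreeZero, e]

theorem contractForm_mem {S S' : Submodule ℂ L} {Θ : L ⊗[ℂ] Module.Dual ℂ V}
    {x : L ⊗[ℂ] ExteriorAlgebra ℂ V} (hx : x ∈ coeffIn S (ExteriorAlgebra ℂ V))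
    (hΘ : Θ ∈ coeffIn S' (Module.Dual ℂ V)) :
    contractForm Θ x ∈ coeffIn (S * S') (ExteriorAlgebra ℂ V) := by
  induction hΘ using coeffIn_induction with
  | zero => simp
  | add a b _ _ ha hb => simp only [map_add, LinearMap.add_apply]; exact add_mem ha hb
  | tmul c hc f =>
    induction hx using coeffIn_induction with
    | zero => simp
    | add a b _ _ ha hb => rw [map_add]; exact add_mem ha hb
    | tmul s hs y =>
      rw [contractForm_tmul]
      exact tmul_mem_coeffIn (Submodule.mul_mem_mul hs hc) _

theorem degreeZero_mem {S : Submodule ℂ L} {x : L ⊗[ℂ] ExteriorAlgebra ℂ V}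
    (hx : x ∈ coeffIn S (ExteriorAlgebra ℂ V)) : degreeZero x ∈ S := by
  induction hx using coeffIn_induction with
  | zero => simp
  | add a b _ _ ha hb => rw [map_add]; exact add_mem ha hb
  | tmul s hs y => simpa [degreeZero] using S.smul_mem _ hs

/-- A decomposable multivector of degree less than the dimension is a contraction: a covector
`f` vanishing on its factors and a vector `v` with `f v = 1` recover it from `v ∧ e`. -/
theorem exists_contractLeft_eq_ιMulti {p : ℕ} (hp : p < Module.finrank ℂ V) (e : Fin p → V) :
    ∃ (f : Module.Dual ℂ V) (v : V),
      CliffordAlgebra.contractLeft f (ExteriorAlgebra.ι ℂ v * ExteriorAlgebra.ιMulti ℂ p e) =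
        ExteriorAlgebra.ιMulti ℂ p e := by
  have hlt : Submodule.span ℂ (Set.range e) < ⊤ := by
    refine lt_top_iff_ne_top.mpr fun h => ?_
    have h1 := finrank_range_le_card (R := ℂ) e
    rw [Set.finrank, h, finrank_top, Fintype.card_fin] at h1
    omega
  obtain ⟨f, hf, hle⟩ := Submodule.exists_le_ker_of_lt_top _ hlt
  obtain ⟨v, hv⟩ : ∃ v, f v ≠ 0 := by
    by_contra! h
    exact hf (LinearMap.ext h)
  have hz : ∀ (n : ℕ) (e : Fin n → V), (∀ i, f (e i) = 0) →
      CliffordAlgebra.contractLeft f (ExteriorAlgebra.ιMulti ℂ n e) = 0 := by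
    intro n
    induction n with
    | zero => intro e _; rw [ExteriorAlgebra.ιMulti_zero_apply, contractLeft_one']
    | succ n ih =>
      intro e he
      rw [ExteriorAlgebra.ιMulti_succ_apply, contractLeft_ι_mul', he,
        ih (Matrix.vecTail e) fun i => he i.succ]
      simp
  refine ⟨(f v)⁻¹ • f, v, ?_⟩
  rw [contractLeft_ι_mul', map_smul, LinearMap.smul_apply, LinearMap.smul_apply,
    hz p e fun i => hle (Submodule.subset_span ⟨i, rfl⟩)]
  simp [hv]

/-- Every multivector is a sum of iterated contractions of multivectors of top degree. -/
theorem mem_span_contractList {p q r : ℕ} (h : q + p = r)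
    (hV : Module.finrank ℂ V = r) (x : ExteriorAlgebra ℂ V) (hx : x ∈ ⋀[ℂ]^p V) :
    x ∈ Submodule.span ℂ {y | ∃ (l : List (Module.Dual ℂ V)) (w : ⋀[ℂ]^r V), l.length = q ∧
      y = contractList l (w : ExteriorAlgebra ℂ V)} := by
  induction q generalizing p x with
  | zero =>
    obtain rfl : p = r := by omega
    exact Submodule.subset_span ⟨[], ⟨x, hx⟩, rfl, rfl⟩
  | succ q ih =>
    rw [← ExteriorAlgebra.ιMulti_span_fixedDegree] at hx
    refine Submodule.span_le.mpr ?_ hx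
    rintro _ ⟨e, rfl⟩
    obtain ⟨f, v, hfv⟩ := exists_contractLeft_eq_ιMulti (p := p) (by omega) e
    have hm : ExteriorAlgebra.ι ℂ v * ExteriorAlgebra.ιMulti ℂ p e ∈ ⋀[ℂ]^(p + 1) V := by
      rw [ExteriorAlgebra.exteriorPower, pow_succ']
      exact Submodule.mul_mem_mul ⟨v, rfl⟩ (ExteriorAlgebra.ιMulti_range ℂ p ⟨e, rfl⟩)
    have h1 := Submodule.mem_map_of_mem (f := CliffordAlgebra.contractLeft f)
      (ih (p := p + 1) (by omega) _ hm)
    rw [hfv, Submodule.map_span] at h1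
    refine Submodule.span_mono ?_ h1
    rintro _ ⟨_, ⟨l, w, hl, rfl⟩, rfl⟩
    exact ⟨f :: l, w, by simp [hl], rfl⟩

section Finite

variable [Module.Finite ℂ V]

/-- In degree zero, the conjugate of `⋀^r R` is multiplication by the determinant of `R`. -/
theorem twist_zero (R : Module.Dual ℂ V →ₗ[ℂ] L ⊗[ℂ] Module.Dual ℂ V)
    (hR : ∀ f, R f ∈ coeffIn (centre L) (Module.Dual ℂ V)) {p r : ℕ} (h : r + p = r)
    (hV : Module.finrank ℂ V = r) (b : Module.Basis (Fin r) ℂ (Module.Dual ℂ V)) (α : ⋀[ℂ]^p V) :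
    twist R p r r h hV α =
      detForm (Matrix.of fun i j => evalAt (b.coord j) (R (b i))) ⊗ₜ[ℂ] α := by
  have key : ∀ x : ⋀[ℂ]^r (Module.Dual ℂ V) ⊗[ℂ] ⋀[ℂ]^r V,
      TensorProduct.assoc ℂ L _ _ (LinearMap.rTensor (⋀[ℂ]^r V) (wedgePow R r) x) =
        detForm (Matrix.of fun i j => evalAt (b.coord j) (R (b i))) ⊗ₜ[ℂ] x := by
    intro x
    induction x using TensorProduct.induction_on with
    | zero => simp
    | add a b ha hb => simp only [map_add, ha, hb, TensorProduct.tmul_add]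
    | tmul ξ w => rw [LinearMap.rTensor_tmul, wedgePow_top R hR b, TensorProduct.assoc_tmul]
  simp only [twist, LinearMap.comp_apply, LinearEquiv.coe_coe, key, LinearMap.lTensor_tmul,
    LinearEquiv.symm_apply_apply]

/-- The value of `(1/p!) (ι_Θ)^p ∘ twist R` on an iterated contraction of a multivector of top
degree. -/
theorem contractPow_twist (R : Module.Dual ℂ V →ₗ[ℂ] L ⊗[ℂ] Module.Dual ℂ V)
    (hR : ∀ f, R f ∈ coeffIn (centre L) (Module.Dual ℂ V)) {r : ℕ}
    (hV : Module.finrank ℂ V = r) (Θ : L ⊗[ℂ] Module.Dual ℂ V) (l : List (Module.Dual ℂ V))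
    (w : ⋀[ℂ]^r V) (p q : ℕ) (h : q + p = r) (hl : l.length = q) (α : ⋀[ℂ]^p V)
    (hα : (α : ExteriorAlgebra ℂ V) = contractList l w) :
    contractPow Θ p (twist R p q r h hV α) = (p.factorial : ℂ)⁻¹ •
      degreeZero ((contractForm Θ ^ p)
        (contractFormList (l.map R) (1 ⊗ₜ[ℂ] (w : ExteriorAlgebra ℂ V)))) := by
  rw [← twist_contractList R hR hV l w p q h hl α hα]
  rfl

end Finite

end Determinant

/-! ### Derivatives of maps into finite-dimensional spaces -/

section Derivatives

theorem analyticAt_clm_comp {𝕜 M N N' : Type*} [NontriviallyNormedField 𝕜]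
    [NormedAddCommGroup M] [NormedSpace 𝕜 M] [NormedAddCommGroup N] [NormedSpace 𝕜 N]
    [NormedAddCommGroup N'] [NormedSpace 𝕜 N'] {g : M → N} {z : M} (hg : AnalyticAt 𝕜 g z)
    (A : N →L[𝕜] N') : AnalyticAt 𝕜 (fun y => A (g y)) z :=
  (A.analyticAt (g z)).fun_comp hg

variable {E : Type*} [NormedAddCommGroup E] [NormedSpace ℂ E]
variable {W : Type*} [AddCommGroup W] [Module ℂ W] [Module.Finite ℂ W]
variable {W₁ : Type*} [AddCommGroup W₁] [Module ℂ W₁] [Module.Finite ℂ W₁]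
variable {W₂ : Type*} [AddCommGroup W₂] [Module ℂ W₂] [Module.Finite ℂ W₂]

/-- The coordinates on `W` by which derivatives of `W`-valued maps are defined. -/
abbrev coords (W : Type*) [AddCommGroup W] [Module ℂ W] [Module.Finite ℂ W] :
    W ≃ₗ[ℂ] (Fin (Module.finrank ℂ W) → ℂ) :=
  (Module.finBasis ℂ W).equivFun

/-- A linear map in coordinates. -/
def linCoords (T : W →ₗ[ℂ] W₁) :
    (Fin (Module.finrank ℂ W) → ℂ) →L[ℂ] (Fin (Module.finrank ℂ W₁) → ℂ) :=
  LinearMap.toContinuousLinearMap ((coords W₁).toLinearMap ∘ₗ T ∘ₗ (coords W).symm.toLinearMap)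

theorem linCoords_apply (T : W →ₗ[ℂ] W₁) (w : W) :
    linCoords T (coords W w) = coords W₁ (T w) := by
  simp [linCoords]

/-- A bilinear map in coordinates. -/
def bilinCoords (B : W →ₗ[ℂ] W₁ →ₗ[ℂ] W₂) :
    (Fin (Module.finrank ℂ W) → ℂ) →L[ℝ] (Fin (Module.finrank ℂ W₁) → ℂ) →L[ℝ]
      (Fin (Module.finrank ℂ W₂) → ℂ) :=
  ContinuousLinearMap.bilinearRestrictScalars ℝ (LinearMap.toContinuousBilinearMap
    ((B.compl₁₂ (coords W).symm.toLinearMap (coords W₁).symm.toLinearMap).compr₂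
      (coords W₂).toLinearMap))

theorem bilinCoords_apply (B : W →ₗ[ℂ] W₁ →ₗ[ℂ] W₂) (w : W) (w₁ : W₁) :
    bilinCoords B (coords W w) (coords W₁ w₁) = coords W₂ (B w w₁) := by
  simp [bilinCoords]

theorem coords_dirDeriv (f : E → W) (z v : E) :
    coords W (dirDeriv f z v) = fderiv ℝ (fun y => coords W (f y)) z v := by
  exact (coords W).apply_symm_apply _

theorem RealAnalyticAt.differentiableAt {f : E → W} {z : E} (hf : RealAnalyticAt f z) :
    DifferentiableAt ℝ (fun y => coords W (f y)) z :=
  AnalyticAt.differentiableAt hf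

theorem RealAnalyticAt.congr {f g : E → W} {z : E} (hf : RealAnalyticAt f z)
    (h : f =ᶠ[nhds z] g) : RealAnalyticAt g z :=
  AnalyticAt.congr hf (h.mono fun y hy => by simp only [hy])

theorem dirDeriv_congr {f g : E → W} {z : E} (h : f =ᶠ[nhds z] g) (v : E) :
    dirDeriv f z v = dirDeriv g z v := by
  have : (fun y => coords W (f y)) =ᶠ[nhds z] fun y => coords W (g y) :=
    h.mono fun y hy => by simp only [hy]
  simp only [dirDeriv, this.fderiv_eq]

theorem realAnalyticAt_const (w : W) (z : E) : RealAnalyticAt (fun _ => w) z :=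
  analyticAt_const

theorem RealAnalyticAt.linear {f : E → W} {z : E} (hf : RealAnalyticAt f z) (T : W →ₗ[ℂ] W₁) :
    RealAnalyticAt (fun y => T (f y)) z := by
  refine AnalyticAt.congr (analyticAt_clm_comp hf ((linCoords T).restrictScalars ℝ))
    (Filter.Eventually.of_forall fun y => ?_)
  exact linCoords_apply T (f y)

theorem RealAnalyticAt.bilinear {f : E → W} {g : E → W₁} {z : E} (hf : RealAnalyticAt f z)
    (hg : RealAnalyticAt g z) (B : W →ₗ[ℂ] W₁ →ₗ[ℂ] W₂) :
    RealAnalyticAt (fun y => B (f y) (g y)) z := by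
  have h := (bilinCoords B).analyticAt_bilinear (coords W (f z), coords W₁ (g z))
  have h2 := AnalyticAt.fun_comp (f := fun y => (coords W (f y), coords W₁ (g y))) h (hf.prod hg)
  refine AnalyticAt.congr h2 (Filter.Eventually.of_forall fun y => ?_)
  exact bilinCoords_apply B (f y) (g y)

theorem dirDeriv_linear {f : E → W} {z : E} (hf : RealAnalyticAt f z) (T : W →ₗ[ℂ] W₁) (v : E) :
    dirDeriv (fun y => T (f y)) z v = T (dirDeriv f z v) := by
  apply (coords W₁).injective
  rw [coords_dirDeriv, ← linCoords_apply, coords_dirDeriv]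
  simp only [← linCoords_apply]
  have := ((linCoords T).restrictScalars ℝ).hasFDerivAt.comp z hf.differentiableAt.hasFDerivAt
  have h2 := this.fderiv
  exact DFunLike.congr_fun h2 v

theorem dirDeriv_bilinear {f : E → W} {g : E → W₁} {z : E} (hf : RealAnalyticAt f z)
    (hg : RealAnalyticAt g z) (B : W →ₗ[ℂ] W₁ →ₗ[ℂ] W₂) (v : E) :
    dirDeriv (fun y => B (f y) (g y)) z v =
      B (dirDeriv f z v) (g z) + B (f z) (dirDeriv g z v) := by
  apply (coords W₂).injective
  rw [coords_dirDeriv, map_add, ← bilinCoords_apply, ← bilinCoords_apply, coords_dirDeriv,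
    coords_dirDeriv]
  simp only [← bilinCoords_apply]
  rw [ContinuousLinearMap.fderiv_of_bilinear _ hf.differentiableAt hg.differentiableAt, add_comm]
  rfl

theorem dirDeriv_const (w : W) (z v : E) : dirDeriv (fun _ => w) z v = 0 := by
  apply (coords W).injective
  rw [coords_dirDeriv, map_zero]
  simp

theorem RealAnalyticAt.add {f g : E → W} {z : E} (hf : RealAnalyticAt f z)
    (hg : RealAnalyticAt g z) : RealAnalyticAt (fun y => f y + g y) z := by
  simpa only [RealAnalyticAt, map_add] using AnalyticAt.fun_add hf hg

theorem dirDeriv_add {f g : E → W} {z : E} (hf : RealAnalyticAt f z)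
    (hg : RealAnalyticAt g z) (v : E) :
    dirDeriv (fun y => f y + g y) z v = dirDeriv f z v + dirDeriv g z v := by
  apply (coords W).injective
  rw [coords_dirDeriv, map_add, coords_dirDeriv, coords_dirDeriv]
  simp only [map_add]
  rw [fderiv_fun_add hf.differentiableAt hg.differentiableAt]
  rfl

theorem RealAnalyticAt.sum {ι : Type*} {s : Finset ι} {f : ι → E → W} {z : E}
    (hf : ∀ i ∈ s, RealAnalyticAt (f i) z) : RealAnalyticAt (fun y => ∑ i ∈ s, f i y) z := by
  classical
  induction s using Finset.induction_on with
  | empty => simpa using realAnalyticAt_const (0 : W) z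
  | insert a s ha ih =>
    simp only [Finset.sum_insert ha]
    exact (hf a (by simp)).add (ih fun i hi => hf i (by simp [hi]))

theorem dirDeriv_sum {ι : Type*} {s : Finset ι} {f : ι → E → W} {z : E}
    (hf : ∀ i ∈ s, RealAnalyticAt (f i) z) (v : E) :
    dirDeriv (fun y => ∑ i ∈ s, f i y) z v = ∑ i ∈ s, dirDeriv (f i) z v := by
  classical
  induction s using Finset.induction_on with
  | empty => simpa using dirDeriv_const (0 : W) z v
  | insert a s ha ih =>
    simp only [Finset.sum_insert ha]
    rw [dirDeriv_add (hf a (by simp)) (RealAnalyticAt.sum fun i hi => hf i (by simp [hi])),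
      ih fun i hi => hf i (by simp [hi])]

theorem RealAnalyticAt.dirDeriv {f : E → W} {z : E} (hf : RealAnalyticAt f z) (v : E) :
    RealAnalyticAt (fun y => KoszulDolbeault.dirDeriv f y v) z := by
  have h : AnalyticAt ℝ (fun y => fderiv ℝ (fun y => coords W (f y)) y v) z :=
    analyticAt_clm_comp (AnalyticAt.fderiv hf) (ContinuousLinearMap.apply ℝ _ v)
  refine h.congr (Filter.Eventually.of_forall fun y => ?_)
  exact (coords_dirDeriv f y v).symm

/-- Symmetry of the second derivative. -/
theorem dirDeriv_comm {f : E → W} {z : E} (hf : RealAnalyticAt f z) (u v : E) :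
    dirDeriv (fun y => dirDeriv f y u) z v = dirDeriv (fun y => dirDeriv f y v) z u := by
  apply (coords W).injective
  rw [coords_dirDeriv, coords_dirDeriv]
  simp only [coords_dirDeriv]
  have hd : DifferentiableAt ℝ (fderiv ℝ (fun y => coords W (f y))) z :=
    (AnalyticAt.fderiv hf).differentiableAt
  have hs : IsSymmSndFDerivAt ℝ (fun y => coords W (f y)) z :=
    (AnalyticAt.contDiffAt (n := ω) hf).isSymmSndFDerivAt le_top
  rw [fderiv_clm_apply hd (differentiableAt_const _),
    fderiv_clm_apply hd (differentiableAt_const _)]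
  simpa using hs v u

/-- The derivative of a map with values in a subspace has values in this subspace. -/
theorem dirDeriv_mem {S : Submodule ℂ W} {f : E → W} {z : E} (hf : RealAnalyticAt f z)
    (hS : ∀ᶠ y in nhds z, f y ∈ S) (v : E) : dirDeriv f z v ∈ S := by
  rw [← Submodule.ker_mkQ S, LinearMap.mem_ker, ← dirDeriv_linear hf,
    dirDeriv_congr (g := fun _ => 0) (hS.mono fun y hy => by simpa using hy), dirDeriv_const]

section Normed

variable {N : Type*} [NormedAddCommGroup N] [NormedSpace ℂ N] [FiniteDimensional ℂ N]

/-- The coordinates of a normed space are a topological isomorphism. -/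
def coordsL (N : Type*) [NormedAddCommGroup N] [NormedSpace ℂ N] [FiniteDimensional ℂ N] :
    N ≃L[ℂ] (Fin (Module.finrank ℂ N) → ℂ) :=
  (coords N).toContinuousLinearEquiv

theorem realAnalyticAt_of_analyticAt {f : E → N} {z : E} (hf : AnalyticAt ℝ f z) :
    RealAnalyticAt f z :=
  analyticAt_clm_comp hf (((coordsL N).toContinuousLinearMap).restrictScalars ℝ)

theorem RealAnalyticAt.analyticAt {f : E → N} {z : E} (hf : RealAnalyticAt f z) :
    AnalyticAt ℝ f z := by
  have h := analyticAt_clm_comp hf (((coordsL N).symm.toContinuousLinearMap).restrictScalars ℝ)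
  refine h.congr (Filter.Eventually.of_forall fun y => ?_)
  exact (coordsL N).symm_apply_apply (f y)

theorem dirDeriv_eq_fderiv {f : E → N} {z : E} (hf : DifferentiableAt ℝ f z) (v : E) :
    dirDeriv f z v = fderiv ℝ f z v := by
  apply (coords N).injective
  rw [coords_dirDeriv]
  have := ((coordsL N).toContinuousLinearMap.restrictScalars ℝ).hasFDerivAt.comp z hf.hasFDerivAt
  exact DFunLike.congr_fun this.fderiv v

end Normed

/-- Holomorphy of a map with values in a finite-dimensional complex vector space. -/
def HolomorphicAt (f : E → W) (z : E) : Prop :=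
  AnalyticAt ℂ (fun y => coords W (f y)) z

theorem holomorphicAt_of_analyticAt {N : Type*} [NormedAddCommGroup N] [NormedSpace ℂ N]
    [FiniteDimensional ℂ N] {f : E → N} {z : E} (hf : AnalyticAt ℂ f z) : HolomorphicAt f z :=
  analyticAt_clm_comp hf (coordsL N).toContinuousLinearMap

theorem HolomorphicAt.realAnalyticAt {f : E → W} {z : E} (hf : HolomorphicAt f z) :
    RealAnalyticAt f z :=
  AnalyticAt.restrictScalars hf

theorem HolomorphicAt.linear {f : E → W} {z : E} (hf : HolomorphicAt f z) (T : W →ₗ[ℂ] W₁) :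
    HolomorphicAt (fun y => T (f y)) z := by
  refine AnalyticAt.congr (analyticAt_clm_comp hf (linCoords T))
    (Filter.Eventually.of_forall fun y => ?_)
  exact linCoords_apply T (f y)

theorem HolomorphicAt.dirDeriv_I {f : E → W} {z : E} (hf : HolomorphicAt f z) (v : E) :
    dirDeriv f z (Complex.I • v) = Complex.I • dirDeriv f z v := by
  apply (coords W).injective
  rw [map_smul, coords_dirDeriv, coords_dirDeriv,
    (AnalyticAt.differentiableAt hf).fderiv_restrictScalars ℝ]
  simp

end Derivatives

/-! ### The operator `∂̄` on a vector space -/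

/-- The algebra of complex-valued forms at a point of `E`. -/
abbrev Forms (E : Type*) [NormedAddCommGroup E] [NormedSpace ℂ E] : Type _ :=
  ExteriorAlgebra ℂ (E →L[ℝ] ℂ)

section Involution

variable {E : Type*} [NormedAddCommGroup E] [NormedSpace ℂ E] {V : Type*} [AddCommGroup V]
  [Module ℂ V]

/-- The grading involution of the coefficients. -/
def coeffInvolute (W : Type*) [AddCommGroup W] [Module ℂ W] :
    Forms E ⊗[ℂ] W →ₗ[ℂ] Forms E ⊗[ℂ] W :=
  LinearMap.rTensor W CliffordAlgebra.involute.toLinearMap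

theorem coeffInvolute_tmul {W : Type*} [AddCommGroup W] [Module ℂ W] (a : Forms E) (w : W) :
    coeffInvolute W (a ⊗ₜ[ℂ] w) = CliffordAlgebra.involute a ⊗ₜ[ℂ] w := rfl

/-- Contraction is compatible with the grading of the coefficients. -/
theorem coeffInvolute_contractForm (Θ : Forms E ⊗[ℂ] Module.Dual ℂ V)
    (x : Forms E ⊗[ℂ] ExteriorAlgebra ℂ V) :
    coeffInvolute _ (contractForm Θ x) =
      contractForm (coeffInvolute _ Θ) (coeffInvolute _ x) := by
  induction Θ using TensorProduct.induction_on with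
  | zero => simp
  | add a b ha hb => simp only [map_add, LinearMap.add_apply, ha, hb]
  | tmul η f =>
    induction x using TensorProduct.induction_on with
    | zero => simp
    | add a b ha hb => simp only [map_add, ha, hb]
    | tmul ζ y => simp only [contractForm_tmul, coeffInvolute_tmul, map_mul]

end Involution

section Delbar

variable {E : Type*} [NormedAddCommGroup E] [NormedSpace ℂ E] [FiniteDimensional ℂ E]
variable {W : Type*} [AddCommGroup W] [Module ℂ W] [Module.Finite ℂ W]
variable {W₁ : Type*} [AddCommGroup W₁] [Module ℂ W₁] [Module.Finite ℂ W₁]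
variable {W₂ : Type*} [AddCommGroup W₂] [Module ℂ W₂] [Module.Finite ℂ W₂]

/-- The derivative `∂f/∂z̄_k`. -/
def antiholDeriv (k : Fin (Module.finrank ℂ E)) (f : E → W) (z : E) : W :=
  (1 / 2 : ℂ) • (dirDeriv f z (Module.finBasis ℂ E k) +
    Complex.I • dirDeriv f z (Complex.I • Module.finBasis ℂ E k))

theorem flatDelbar_eq (f : E → Forms E) (z : E) :
    flatDelbar f z = ∑ k, ExteriorAlgebra.ι ℂ (dzbar k) * antiholDeriv k f z := rfl

theorem antiholDeriv_congr {f g : E → W} {z : E} (h : f =ᶠ[nhds z] g)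
    (k : Fin (Module.finrank ℂ E)) : antiholDeriv k f z = antiholDeriv k g z := by
  simp only [antiholDeriv, dirDeriv_congr h]

theorem antiholDeriv_linear {f : E → W} {z : E} (hf : RealAnalyticAt f z) (T : W →ₗ[ℂ] W₁)
    (k : Fin (Module.finrank ℂ E)) :
    antiholDeriv k (fun y => T (f y)) z = T (antiholDeriv k f z) := by
  simp only [antiholDeriv, dirDeriv_linear hf, map_smul, map_add]

theorem antiholDeriv_bilinear {f : E → W} {g : E → W₁} {z : E} (hf : RealAnalyticAt f z)
    (hg : RealAnalyticAt g z) (B : W →ₗ[ℂ] W₁ →ₗ[ℂ] W₂) (k : Fin (Module.finrank ℂ E)) :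
    antiholDeriv k (fun y => B (f y) (g y)) z =
      B (antiholDeriv k f z) (g z) + B (f z) (antiholDeriv k g z) := by
  simp only [antiholDeriv, dirDeriv_bilinear hf hg, map_smul, map_add, LinearMap.add_apply,
    LinearMap.smul_apply, smul_add]
  abel

theorem antiholDeriv_sum {ι : Type*} {s : Finset ι} {f : ι → E → W} {z : E}
    (hf : ∀ i ∈ s, RealAnalyticAt (f i) z) (k : Fin (Module.finrank ℂ E)) :
    antiholDeriv k (fun y => ∑ i ∈ s, f i y) z = ∑ i ∈ s, antiholDeriv k (f i) z := by
  simp only [antiholDeriv, dirDeriv_sum hf, Finset.smul_sum, ← Finset.sum_add_distrib, smul_add]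

theorem RealAnalyticAt.antiholDeriv {f : E → W} {z : E} (hf : RealAnalyticAt f z)
    (k : Fin (Module.finrank ℂ E)) : RealAnalyticAt (KoszulDolbeault.antiholDeriv k f) z :=
  RealAnalyticAt.linear (f := fun y => KoszulDolbeault.dirDeriv f y (Module.finBasis ℂ E k) +
      Complex.I • KoszulDolbeault.dirDeriv f y (Complex.I • Module.finBasis ℂ E k))
    ((hf.dirDeriv _).add ((hf.dirDeriv _).linear (LinearMap.lsmul ℂ W Complex.I)))
    (LinearMap.lsmul ℂ W (1 / 2 : ℂ))

theorem antiholDeriv_comm {f : E → W} {z : E} (hf : RealAnalyticAt f z)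
    (k l : Fin (Module.finrank ℂ E)) :
    antiholDeriv k (antiholDeriv l f) z = antiholDeriv l (antiholDeriv k f) z := by
  have key : ∀ (u : E) (l : Fin (Module.finrank ℂ E)), dirDeriv (antiholDeriv l f) z u =
      antiholDeriv l (fun y => dirDeriv f y u) z := by
    intro u l
    have h1 := hf.dirDeriv (Module.finBasis ℂ E l)
    have h2 := (hf.dirDeriv (Complex.I • Module.finBasis ℂ E l)).linear
      (LinearMap.lsmul ℂ W Complex.I)
    have e : antiholDeriv l f = fun y => LinearMap.lsmul ℂ W (1 / 2 : ℂ)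
        (dirDeriv f y (Module.finBasis ℂ E l) +
          LinearMap.lsmul ℂ W Complex.I (dirDeriv f y (Complex.I • Module.finBasis ℂ E l))) := rfl
    rw [e, dirDeriv_linear (h1.add h2), dirDeriv_add h1 h2,
      dirDeriv_linear (hf.dirDeriv (Complex.I • Module.finBasis ℂ E l)),
      dirDeriv_comm hf (Module.finBasis ℂ E l) u,
      dirDeriv_comm hf (Complex.I • Module.finBasis ℂ E l) u]
    rfl
  have e1 := key (Module.finBasis ℂ E k) l
  have e2 := key (Complex.I • Module.finBasis ℂ E k) l
  have h1 := hf.dirDeriv (Module.finBasis ℂ E k)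
  have h2 := (hf.dirDeriv (Complex.I • Module.finBasis ℂ E k)).linear
    (LinearMap.lsmul ℂ W Complex.I)
  have e : antiholDeriv k f = fun y => LinearMap.lsmul ℂ W (1 / 2 : ℂ)
        (dirDeriv f y (Module.finBasis ℂ E k) +
          LinearMap.lsmul ℂ W Complex.I (dirDeriv f y (Complex.I • Module.finBasis ℂ E k))) := rfl
  have e3 : antiholDeriv l (fun y => dirDeriv f y (Module.finBasis ℂ E k) +
      LinearMap.lsmul ℂ W Complex.I (dirDeriv f y (Complex.I • Module.finBasis ℂ E k))) z =
      antiholDeriv l (fun y => dirDeriv f y (Module.finBasis ℂ E k)) z +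
      antiholDeriv l (fun y => LinearMap.lsmul ℂ W Complex.I
        (dirDeriv f y (Complex.I • Module.finBasis ℂ E k))) z := by
    simp only [antiholDeriv, dirDeriv_add h1 h2, smul_add]
    abel
  rw [e, antiholDeriv_linear (h1.add h2), e3,
    antiholDeriv_linear (hf.dirDeriv (Complex.I • Module.finBasis ℂ E k)), ← e1, ← e2]
  rfl

theorem antiholDeriv_mem {S : Submodule ℂ W} {f : E → W} {z : E} (hf : RealAnalyticAt f z)
    (hS : ∀ᶠ y in nhds z, f y ∈ S) (k : Fin (Module.finrank ℂ E)) : antiholDeriv k f z ∈ S :=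
  S.smul_mem _ (S.add_mem (dirDeriv_mem hf hS _) (S.smul_mem _ (dirDeriv_mem hf hS _)))

theorem HolomorphicAt.antiholDeriv_eq_zero {f : E → W} {z : E} (hf : HolomorphicAt f z)
    (k : Fin (Module.finrank ℂ E)) : antiholDeriv k f z = 0 := by
  rw [antiholDeriv, hf.dirDeriv_I, smul_smul, Complex.I_mul_I]
  simp

theorem HolomorphicAt.flatDelbar_eq_zero {f : E → Forms E} {z : E} (hf : HolomorphicAt f z) :
    flatDelbar f z = 0 := by
  simp [flatDelbar_eq, hf.antiholDeriv_eq_zero]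

theorem flatDelbar_congr {f g : E → Forms E} {z : E} (h : f =ᶠ[nhds z] g) :
    flatDelbar f z = flatDelbar g z := by
  simp only [flatDelbar_eq, antiholDeriv_congr h]

theorem RealAnalyticAt.flatDelbar {f : E → Forms E} {z : E} (hf : RealAnalyticAt f z) :
    RealAnalyticAt (KoszulDolbeault.flatDelbar f) z :=
  RealAnalyticAt.sum (f := fun k y => ExteriorAlgebra.ι ℂ (dzbar k) *
      KoszulDolbeault.antiholDeriv k f y)
    fun k _ => (hf.antiholDeriv k).linear (LinearMap.mulLeft ℂ (ExteriorAlgebra.ι ℂ (dzbar k)))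

theorem flatDelbar_sum {ι : Type*} {s : Finset ι} {f : ι → E → Forms E} {z : E}
    (hf : ∀ i ∈ s, RealAnalyticAt (f i) z) :
    flatDelbar (fun y => ∑ i ∈ s, f i y) z = ∑ i ∈ s, flatDelbar (f i) z := by
  simp only [flatDelbar_eq, antiholDeriv_sum hf, Finset.mul_sum]
  exact Finset.sum_comm

theorem flatDelbar_neg {f : E → Forms E} {z : E} (hf : RealAnalyticAt f z) :
    flatDelbar (fun y => -f y) z = -flatDelbar f z := by
  have h := fun k => antiholDeriv_linear hf (-LinearMap.id) k
  simp only [LinearMap.neg_apply, LinearMap.id_apply] at h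
  simp [flatDelbar_eq, h]

/-- The one-form `∂̄f` of a function `f`. -/
def delbarFun (f : E → ℂ) (z : E) : E →L[ℝ] ℂ := ∑ k, antiholDeriv k f z • dzbar k

/-- The Leibniz rule for the product of a function and a form. -/
theorem flatDelbar_smul {f : E → ℂ} {η : E → Forms E} {z : E} (hf : RealAnalyticAt f z)
    (hη : RealAnalyticAt η z) :
    flatDelbar (fun y => f y • η y) z =
      ExteriorAlgebra.ι ℂ (delbarFun f z) * η z + f z • flatDelbar η z := by
  have h := antiholDeriv_bilinear hf hη (LinearMap.lsmul ℂ (Forms E))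
  simp only [LinearMap.lsmul_apply] at h
  simp only [flatDelbar_eq, h, mul_add, Finset.sum_add_distrib, delbarFun, map_sum, map_smul,
    Finset.sum_mul, Finset.smul_sum, mul_smul_comm, smul_mul_assoc]

theorem flatDelbar_holomorphic_smul {f : E → ℂ} {η : E → Forms E} {z : E} (hf : HolomorphicAt f z)
    (hη : RealAnalyticAt η z) :
    flatDelbar (fun y => f y • η y) z = f z • flatDelbar η z := by
  rw [flatDelbar_smul hf.realAnalyticAt hη, delbarFun]
  simp [hf.antiholDeriv_eq_zero]

/-- `∂̄² = 0`: the derivatives `∂/∂z̄_k` commute, the covectors `dz̄_k` anticommute. -/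
theorem flatDelbar_flatDelbar {f : E → Forms E} {z : E} (hf : RealAnalyticAt f z) :
    flatDelbar (flatDelbar f) z = 0 := by
  have h : ∀ k, antiholDeriv k (flatDelbar f) z =
      ∑ l, ExteriorAlgebra.ι ℂ (dzbar l) * antiholDeriv k (antiholDeriv l f) z := by
    intro k
    have := antiholDeriv_sum (s := Finset.univ) (z := z)
      (f := fun l y => LinearMap.mulLeft ℂ (ExteriorAlgebra.ι ℂ (dzbar l)) (antiholDeriv l f y))
      (fun l _ => (hf.antiholDeriv l).linear _) k
    refine Eq.trans this (Finset.sum_congr rfl fun l _ => ?_)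
    rw [antiholDeriv_linear (hf.antiholDeriv l)]
    rfl
  have e : flatDelbar (flatDelbar f) z = ∑ k, ∑ l, ExteriorAlgebra.ι ℂ (dzbar k) *
      ExteriorAlgebra.ι ℂ (dzbar l) * antiholDeriv k (antiholDeriv l f) z := by
    rw [flatDelbar_eq]
    simp only [h, Finset.mul_sum, mul_assoc]
  -- exchanging the summation indices changes the sign
  have e2 : flatDelbar (flatDelbar f) z = -flatDelbar (flatDelbar f) z := by
    conv_lhs => rw [e, Finset.sum_comm]
    rw [e, ← Finset.sum_neg_distrib]
    refine Finset.sum_congr rfl fun k _ => ?_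
    rw [← Finset.sum_neg_distrib]
    refine Finset.sum_congr rfl fun l _ => ?_
    rw [antiholDeriv_comm hf, eq_neg_of_add_eq_zero_left (ExteriorAlgebra.ι_add_mul_swap (R := ℂ)
      (dzbar l : E →L[ℝ] ℂ) (dzbar k)), neg_mul]
  have h2 : (2 : ℂ) • flatDelbar (flatDelbar f) z = 0 := by
    rw [two_smul]; exact add_eq_zero_iff_eq_neg.mpr e2
  exact (smul_eq_zero.mp h2).resolve_left two_ne_zero

section Bundle

variable {V : Type*} [AddCommGroup V] [Module ℂ V] [Module.Finite ℂ V]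

/-- The operator `∂̄` on forms with values in a constant vector space `W`. -/
def tensorDelbar (Ψ : E → Forms E ⊗[ℂ] W) (z : E) : Forms E ⊗[ℂ] W :=
  ∑ k, LinearMap.rTensor W (LinearMap.mulLeft ℂ (ExteriorAlgebra.ι ℂ (dzbar k)))
    (antiholDeriv k Ψ z)

theorem tensorDelbar_const (w : Forms E ⊗[ℂ] W) (z : E) :
    tensorDelbar (fun _ => w) z = 0 := by
  simp [tensorDelbar, antiholDeriv, dirDeriv_const]

theorem tensorDelbar_sum_tmul {ι : Type*} [Fintype ι] (b : ι → W) {θ : ι → E → Forms E} {z : E}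
    (hθ : ∀ i, RealAnalyticAt (θ i) z) :
    tensorDelbar (fun y => ∑ i, θ i y ⊗ₜ[ℂ] b i) z = ∑ i, flatDelbar (θ i) z ⊗ₜ[ℂ] b i := by
  have h : ∀ k, antiholDeriv k (fun y => ∑ i, θ i y ⊗ₜ[ℂ] b i) z =
      ∑ i, antiholDeriv k (θ i) z ⊗ₜ[ℂ] b i := by
    intro k
    refine Eq.trans (antiholDeriv_sum (s := Finset.univ)
      (f := fun i y => (TensorProduct.mk ℂ (Forms E) W).flip (b i) (θ i y))
      (fun i _ => (hθ i).linear _) k) (Finset.sum_congr rfl fun i _ => ?_)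
    rw [antiholDeriv_linear (hθ i)]
    rfl
  simp only [tensorDelbar, h, map_sum, LinearMap.rTensor_tmul, LinearMap.mulLeft_apply,
    flatDelbar_eq, TensorProduct.sum_tmul]
  exact Finset.sum_comm

theorem realAnalyticAt_sum_tmul {ι : Type*} [Fintype ι] (b : ι → W) {θ : ι → E → Forms E} {z : E}
    (hθ : ∀ i, RealAnalyticAt (θ i) z) :
    RealAnalyticAt (fun y => ∑ i, θ i y ⊗ₜ[ℂ] b i) z :=
  RealAnalyticAt.sum (f := fun i y => θ i y ⊗ₜ[ℂ] b i)
    fun i _ => (hθ i).linear ((TensorProduct.mk ℂ (Forms E) W).flip (b i))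

theorem flatDelbar_degreeZero {Ψ : E → Forms E ⊗[ℂ] ExteriorAlgebra ℂ V} {z : E}
    (hΨ : RealAnalyticAt Ψ z) :
    flatDelbar (fun y => degreeZero (Ψ y)) z = degreeZero (tensorDelbar Ψ z) := by
  have h : ∀ (a : Forms E) (x : Forms E ⊗[ℂ] ExteriorAlgebra ℂ V),
      degreeZero (LinearMap.rTensor _ (LinearMap.mulLeft ℂ a) x) = a * degreeZero x := by
    intro a x
    induction x using TensorProduct.induction_on with
    | zero => simp
    | add x y hx hy => simp only [map_add, mul_add, hx, hy]
    | tmul ζ y => simp [degreeZero]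
  simp only [flatDelbar_eq, tensorDelbar, map_sum, antiholDeriv_linear hΨ, h]

/-- The Leibniz rule for contraction. The sign that comes from moving `dz̄_k` past the coefficients
of `Ψ` is the grading involution. -/
theorem tensorDelbar_contractForm {Θ : E → Forms E ⊗[ℂ] Module.Dual ℂ V}
    {Ψ : E → Forms E ⊗[ℂ] ExteriorAlgebra ℂ V} {z : E} (hΘ : RealAnalyticAt Θ z)
    (hΨ : RealAnalyticAt Ψ z) :
    tensorDelbar (fun y => contractForm (Θ y) (Ψ y)) z =
      contractForm (Θ z) (tensorDelbar Ψ z) +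
        contractForm (tensorDelbar Θ z) (coeffInvolute _ (Ψ z)) := by
  have h1 : ∀ (a : Forms E) (Θ : Forms E ⊗[ℂ] Module.Dual ℂ V)
      (x : Forms E ⊗[ℂ] ExteriorAlgebra ℂ V),
      LinearMap.rTensor _ (LinearMap.mulLeft ℂ a) (contractForm Θ x) =
        contractForm Θ (LinearMap.rTensor _ (LinearMap.mulLeft ℂ a) x) := by
    intro a Θ x
    induction Θ using TensorProduct.induction_on with
    | zero => simp
    | add a b ha hb => simp only [map_add, LinearMap.add_apply, ha, hb]
    | tmul η f =>
      induction x using TensorProduct.induction_on with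
      | zero => simp
      | add a b ha hb => simp only [map_add, ha, hb]
      | tmul ζ y => simp [mul_assoc]
  have h2 : ∀ (c : E →L[ℝ] ℂ) (Θ : Forms E ⊗[ℂ] Module.Dual ℂ V)
      (x : Forms E ⊗[ℂ] ExteriorAlgebra ℂ V),
      LinearMap.rTensor _ (LinearMap.mulLeft ℂ (ExteriorAlgebra.ι ℂ c)) (contractForm Θ x) =
        contractForm (LinearMap.rTensor _ (LinearMap.mulLeft ℂ (ExteriorAlgebra.ι ℂ c)) Θ)
          (coeffInvolute _ x) := by
    intro c Θ x
    induction Θ using TensorProduct.induction_on with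
    | zero => simp
    | add a b ha hb => simp only [map_add, LinearMap.add_apply, ha, hb]
    | tmul η f =>
      induction x using TensorProduct.induction_on with
      | zero => simp
      | add a b ha hb => simp only [map_add, ha, hb]
      | tmul ζ y =>
        simp only [contractForm_tmul, coeffInvolute_tmul, LinearMap.rTensor_tmul,
          LinearMap.mulLeft_apply]
        rw [← mul_assoc (CliffordAlgebra.involute ζ), mul_ι_eq,
          CliffordAlgebra.involute_involute, mul_assoc]
  have h := antiholDeriv_bilinear hΘ hΨ contractForm
  simp only [tensorDelbar, map_sum, LinearMap.sum_apply, ← Finset.sum_add_distrib]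
  refine Finset.sum_congr rfl fun k _ => ?_
  rw [h k, map_add, h2 _ (antiholDeriv k Θ z), h1 _ (Θ z), add_comm]

end Bundle

end Delbar

@[simp] theorem pullCovector_apply {E₁ E₂ : Type*} [AddCommGroup E₁] [Module ℂ E₁]
    [TopologicalSpace E₁] [AddCommGroup E₂] [Module ℂ E₂] [TopologicalSpace E₂] (A : E₁ →L[ℂ] E₂)
    (c : E₂ →L[ℝ] ℂ) (v : E₁) : pullCovector A c v = c (A v) := rfl

/-! ### Types of forms -/

section Types

variable {E : Type*} [NormedAddCommGroup E] [NormedSpace ℂ E]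

/-- The span of the complex linear covectors. -/
def linCovectors (E : Type*) [NormedAddCommGroup E] [NormedSpace ℂ E] : Submodule ℂ (Forms E) :=
  Submodule.span ℂ {η | ∃ c : E →L[ℝ] ℂ,
    (∀ v, c (Complex.I • v) = Complex.I * c v) ∧ η = ExteriorAlgebra.ι ℂ c}

/-- The span of the conjugate linear covectors. -/
def conjCovectors (E : Type*) [NormedAddCommGroup E] [NormedSpace ℂ E] : Submodule ℂ (Forms E) :=
  Submodule.span ℂ {η | ∃ c : E →L[ℝ] ℂ,
    (∀ v, c (Complex.I • v) = -(Complex.I * c v)) ∧ η = ExteriorAlgebra.ι ℂ c}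

/-- The forms of type `(p, q)` in `E`. -/
def flatType (E : Type*) [NormedAddCommGroup E] [NormedSpace ℂ E] (p q : ℕ) :
    Submodule ℂ (Forms E) :=
  linCovectors E ^ p * conjCovectors E ^ q

theorem linCovectors_le : linCovectors E ≤ LinearMap.range (ExteriorAlgebra.ι ℂ) :=
  Submodule.span_le.mpr fun _ ⟨c, _, h⟩ => ⟨c, h.symm⟩

theorem conjCovectors_le : conjCovectors E ≤ LinearMap.range (ExteriorAlgebra.ι ℂ) :=
  Submodule.span_le.mpr fun _ ⟨c, _, h⟩ => ⟨c, h.symm⟩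

theorem mul_le_mul_swap {W : Type*} [AddCommGroup W] [Module ℂ W]
    {S T : Submodule ℂ (ExteriorAlgebra ℂ W)} (hS : S ≤ LinearMap.range (ExteriorAlgebra.ι ℂ))
    (hT : T ≤ LinearMap.range (ExteriorAlgebra.ι ℂ)) : S * T ≤ T * S := by
  refine Submodule.mul_le.mpr fun a ha b hb => ?_
  obtain ⟨u, hu⟩ := hS ha
  obtain ⟨v, hv⟩ := hT hb
  have e : a * b = -(b * a) := by
    rw [← hu, ← hv]
    exact eq_neg_of_add_eq_zero_left (ExteriorAlgebra.ι_add_mul_swap u v)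
  rw [e]
  exact neg_mem (Submodule.mul_mem_mul hb ha)

theorem linCovectors_commute : Commute (linCovectors E) (conjCovectors E) :=
  le_antisymm (mul_le_mul_swap linCovectors_le conjCovectors_le)
    (mul_le_mul_swap conjCovectors_le linCovectors_le)

theorem flatType_mul (p q p' q' : ℕ) :
    flatType E p q * flatType E p' q' = flatType E (p + p') (q + q') := by
  have h := ((linCovectors_commute (E := E)).pow_pow p' q).eq
  rw [flatType, flatType, flatType, pow_add, pow_add, mul_assoc, ← mul_assoc (conjCovectors E ^ q),
    ← h, mul_assoc, mul_assoc]

theorem flatType_le (p q : ℕ) : flatType E p q ≤ ⋀[ℂ]^(p + q) (E →L[ℝ] ℂ) := by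
  rw [flatType, ExteriorAlgebra.exteriorPower, pow_add]
  exact mul_le_mul' (pow_le_pow_left' linCovectors_le _)
    (pow_le_pow_left' conjCovectors_le _)

theorem involute_of_mem_flatType {p q : ℕ} {η : Forms E} (h : η ∈ flatType E p q) :
    CliffordAlgebra.involute η = (-1 : ℂ) ^ (p + q) • η :=
  involute_of_mem (flatType_le p q h)

/-- Forms of type `(1, 1)` have even degree, so they commute with all forms. -/
theorem flatType_one_one_le : flatType E 1 1 ≤ centre (Forms E) := fun η hη => by
  have h := involute_of_mem_flatType hη
  norm_num at h
  exact (Subalgebra.mem_center_iff (R := ℂ)).mpr fun y => (commute_of_involute_eq h y).symm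

theorem coeffIn_mono {L : Type*} [Ring L] [Algebra ℂ L] {S S' : Submodule ℂ L} (h : S ≤ S')
    {W : Type*} [AddCommGroup W] [Module ℂ W] : coeffIn S W ≤ coeffIn S' W := fun x hx => by
  induction hx using coeffIn_induction with
  | zero => exact zero_mem _
  | add x y _ _ hx hy => exact add_mem hx hy
  | tmul s hs w => exact tmul_mem_coeffIn (h hs) w

theorem coeffInvolute_of_mem {p q : ℕ} {W : Type*} [AddCommGroup W] [Module ℂ W]
    {x : Forms E ⊗[ℂ] W} (hx : x ∈ coeffIn (flatType E p q) W) :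
    coeffInvolute W x = (-1 : ℂ) ^ (p + q) • x := by
  induction hx using coeffIn_induction with
  | zero => simp
  | add x y _ _ hx hy => rw [map_add, hx, hy, smul_add]
  | tmul s hs w =>
    rw [coeffInvolute_tmul, involute_of_mem_flatType hs, TensorProduct.smul_tmul']

theorem map_pullCovector_mem {E₁ : Type*} [NormedAddCommGroup E₁] [NormedSpace ℂ E₁]
    (A : E₁ →L[ℂ] E) (p q : ℕ) {η : Forms E} (h : η ∈ flatType E p q) :
    ExteriorAlgebra.map (pullCovector A) η ∈ flatType E₁ p q := by
  have h1 : (linCovectors E).map (ExteriorAlgebra.map (pullCovector A)).toLinearMap ≤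
      linCovectors E₁ := by
    rw [linCovectors, Submodule.map_span]
    refine Submodule.span_mono ?_
    rintro _ ⟨_, ⟨c, hc, rfl⟩, rfl⟩
    exact ⟨pullCovector A c, fun v => by simp [hc], by simp⟩
  have h2 : (conjCovectors E).map (ExteriorAlgebra.map (pullCovector A)).toLinearMap ≤
      conjCovectors E₁ := by
    rw [conjCovectors, Submodule.map_span]
    refine Submodule.span_mono ?_
    rintro _ ⟨_, ⟨c, hc, rfl⟩, rfl⟩
    exact ⟨pullCovector A c, fun v => by simp [hc], by simp⟩
  have h3 := Submodule.mem_map_of_mem (f := (ExteriorAlgebra.map (pullCovector A)).toLinearMap) h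
  rw [flatType, Submodule.map_mul, Submodule.map_pow, Submodule.map_pow] at h3
  exact mul_le_mul' (pow_le_pow_left' h1 _) (pow_le_pow_left' h2 _) h3

theorem exists_of_mem_flatType_one_zero {η : Forms E} (h : η ∈ flatType E 1 0) :
    ∃ c : E →L[ℝ] ℂ, (∀ v, c (Complex.I • v) = Complex.I * c v) ∧ η = ExteriorAlgebra.ι ℂ c := by
  rw [flatType, pow_one, pow_zero, mul_one, linCovectors] at h
  induction h using Submodule.span_induction with
  | mem x h => exact h
  | zero => exact ⟨0, by simp, by simp⟩
  | add x y _ _ hx hy =>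
    obtain ⟨c, hc, rfl⟩ := hx
    obtain ⟨d, hd, rfl⟩ := hy
    exact ⟨c + d, fun v => by simp [hc, hd, mul_add], by simp⟩
  | smul a x _ hx =>
    obtain ⟨c, hc, rfl⟩ := hx
    exact ⟨a • c, fun v => by simp [hc]; ring, by simp⟩

variable [FiniteDimensional ℂ E]

theorem dzbar_mem (k : Fin (Module.finrank ℂ E)) :
    ExteriorAlgebra.ι ℂ (dzbar k) ∈ flatType E 0 1 := by
  rw [flatType, pow_zero, one_mul, pow_one]
  exact Submodule.subset_span ⟨dzbar k, fun v => by simp [dzbar, dz], rfl⟩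

theorem flatDelbar_mem {p q : ℕ} {f : E → Forms E} {z : E} (hf : RealAnalyticAt f z)
    (h : ∀ᶠ y in nhds z, f y ∈ flatType E p q) : flatDelbar f z ∈ flatType E p (q + 1) := by
  refine Submodule.sum_mem _ fun k _ => ?_
  have := Submodule.mul_mem_mul (dzbar_mem k) (antiholDeriv_mem hf h k)
  rwa [flatType_mul, zero_add, add_comm] at this

end Types

/-! ### The operator `∂̄` and contraction -/

section Contraction

variable {V : Type*} [AddCommGroup V] [Module ℂ V]

/-- A contraction with central coefficients anticommutes with every contraction. -/
theorem contractForm_pow_comm {L : Type*} [Ring L] [Algebra ℂ L] {Θ Ξ : L ⊗[ℂ] Module.Dual ℂ V}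
    (hΞ : Ξ ∈ coeffIn (centre L) (Module.Dual ℂ V)) (p : ℕ)
    (x : L ⊗[ℂ] ExteriorAlgebra ℂ V) :
    contractForm Ξ ((contractForm Θ ^ p) x) =
      (-1 : ℂ) ^ p • (contractForm Θ ^ p) (contractForm Ξ x) := by
  induction p with
  | zero => simp
  | succ p ih =>
    simp only [pow_succ', Module.End.mul_apply]
    rw [contractForm_comm hΞ, ih, map_smul, neg_one_mul, neg_smul]

variable {E : Type*} [NormedAddCommGroup E] [NormedSpace ℂ E]

theorem coeffInvolute_contractForm_pow {Θ : Forms E ⊗[ℂ] Module.Dual ℂ V}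
    (hΘ : coeffInvolute _ Θ = -Θ) {x : Forms E ⊗[ℂ] ExteriorAlgebra ℂ V}
    (hx : coeffInvolute _ x = x) (p : ℕ) :
    coeffInvolute _ ((contractForm Θ ^ p) x) = (-1 : ℂ) ^ p • (contractForm Θ ^ p) x := by
  induction p with
  | zero => simp [hx]
  | succ p ih =>
    simp only [pow_succ', Module.End.mul_apply]
    rw [coeffInvolute_contractForm, ih, hΘ, map_smul, map_neg, LinearMap.neg_apply, neg_one_mul,
      neg_smul, smul_neg]

variable [FiniteDimensional ℂ E] [Module.Finite ℂ V]

theorem realAnalyticAt_contractPow {Θ : E → Forms E ⊗[ℂ] Module.Dual ℂ V}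
    {Ψ : E → Forms E ⊗[ℂ] ExteriorAlgebra ℂ V} {z : E} (hΘ : RealAnalyticAt Θ z)
    (hΨ : RealAnalyticAt Ψ z) (p : ℕ) :
    RealAnalyticAt (fun y => (contractForm (Θ y) ^ p) (Ψ y)) z := by
  induction p with
  | zero => simpa using hΨ
  | succ p ih =>
    simp only [pow_succ', Module.End.mul_apply]
    exact hΘ.bilinear ih contractForm

/-- `∂̄` of the powers of the contraction with a form of odd degree: since contraction with `∂̄Θ`
anticommutes with contraction with `Θ`, all terms of the Leibniz rule are equal. -/
theorem tensorDelbar_contractForm_pow {Θ : E → Forms E ⊗[ℂ] Module.Dual ℂ V}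
    {Ψ : E → Forms E ⊗[ℂ] ExteriorAlgebra ℂ V} {z : E} (hΘ : RealAnalyticAt Θ z)
    (hΨ : RealAnalyticAt Ψ z) (hodd : coeffInvolute _ (Θ z) = -Θ z)
    (heven : coeffInvolute _ (Ψ z) = Ψ z) (hclosed : tensorDelbar Ψ z = 0)
    (hd : tensorDelbar Θ z ∈ coeffIn (centre (Forms E)) (Module.Dual ℂ V)) (p : ℕ) :
    tensorDelbar (fun y => (contractForm (Θ y) ^ (p + 1)) (Ψ y)) z =
      ((p : ℂ) + 1) • (contractForm (Θ z) ^ p) (contractForm (tensorDelbar Θ z) (Ψ z)) := by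
  induction p with
  | zero =>
    simp only [zero_add, pow_one, pow_zero, Module.End.one_apply]
    rw [tensorDelbar_contractForm hΘ hΨ, hclosed, heven]
    simp
  | succ p ih =>
    have e : ∀ y, (contractForm (Θ y) ^ (p + 1 + 1)) (Ψ y) =
        contractForm (Θ y) ((contractForm (Θ y) ^ (p + 1)) (Ψ y)) := fun y => by
      rw [pow_succ' _ (p + 1), Module.End.mul_apply]
    simp only [e]
    rw [tensorDelbar_contractForm hΘ (realAnalyticAt_contractPow hΘ hΨ (p + 1)), ih,
      coeffInvolute_contractForm_pow hodd heven, map_smul, map_smul, contractForm_pow_comm hd,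
      smul_smul, ← mul_pow, neg_mul_neg, one_mul, one_pow, pow_succ' _ p, Module.End.mul_apply,
      ← add_smul]
    push_cast
    ring_nf

/-- A closed form of even degree stays so under contraction with closed forms of even degree. -/
theorem contractFormList_closed {l : List (E → Forms E ⊗[ℂ] Module.Dual ℂ V)} {z : E}
    (hl : ∀ ρ ∈ l, RealAnalyticAt ρ z ∧ tensorDelbar ρ z = 0 ∧ coeffInvolute _ (ρ z) = ρ z)
    (w : ExteriorAlgebra ℂ V) :
    RealAnalyticAt (fun y => contractFormList (l.map fun ρ => ρ y) (1 ⊗ₜ[ℂ] w)) z ∧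
      tensorDelbar (fun y => contractFormList (l.map fun ρ => ρ y) (1 ⊗ₜ[ℂ] w)) z = 0 ∧
      coeffInvolute _ (contractFormList (l.map fun ρ => ρ z) (1 ⊗ₜ[ℂ] w)) =
        contractFormList (l.map fun ρ => ρ z) (1 ⊗ₜ[ℂ] w) := by
  induction l with
  | nil =>
    refine ⟨realAnalyticAt_const _ z, tensorDelbar_const _ z, ?_⟩
    simp [contractFormList, coeffInvolute_tmul]
  | cons ρ l ih =>
    obtain ⟨h1, h2, h3⟩ := ih fun σ hσ => hl σ (by simp [hσ])
    obtain ⟨g1, g2, g3⟩ := hl ρ (by simp)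
    refine ⟨g1.bilinear h1 contractForm, ?_, ?_⟩
    · have := tensorDelbar_contractForm g1 h1
      rw [g2, h2] at this
      exact this.trans (by simp)
    · have := coeffInvolute_contractForm (ρ z)
        (contractFormList (l.map fun ρ => ρ z) (1 ⊗ₜ[ℂ] w))
      rw [g3, h3] at this
      exact this

end Contraction

/-! ### Holomorphic pullback -/

section Pullback

variable {E : Type*} [NormedAddCommGroup E] [NormedSpace ℂ E] [FiniteDimensional ℂ E]

/-- A complex linear covector is a combination of the covectors `dz_k`. -/
theorem sum_dz_smul {c : E →L[ℝ] ℂ} (hc : ∀ v, c (Complex.I • v) = Complex.I * c v) :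
    ∑ k, c (Module.finBasis ℂ E k) • dz k = c := by
  have hsmul : ∀ (a : ℂ) (v : E), c (a • v) = a * c v := by
    intro a v
    have e : a • v = a.re • v + a.im • (Complex.I • v) := by
      conv_lhs => rw [← Complex.re_add_im a, add_smul, mul_smul]
      simp [Complex.coe_smul]
    rw [e, map_add, map_smul, map_smul, hc]
    conv_rhs => rw [← Complex.re_add_im a]
    simp only [Complex.real_smul]
    ring
  ext v
  conv_rhs => rw [← (Module.finBasis ℂ E).sum_repr v, map_sum]
  simp only [hsmul]
  simp [dz, mul_comm]

/-- The covector `∂̄f`, without coordinates: the conjugate linear part of the real derivative. -/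
theorem delbarFun_apply {f : E → ℂ} {z : E} (hf : DifferentiableAt ℝ f z) (v : E) :
    delbarFun f z v =
      (1 / 2 : ℂ) * (fderiv ℝ f z v + Complex.I * fderiv ℝ f z (Complex.I • v)) := by
  set d := fderiv ℝ f z
  have hsmul : ∀ (a : ℂ) (v : E), d (a • v) + Complex.I * d (Complex.I • a • v) =
      (starRingEnd ℂ) a * (d v + Complex.I * d (Complex.I • v)) := by
    intro a v
    have e : a • v = a.re • v + a.im • (Complex.I • v) := by
      conv_lhs => rw [← Complex.re_add_im a, add_smul, mul_smul]
      simp [Complex.coe_smul]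
    have e' : Complex.I • a • v = a.re • (Complex.I • v) - a.im • v := by
      rw [e, smul_add, smul_comm Complex.I, smul_comm Complex.I a.im, smul_smul, Complex.I_mul_I]
      simp [sub_eq_add_neg]
    have hr : ∀ (t : ℝ) (u : E), d (t • u) = t • d u := fun t u => d.map_smul t u
    rw [e', e, map_add, map_sub, hr, hr, hr, hr]
    have h : (starRingEnd ℂ) a = a.re - a.im * Complex.I := by
      apply Complex.ext <;> simp
    rw [h]
    simp only [Complex.real_smul]
    linear_combination ((a.im : ℂ) * d (Complex.I • v)) * Complex.I_mul_I
  have hv := (Module.finBasis ℂ E).sum_repr v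
  conv_rhs => rw [← hv, Finset.smul_sum, map_sum, map_sum, Finset.mul_sum, ← Finset.sum_add_distrib,
    Finset.mul_sum]
  simp only [delbarFun, sum_apply, antiholDeriv, dirDeriv_eq_fderiv hf, hsmul]
  refine Finset.sum_congr rfl fun k _ => ?_
  simp [dzbar, dz, d]
  ring

/-- The chain rule for `∂̄` of a function and a holomorphic map. -/
theorem delbarFun_comp {f : E → ℂ} {ψ : E → E} {z : E} (hψ : DifferentiableAt ℂ ψ z)
    (hf : DifferentiableAt ℝ f (ψ z)) :
    delbarFun (fun y => f (ψ y)) z = pullCovector (fderiv ℂ ψ z) (delbarFun f (ψ z)) := by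
  have hψ' : DifferentiableAt ℝ ψ z := hψ.restrictScalars ℝ
  ext v
  have e : ∀ u, fderiv ℝ (fun y => f (ψ y)) z u = fderiv ℝ f (ψ z) (fderiv ℂ ψ z u) := by
    intro u
    rw [fderiv_fun_comp z hf hψ', hψ.fderiv_restrictScalars ℝ]
    rfl
  rw [delbarFun_apply (DifferentiableAt.fun_comp' z hf hψ'), e, e, map_smul]
  exact (delbarFun_apply hf _).symm

/-- `∂̄` of a `(1,0)`-form commutes with pullback along a holomorphic map. -/
theorem flatDelbar_pullback {ψ : E → E} {z : E} (hψ : AnalyticAt ℂ ψ z) {κ : E → E →L[ℝ] ℂ}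
    (hκ : RealAnalyticAt κ (ψ z))
    (hlin : ∀ᶠ w in nhds (ψ z), ∀ v, κ w (Complex.I • v) = Complex.I * κ w v) :
    RealAnalyticAt (fun y => ExteriorAlgebra.map (pullCovector (fderiv ℂ ψ y))
        (ExteriorAlgebra.ι ℂ (κ (ψ y)))) z ∧
    flatDelbar (fun y => ExteriorAlgebra.map (pullCovector (fderiv ℂ ψ y))
        (ExteriorAlgebra.ι ℂ (κ (ψ y)))) z =
      ExteriorAlgebra.map (pullCovector (fderiv ℂ ψ z))
        (flatDelbar (fun w => ExteriorAlgebra.ι ℂ (κ w)) (ψ z)) := by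
  let ev : Fin (Module.finrank ℂ E) → (E →L[ℝ] ℂ) →ₗ[ℂ] ℂ := fun k =>
    { toFun := fun c => c (Module.finBasis ℂ E k)
      map_add' := fun _ _ => rfl
      map_smul' := fun _ _ => rfl }
  have hc : ∀ k, RealAnalyticAt (fun w => ev k (κ w)) (ψ z) := fun k => hκ.linear (ev k)
  have hcψ : ∀ k, RealAnalyticAt (fun y => ev k (κ (ψ y))) z := fun k =>
    realAnalyticAt_of_analyticAt ((hc k).analyticAt.fun_comp hψ.restrictScalars)
  let T : Fin (Module.finrank ℂ E) → (E →L[ℂ] E) →ₗ[ℂ] (E →L[ℝ] ℂ) := fun k =>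
    { toFun := fun A => pullCovector A (dz k)
      map_add' := fun A B => by ext v; simp
      map_smul' := fun a A => by ext v; simp [dz] }
  have hT : ∀ k, HolomorphicAt (fun y => ExteriorAlgebra.ι ℂ (T k (fderiv ℂ ψ y))) z := fun k =>
    (holomorphicAt_of_analyticAt (analyticAt_clm_comp hψ.fderiv
      (LinearMap.toContinuousLinearMap (T k)))).linear (ExteriorAlgebra.ι ℂ)
  have e1 : (fun y => ExteriorAlgebra.map (pullCovector (fderiv ℂ ψ y))
      (ExteriorAlgebra.ι ℂ (κ (ψ y)))) =ᶠ[nhds z] fun y =>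
      ∑ k, ev k (κ (ψ y)) • ExteriorAlgebra.ι ℂ (T k (fderiv ℂ ψ y)) := by
    filter_upwards [hψ.continuousAt.eventually hlin] with y hy
    conv_lhs => rw [← sum_dz_smul hy]
    simp only [map_sum, map_smul, ExteriorAlgebra.map_apply_ι]
    rfl
  have e2 : (fun w => ExteriorAlgebra.ι ℂ (κ w)) =ᶠ[nhds (ψ z)] fun w =>
      ∑ k, ev k (κ w) • ExteriorAlgebra.ι ℂ (dz k) := by
    filter_upwards [hlin] with w hw
    conv_lhs => rw [← sum_dz_smul hw]
    simp only [map_sum, map_smul]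
    rfl
  have a1 : ∀ k, RealAnalyticAt (fun y => ev k (κ (ψ y)) •
      ExteriorAlgebra.ι ℂ (T k (fderiv ℂ ψ y))) z := fun k =>
    (hcψ k).bilinear (hT k).realAnalyticAt (LinearMap.lsmul ℂ (Forms E))
  have a2 : ∀ k, RealAnalyticAt (fun w => ev k (κ w) • ExteriorAlgebra.ι ℂ (dz k)) (ψ z) :=
    fun k => (hc k).bilinear (realAnalyticAt_const _ _) (LinearMap.lsmul ℂ (Forms E))
  have h0 : ∀ (k : Fin (Module.finrank ℂ E)) (w : E),
      HolomorphicAt (fun _ : E => ExteriorAlgebra.ι ℂ (dz (E := E) k)) w := fun k w =>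
    analyticAt_const
  refine ⟨(RealAnalyticAt.sum fun k _ => a1 k).congr e1.symm, ?_⟩
  rw [flatDelbar_congr e1, flatDelbar_congr e2, flatDelbar_sum fun k _ => a1 k,
    flatDelbar_sum fun k _ => a2 k, map_sum]
  refine Finset.sum_congr rfl fun k _ => ?_
  rw [flatDelbar_smul (hcψ k) (hT k).realAnalyticAt, (hT k).flatDelbar_eq_zero,
    flatDelbar_smul (hc k) (realAnalyticAt_const _ _), (h0 k (ψ z)).flatDelbar_eq_zero]
  simp only [smul_zero, add_zero]
  rw [map_mul, ExteriorAlgebra.map_apply_ι,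
    ExteriorAlgebra.map_apply_ι,
    delbarFun_comp (f := fun w => ev k (κ w)) hψ.differentiableAt
      (hc k).analyticAt.differentiableAt]
  rfl

end Pullback

/-! ### Charts of the manifold -/

section Charts

set_option linter.unusedSectionVars false

variable {E : Type*} [NormedAddCommGroup E] [NormedSpace ℂ E]
  {X : Type*} [TopologicalSpace X] [ChartedSpace E X]

/-- The change of charts, from the chart at `x` to the chart at `y`. -/
def chartChange (E : Type*) [NormedAddCommGroup E] [NormedSpace ℂ E] {X : Type*}
    [TopologicalSpace X] [ChartedSpace E X] (x y : X) (z : E) : E :=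
  extChartAt 𝓘(ℂ, E) y ((extChartAt 𝓘(ℂ, E) x).symm z)

/-- The derivative of the inverse of the chart at `x`, as a map between copies of `E`. -/
def symmDeriv (E : Type*) [NormedAddCommGroup E] [NormedSpace ℂ E] {X : Type*}
    [TopologicalSpace X] [ChartedSpace E X] (x : X) (z : E) : E →L[ℂ] E :=
  mfderiv 𝓘(ℂ, E) 𝓘(ℂ, E) (extChartAt 𝓘(ℂ, E) x).symm z

/-- A form at a point, seen as a form on the model space `E` of the tangent space. -/
def modelForm (η : Π y : X, FormAt E y) (y : X) : Forms E := η y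

theorem inChart_eq (η : Π y : X, FormAt E y) (x : X) (z : E) :
    inChart E η x z = ExteriorAlgebra.map (pullCovector (symmDeriv E x z))
      (modelForm η ((extChartAt 𝓘(ℂ, E) x).symm z)) := rfl

theorem symm_chart {x y : X} (hy : y ∈ (extChartAt 𝓘(ℂ, E) x).source) :
    (extChartAt 𝓘(ℂ, E) x).symm (extChartAt 𝓘(ℂ, E) x y) = y :=
  (extChartAt 𝓘(ℂ, E) x).left_inv hy

/-- What holds near a point of `X` holds near its image in a chart. -/
theorem eventually_chart {x y : X} (hy : y ∈ (extChartAt 𝓘(ℂ, E) x).source) {P : X → Prop}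
    (h : ∀ᶠ y' in nhds y, P y') :
    ∀ᶠ z in nhds (extChartAt 𝓘(ℂ, E) x y), z ∈ (extChartAt 𝓘(ℂ, E) x).target ∧
      P ((extChartAt 𝓘(ℂ, E) x).symm z) := by
  have hc := continuousAt_extChartAt_symm' (I := 𝓘(ℂ, E)) hy
  rw [ContinuousAt, symm_chart hy] at hc
  exact Filter.Eventually.and ((isOpen_extChartAt_target x).mem_nhds
    ((extChartAt 𝓘(ℂ, E) x).map_source hy)) (hc.eventually h)

section Manifold

variable [IsManifold 𝓘(ℂ, E) ω X]

theorem isManifold_one (E : Type*) [NormedAddCommGroup E] [NormedSpace ℂ E] (X : Type*)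
    [TopologicalSpace X] [ChartedSpace E X] [IsManifold 𝓘(ℂ, E) ω X] :
    IsManifold 𝓘(ℂ, E) 1 X := IsManifold.of_le (n := ω) le_top

variable [FiniteDimensional ℂ E]

theorem analyticAt_chartChange {x y y' : X} (h : y' ∈ (extChartAt 𝓘(ℂ, E) x).source)
    (h' : y' ∈ (extChartAt 𝓘(ℂ, E) y).source) :
    AnalyticAt ℂ (chartChange E x y) (extChartAt 𝓘(ℂ, E) x y') := by
  have : CompleteSpace E := FiniteDimensional.complete ℂ E
  have h1 := contDiffWithinAt_ext_coord_change (I := 𝓘(ℂ, E)) (n := ω) y x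
    (y := extChartAt 𝓘(ℂ, E) x y') (by
      rw [PartialEquiv.trans_source]
      exact ⟨(extChartAt 𝓘(ℂ, E) x).map_source h, by
        rw [Set.mem_preimage, symm_chart h]
        exact h'⟩)
  rw [contDiffWithinAt_omega_iff_analyticWithinAt, modelWithCornersSelf_coe, Set.range_id,
    analyticWithinAt_univ] at h1
  exact h1

theorem mdifferentiableAt_symm {x : X} {z : E} (hz : z ∈ (extChartAt 𝓘(ℂ, E) x).target) :
    MDifferentiableAt 𝓘(ℂ, E) 𝓘(ℂ, E) (extChartAt 𝓘(ℂ, E) x).symm z := by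
  have := isManifold_one E X
  have h := mdifferentiableWithinAt_extChartAt_symm (I := 𝓘(ℂ, E)) hz
  rwa [modelWithCornersSelf_coe, Set.range_id, mdifferentiableWithinAt_univ] at h

theorem symmDeriv_self (x : X) :
    symmDeriv E x (extChartAt 𝓘(ℂ, E) x x) = ContinuousLinearMap.id ℂ E := by
  have := isManifold_one E X
  have h := mfderivWithin_range_extChartAt_symm (I := 𝓘(ℂ, E)) (x := x)
  rw [modelWithCornersSelf_coe, Set.range_id, mfderivWithin_univ] at h
  exact h

theorem map_pullCovector_id (u : Forms E) :
    ExteriorAlgebra.map (pullCovector (ContinuousLinearMap.id ℂ E)) u = u := by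
  have : pullCovector (ContinuousLinearMap.id ℂ E) = LinearMap.id := by ext; rfl
  rw [this, ExteriorAlgebra.map_id]; rfl

/-- At the point `x` the chart at `x` identifies the tangent space with `E` by the identity. -/
theorem fromChart_eq (x : X) (u : Forms E) : fromChart E x u = u := by
  have := isManifold_one E X
  have h : (mfderiv 𝓘(ℂ, E) 𝓘(ℂ, E) (extChartAt 𝓘(ℂ, E) x) x : E →L[ℂ] E) =
    ContinuousLinearMap.id ℂ E := mfderiv_extChartAt_self (I := 𝓘(ℂ, E)) (x := x)
  refine Eq.trans ?_ (map_pullCovector_id u)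
  exact congrArg (fun A : E →L[ℂ] E => ExteriorAlgebra.map (pullCovector A) u) h

theorem inChart_self (η : Π y : X, FormAt E y) (x : X) :
    inChart E η x (extChartAt 𝓘(ℂ, E) x x) = η x := by
  rw [inChart_eq, symmDeriv_self, map_pullCovector_id]
  exact congrArg (modelForm η) (extChartAt_to_inv (I := 𝓘(ℂ, E)) x)

theorem delbar_eq (η : Π y : X, FormAt E y) (x : X) :
    delbar E η x = flatDelbar (inChart E η x) (extChartAt 𝓘(ℂ, E) x x) := fromChart_eq x _

theorem del_eq (η : Π y : X, FormAt E y) (x : X) :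
    del E η x = flatDel (inChart E η x) (extChartAt 𝓘(ℂ, E) x x) := fromChart_eq x _

/-- The chain rule for the inverses of two charts. -/
theorem symmDeriv_chartChange {x y : X} {z : E} (hz : z ∈ (extChartAt 𝓘(ℂ, E) x).target)
    (hy : (extChartAt 𝓘(ℂ, E) x).symm z ∈ (extChartAt 𝓘(ℂ, E) y).source) :
    symmDeriv E x z =
      (symmDeriv E y (chartChange E x y z)).comp (fderiv ℂ (chartChange E x y) z) := by
  have hψ : DifferentiableAt ℂ (chartChange E x y) z := by
    have := (analyticAt_chartChange ((extChartAt 𝓘(ℂ, E) x).map_target hz) hy).differentiableAt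
    rwa [(extChartAt 𝓘(ℂ, E) x).right_inv hz] at this
  have hev : (extChartAt 𝓘(ℂ, E) x).symm =ᶠ[nhds z]
      (extChartAt 𝓘(ℂ, E) y).symm ∘ chartChange E x y := by
    have hsrc := (extChartAt 𝓘(ℂ, E) x).map_target hz
    have h := eventually_chart hsrc
      ((isOpen_extChartAt_source (I := 𝓘(ℂ, E)) y).mem_nhds hy)
    rw [(extChartAt 𝓘(ℂ, E) x).right_inv hz] at h
    filter_upwards [h] with w hw
    exact (symm_chart hw.2).symm
  have hy' : chartChange E x y z ∈ (extChartAt 𝓘(ℂ, E) y).target :=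
    (extChartAt 𝓘(ℂ, E) y).map_source hy
  have h1 : HasMFDerivAt 𝓘(ℂ, E) 𝓘(ℂ, E) (chartChange E x y) z
      (fderiv ℂ (chartChange E x y) z) := hψ.hasFDerivAt.hasMFDerivAt
  have h2 := ((mdifferentiableAt_symm hy').hasMFDerivAt.comp z h1).congr_of_eventuallyEq hev
  exact h2.mfderiv

/-- The expressions of a form in two charts differ by the pullback along the change of charts. -/
theorem inChart_chartChange (η : Π y : X, FormAt E y) {x y : X} {z : E}
    (hz : z ∈ (extChartAt 𝓘(ℂ, E) x).target)
    (hy : (extChartAt 𝓘(ℂ, E) x).symm z ∈ (extChartAt 𝓘(ℂ, E) y).source) :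
    inChart E η x z = ExteriorAlgebra.map (pullCovector (fderiv ℂ (chartChange E x y) z))
      (inChart E η y (chartChange E x y z)) := by
  have e : (extChartAt 𝓘(ℂ, E) y).symm (chartChange E x y z) =
    (extChartAt 𝓘(ℂ, E) x).symm z := symm_chart hy
  rw [inChart_eq, inChart_eq, symmDeriv_chartChange hz hy, e, ← AlgHom.comp_apply,
    ExteriorAlgebra.map_comp_map]
  rfl

theorem inChart_mem {p q : ℕ} {η : Π y : X, FormAt E y} {x : X} {z : E}
    (h : η ((extChartAt 𝓘(ℂ, E) x).symm z) ∈
      formType E p q ((extChartAt 𝓘(ℂ, E) x).symm z)) :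
    inChart E η x z ∈ flatType E p q :=
  map_pullCovector_mem (symmDeriv E x z) p q h

/-- The operator `∂̄` on forms of type `(1, 0)`, defined at every point by the chart at this point,
may be computed in any chart. -/
theorem inChart_delbar {η : Π y : X, FormAt E y} {x y : X}
    (hy : y ∈ (extChartAt 𝓘(ℂ, E) x).source) (ht : ∀ᶠ y' in nhds y, η y' ∈ formType E 1 0 y')
    (ha : FormAnalyticAt E η y) :
    RealAnalyticAt (inChart E η x) (extChartAt 𝓘(ℂ, E) x y) ∧
      inChart E (delbar E η) x (extChartAt 𝓘(ℂ, E) x y) =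
        flatDelbar (inChart E η x) (extChartAt 𝓘(ℂ, E) x y) := by
  set z₀ := extChartAt 𝓘(ℂ, E) x y with hz₀
  set ψ := chartChange E x y with hψdef
  have hs : y ∈ (extChartAt 𝓘(ℂ, E) y).source := mem_extChartAt_source y
  have hψz : ψ z₀ = extChartAt 𝓘(ℂ, E) y y := by
    rw [hψdef, chartChange, hz₀, symm_chart hy]
  have hψ : AnalyticAt ℂ ψ z₀ := analyticAt_chartChange hy hs
  have hmem : ∀ᶠ w in nhds (ψ z₀), inChart E η y w ∈ flatType E 1 0 := by
    rw [hψz]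
    exact (eventually_chart hs ht).mono fun w hw => inChart_mem hw.2
  -- a `(1,0)`-form is a field of complex linear covectors, to which `flatDelbar_pullback` applies
  set κ : E → E →L[ℝ] ℂ := fun w => ExteriorAlgebra.ιInv (inChart E η y w) with hκ
  have hκ' : ∀ᶠ w in nhds (ψ z₀), inChart E η y w = ExteriorAlgebra.ι ℂ (κ w) ∧
      ∀ v, κ w (Complex.I • v) = Complex.I * κ w v := by
    filter_upwards [hmem] with w hw
    obtain ⟨c, hc, he⟩ := exists_of_mem_flatType_one_zero hw
    have : κ w = c := by
      simp only [hκ, he]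
      exact ExteriorAlgebra.ι_leftInverse c
    rw [this]
    exact ⟨he, hc⟩
  have hpb : inChart E η x =ᶠ[nhds z₀] fun w => ExteriorAlgebra.map
      (pullCovector (fderiv ℂ ψ w)) (ExteriorAlgebra.ι ℂ (κ (ψ w))) := by
    have h1 := eventually_chart hy
      ((isOpen_extChartAt_source (I := 𝓘(ℂ, E)) y).mem_nhds hs)
    filter_upwards [h1, hψ.continuousAt.eventually hκ'] with w hw hw'
    rw [inChart_chartChange η hw.1 hw.2, ← hψdef, hw'.1]
  have hmain := flatDelbar_pullback hψ (κ := κ)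
    (by rw [hψz]; exact RealAnalyticAt.linear ha _) (hκ'.mono fun w hw => hw.2)
  refine ⟨hmain.1.congr (hpb.mono fun w hw => hw.symm), ?_⟩
  rw [flatDelbar_congr hpb, hmain.2, inChart_chartChange (E := E) (y := y) _
    ((extChartAt 𝓘(ℂ, E) x).map_source hy) (by rw [symm_chart hy]; exact hs), ← hψdef, ← hz₀, hψz,
    inChart_self, delbar_eq]
  rw [flatDelbar_congr (f := inChart E η y) (g := fun w => ExteriorAlgebra.ι ℂ (κ w))]
  rw [← hψz]
  exact hκ'.mono fun w hw => hw.1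

end Manifold

end Charts

/-! ### Holomorphic functions -/

section Functions

set_option linter.unusedSectionVars false

variable {E : Type*} [NormedAddCommGroup E] [NormedSpace ℂ E] [FiniteDimensional ℂ E]
  {X : Type*} [TopologicalSpace X] [ChartedSpace E X]

/-- A linear covector, seen as a form of degree one. -/
def linForm (E : Type*) [NormedAddCommGroup E] [NormedSpace ℂ E] : (E →L[ℂ] ℂ) →ₗ[ℂ] Forms E where
  toFun c := ExteriorAlgebra.ι ℂ (c.restrictScalars ℝ)
  map_add' c d := by rw [← map_add]; rfl
  map_smul' a c := by rw [RingHom.id_apply, ← map_smul]; rfl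

theorem linForm_mem (c : E →L[ℂ] ℂ) : linForm E c ∈ flatType E 1 0 := by
  rw [flatType, pow_one, pow_zero, mul_one]
  exact Submodule.subset_span ⟨c.restrictScalars ℝ, fun v => by simp, rfl⟩

/-- `∂` of a holomorphic function is its complex derivative. -/
theorem flatDel_algebraMap {h : E → ℂ} {z : E} (hh : AnalyticAt ℂ h z) :
    flatDel (fun w => algebraMap ℂ (Forms E) (h w)) z = linForm E (fderiv ℂ h z) := by
  have hR : RealAnalyticAt h z := realAnalyticAt_of_analyticAt hh.restrictScalars
  have hd : ∀ v, dirDeriv (fun w => algebraMap ℂ (Forms E) (h w)) z v =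
      algebraMap ℂ (Forms E) (fderiv ℂ h z v) := by
    intro v
    have h1 := dirDeriv_linear hR (Algebra.linearMap ℂ (Forms E)) v
    refine h1.trans ?_
    rw [dirDeriv_eq_fderiv (hh.differentiableAt.restrictScalars ℝ),
      hh.differentiableAt.fderiv_restrictScalars ℝ]
    rfl
  have key : ∀ k, ExteriorAlgebra.ι ℂ (dz k) * ((1 / 2 : ℂ) •
      (dirDeriv (fun w => algebraMap ℂ (Forms E) (h w)) z (Module.finBasis ℂ E k) -
        Complex.I • dirDeriv (fun w => algebraMap ℂ (Forms E) (h w)) z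
          (Complex.I • Module.finBasis ℂ E k))) =
      ExteriorAlgebra.ι ℂ (fderiv ℂ h z (Module.finBasis ℂ E k) • dz k) := by
    intro k
    set a := fderiv ℂ h z (Module.finBasis ℂ E k) with ha
    have e : Complex.I • algebraMap ℂ (Forms E) (Complex.I * a) = -algebraMap ℂ (Forms E) a := by
      rw [Algebra.smul_def, ← map_mul, ← mul_assoc, Complex.I_mul_I, neg_one_mul, map_neg]
    rw [hd, hd, map_smul, smul_eq_mul, ← ha, e, sub_neg_eq_add, ← two_smul ℂ, smul_smul,
      show (1 / 2 : ℂ) * 2 = 1 by norm_num, one_smul, ← Algebra.commutes, ← Algebra.smul_def,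
      map_smul]
  rw [flatDel, Finset.sum_congr rfl fun k _ => key k, ← map_sum]
  exact congrArg (ExteriorAlgebra.ι ℂ)
    (sum_dz_smul (c := (fderiv ℂ h z).restrictScalars ℝ) (fun v => by simp))

theorem inChart_funForm (f : X → ℂ) (x : X) (z : E) :
    inChart E (funForm E f) x z =
      algebraMap ℂ (Forms E) (f ((extChartAt 𝓘(ℂ, E) x).symm z)) :=
  AlgHom.commutes _ _

/-- Holomorphy of a function near a point of `X`. -/
abbrev HolAt (E : Type*) [NormedAddCommGroup E] [NormedSpace ℂ E] {X : Type*}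
    [TopologicalSpace X] [ChartedSpace E X] (f : X → ℂ) (y : X) : Prop :=
  ContMDiffAt 𝓘(ℂ, E) 𝓘(ℂ, ℂ) ω f y

section Manifold

variable [IsManifold 𝓘(ℂ, E) ω X]

theorem HolAt.analyticAt {f : X → ℂ} {x y : X} (hy : y ∈ (extChartAt 𝓘(ℂ, E) x).source)
    (hf : HolAt E f y) :
    AnalyticAt ℂ (fun z => f ((extChartAt 𝓘(ℂ, E) x).symm z)) (extChartAt 𝓘(ℂ, E) x y) := by
  rw [extChartAt_source] at hy
  rw [HolAt, contMDiffAt_iff_source_of_mem_source hy, modelWithCornersSelf_coe, Set.range_id,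
    contMDiffWithinAt_univ, contMDiffAt_iff_contDiffAt, ← contDiffWithinAt_univ,
    contDiffWithinAt_omega_iff_analyticWithinAt, analyticWithinAt_univ] at hf
  exact hf

theorem HolAt.eventually {f : X → ℂ} {y : X} (hf : HolAt E f y) :
    ∀ᶠ y' in nhds y, HolAt E f y' :=
  (contMDiffAt_iff_contMDiffAt_nhds (by simp)).mp hf

/-- Holomorphic functions are real analytic. -/
theorem HolAt.real {f : X → ℂ} {y : X} (hf : HolAt E f y) :
    ContMDiffAt 𝓘(ℝ, E) 𝓘(ℝ, ℂ) ω f y := by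
  have h := (hf.analyticAt (mem_extChartAt_source y)).restrictScalars (𝕜 := ℝ)
  rw [contMDiffAt_iff_source, modelWithCornersSelf_coe, Set.range_id, contMDiffWithinAt_univ,
    contMDiffAt_iff_contDiffAt]
  exact h.contDiffAt

/-- `∂` of a function on `X`. -/
abbrev delFun (E : Type*) [NormedAddCommGroup E] [NormedSpace ℂ E] [FiniteDimensional ℂ E]
    {X : Type*} [TopologicalSpace X] [ChartedSpace E X] (f : X → ℂ) (y : X) : FormAt E y :=
  del E (funForm E f) y

theorem delFun_eq {f : X → ℂ} {y : X} (hf : HolAt E f y) :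
    modelForm (delFun E f) y = linForm E (fderiv ℂ (fun z => f ((extChartAt 𝓘(ℂ, E) y).symm z))
      (extChartAt 𝓘(ℂ, E) y y)) := by
  have h1 : modelForm (delFun E f) y =
      flatDel (inChart E (funForm E f) y) (extChartAt 𝓘(ℂ, E) y y) := del_eq _ _
  rw [h1, ← flatDel_algebraMap (hf.analyticAt (mem_extChartAt_source y))]
  exact congrArg (fun u : E → Forms E => flatDel u (extChartAt 𝓘(ℂ, E) y y))
    (funext fun z => inChart_funForm f y z)

theorem delFun_mem {f : X → ℂ} {y : X} (hf : HolAt E f y) :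
    delFun E f y ∈ formType E 1 0 y := by
  have h := linForm_mem (fderiv ℂ (fun z => f ((extChartAt 𝓘(ℂ, E) y).symm z))
      (extChartAt 𝓘(ℂ, E) y y))
  rw [← delFun_eq hf] at h
  exact h

theorem map_pullCovector_linForm {E₁ : Type*} [NormedAddCommGroup E₁] [NormedSpace ℂ E₁]
    (A : E₁ →L[ℂ] E) (c : E →L[ℂ] ℂ) :
    ExteriorAlgebra.map (pullCovector A) (linForm E c) = linForm E₁ (c.comp A) :=
  ExteriorAlgebra.map_apply_ι _ _

/-- In every chart, `∂f` of a holomorphic function `f` is its complex derivative. -/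
theorem inChart_delFun {f : X → ℂ} {x : X} {z : E} (hz : z ∈ (extChartAt 𝓘(ℂ, E) x).target)
    (hf : HolAt E f ((extChartAt 𝓘(ℂ, E) x).symm z)) :
    inChart E (delFun E f) x z =
      linForm E (fderiv ℂ (fun z => f ((extChartAt 𝓘(ℂ, E) x).symm z)) z) := by
  obtain ⟨y, hy⟩ : ∃ y, y = (extChartAt 𝓘(ℂ, E) x).symm z := ⟨_, rfl⟩
  have hyx : y ∈ (extChartAt 𝓘(ℂ, E) x).source := hy ▸ (extChartAt 𝓘(ℂ, E) x).map_target hz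
  have hyy : (extChartAt 𝓘(ℂ, E) x).symm z ∈ (extChartAt 𝓘(ℂ, E) y).source :=
    hy ▸ mem_extChartAt_source y
  rw [← hy] at hf
  have hψz : chartChange E x y z = extChartAt 𝓘(ℂ, E) y y := by rw [chartChange, ← hy]
  rw [inChart_chartChange _ hz hyy, hψz, inChart_self]
  refine (congrArg (ExteriorAlgebra.map _) (delFun_eq hf)).trans ?_
  rw [map_pullCovector_linForm]
  congr 1
  have h1 : AnalyticAt ℂ (chartChange E x y) z := by
    have := analyticAt_chartChange (E := E) hyx (mem_extChartAt_source y)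
    rwa [hy, (extChartAt 𝓘(ℂ, E) x).right_inv hz, ← hy] at this
  have h2 := (hf.analyticAt (mem_extChartAt_source y)).differentiableAt
  rw [← hψz] at h2 ⊢
  have h3 := (h2.hasFDerivAt.comp z h1.differentiableAt.hasFDerivAt).fderiv
  rw [← h3]
  refine Filter.EventuallyEq.fderiv_eq ?_
  have h := eventually_chart hyx
    ((isOpen_extChartAt_source (I := 𝓘(ℂ, E)) y).mem_nhds (mem_extChartAt_source y))
  rw [hy, (extChartAt 𝓘(ℂ, E) x).right_inv hz, ← hy] at h
  filter_upwards [h] with w hw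
  exact congrArg f (symm_chart hw.2)

/-- For a holomorphic function `f`, the form `∂f` is holomorphic in charts. -/
theorem holomorphicAt_delFun {f : X → ℂ} {x y : X} (hy : y ∈ (extChartAt 𝓘(ℂ, E) x).source)
    (hf : HolAt E f y) :
    HolomorphicAt (inChart E (delFun E f) x) (extChartAt 𝓘(ℂ, E) x y) := by
  have h1 : AnalyticAt ℂ (fun z => fderiv ℂ (fun z => f ((extChartAt 𝓘(ℂ, E) x).symm z)) z)
      (extChartAt 𝓘(ℂ, E) x y) := (hf.analyticAt hy).fderiv
  have h2 := (holomorphicAt_of_analyticAt h1).linear (linForm E)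
  refine AnalyticAt.congr h2 ?_
  filter_upwards [eventually_chart hy hf.eventually] with w hw
  rw [inChart_delFun hw.1 hw.2]

theorem formAnalyticAt_delFun {f : X → ℂ} {y : X} (hf : HolAt E f y) :
    FormAnalyticAt E (delFun E f) y :=
  (holomorphicAt_delFun (mem_extChartAt_source y) hf).realAnalyticAt

theorem delbar_delFun {f : X → ℂ} {y : X} (hf : HolAt E f y) : delbar E (delFun E f) y = 0 := by
  rw [delbar_eq]
  exact (holomorphicAt_delFun (mem_extChartAt_source y) hf).flatDelbar_eq_zero

theorem HolAt.holomorphicAt {f : X → ℂ} {x y : X} (hy : y ∈ (extChartAt 𝓘(ℂ, E) x).source)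
    (hf : HolAt E f y) : HolomorphicAt (fun z => f ((extChartAt 𝓘(ℂ, E) x).symm z))
      (extChartAt 𝓘(ℂ, E) x y) := holomorphicAt_of_analyticAt (hf.analyticAt hy)

theorem delbar_funForm {f : X → ℂ} {y : X} (hf : HolAt E f y) :
    delbar E (funForm E f) y = 0 := by
  rw [delbar_eq]
  have := (hf.holomorphicAt (mem_extChartAt_source y)).linear (Algebra.linearMap ℂ (Forms E))
  have h : inChart E (funForm E f) y =
      fun z => Algebra.linearMap ℂ (Forms E) (f ((extChartAt 𝓘(ℂ, E) y).symm z)) :=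
    funext fun z => inChart_funForm f y z
  rw [h]
  exact HolomorphicAt.flatDelbar_eq_zero this

theorem delFun_congr {f g : X → ℂ} {y : X} (hf : HolAt E f y) (h : f =ᶠ[nhds y] g) :
    delFun E f y = delFun E g y := by
  have e : modelForm (delFun E f) y = modelForm (delFun E g) y := by
    rw [delFun_eq hf, delFun_eq (hf.congr_of_eventuallyEq h.symm)]
    congr 1
    refine Filter.EventuallyEq.fderiv_eq ?_
    exact (eventually_chart (mem_extChartAt_source y) h).mono fun w hw => hw.2
  exact e

theorem delFun_const (c : ℂ) (y : X) : delFun E (fun _ => c) y = 0 := by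
  refine (delFun_eq contMDiffAt_const).trans ?_
  rw [fderiv_fun_const, Pi.zero_apply, map_zero]
  rfl

theorem delFun_sum {ι : Type*} {s : Finset ι} {f : ι → X → ℂ} {y : X}
    (hf : ∀ i ∈ s, HolAt E (f i) y) :
    delFun E (fun y => ∑ i ∈ s, f i y) y = ∑ i ∈ s, delFun E (f i) y := by
  refine (delFun_eq (ContMDiffAt.sum hf)).trans ?_
  rw [fderiv_fun_sum fun i hi =>
    ((hf i hi).analyticAt (mem_extChartAt_source y)).differentiableAt, map_sum]
  exact Finset.sum_congr rfl fun i hi => (delFun_eq (hf i hi)).symm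

theorem delFun_mul {f g : X → ℂ} {y : X} (hf : HolAt E f y) (hg : HolAt E g y) :
    delFun E (fun y => f y * g y) y = f y • delFun E g y + g y • delFun E f y := by
  have h1 := (hf.analyticAt (mem_extChartAt_source y)).differentiableAt
  have h2 := (hg.analyticAt (mem_extChartAt_source y)).differentiableAt
  refine (delFun_eq (f := fun y => f y * g y) (ContMDiffAt.mul hf hg)).trans ?_
  rw [fderiv_fun_mul h1 h2, map_add, map_smul, map_smul, extChartAt_to_inv, ← delFun_eq hf,
    ← delFun_eq hg]
  rfl

end Manifold

end Functions

/-! ### Local frames and holomorphic sections -/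

section Frames

set_option linter.unusedSectionVars false

open Bundle

variable {E : Type*} [NormedAddCommGroup E] [NormedSpace ℂ E] [FiniteDimensional ℂ E]
  {X : Type*} [TopologicalSpace X] [ChartedSpace E X]
  {F : Type*} [NormedAddCommGroup F] [NormedSpace ℂ F] [FiniteDimensional ℂ F]
  {V : X → Type*} [TopologicalSpace (TotalSpace F V)]
  [∀ x, AddCommGroup (V x)] [∀ x, Module ℂ (V x)] [∀ x, TopologicalSpace (V x)]
  [FiberBundle F V] [VectorBundle ℂ F V]

/-- The set on which the frame of the bundle at `x` is defined. -/
abbrev frameSet (F : Type*) [NormedAddCommGroup F] [NormedSpace ℂ F] (V : X → Type*)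
    [TopologicalSpace (TotalSpace F V)] [∀ x, TopologicalSpace (V x)] [FiberBundle F V] (x : X) :
    Set X := (trivializationAt F V x).baseSet

theorem mem_frameSet (x : X) : x ∈ frameSet F V x := mem_baseSet_trivializationAt F V x

theorem eventually_frameSet {x y : X} (hy : y ∈ frameSet F V x) :
    ∀ᶠ y' in nhds y, y' ∈ frameSet F V x :=
  (trivializationAt F V x).open_baseSet.mem_nhds hy

/-- The isomorphism of the fibre at `y` with `F` given by the trivialisation at `x`. -/
def fibreEquiv {x y : X} (hy : y ∈ frameSet F V x) : V y ≃ₗ[ℂ] F :=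
  (trivializationAt F V x).linearEquivAt ℂ y hy

theorem sec_eq {x y : X} (hy : y ∈ frameSet F V x) (i : Fin (Module.finrank ℂ F)) :
    (bundleFrames F).sec x i y = (fibreEquiv (V := V) hy).symm (Module.finBasis ℂ F i) := by
  simp only [bundleFrames, fibreEquiv]
  rw [LinearEquiv.eq_symm_apply]
  exact ((trivializationAt F V x).coe_linearMapAt_of_mem (R := ℂ) hy ▸
    (trivializationAt F V x).linearMapAt_symmₗ (R := ℂ) hy (Module.finBasis ℂ F i) :)

theorem coord_eq {x y : X} (hy : y ∈ frameSet F V x) (i : Fin (Module.finrank ℂ F)) (v : V y) :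
    (bundleFrames F).coord x i y v = (Module.finBasis ℂ F).coord i (fibreEquiv hy v) := by
  simp only [bundleFrames, LinearMap.comp_apply, fibreEquiv]
  rw [Trivialization.coe_linearMapAt_of_mem _ hy]
  rfl

theorem coord_sec {x y : X} (hy : y ∈ frameSet F V x) (i j : Fin (Module.finrank ℂ F)) :
    (bundleFrames F).coord x i y ((bundleFrames F).sec x j y : V y) = if i = j then 1 else 0 := by
  rw [coord_eq hy, sec_eq hy, LinearEquiv.apply_symm_apply, Module.Basis.coord_apply,
    Module.Basis.repr_self, Finsupp.single_apply]
  simp only [eq_comm]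

theorem sum_coord_smul_sec {x y : X} (hy : y ∈ frameSet F V x) (v : V y) :
    ∑ i, (bundleFrames F).coord x i y v • (bundleFrames F).sec x i y = v := by
  apply (fibreEquiv hy).injective
  simp only [coord_eq hy, sec_eq hy, map_sum, map_smul, LinearEquiv.apply_symm_apply]
  exact (Module.finBasis ℂ F).sum_repr _

theorem sum_sec_smul_coord {x y : X} (hy : y ∈ frameSet F V x) (t : Module.Dual ℂ (V y)) :
    ∑ i, t ((bundleFrames F).sec x i y) • (bundleFrames F).coord x i y = t := by
  ext v
  conv_rhs => rw [← sum_coord_smul_sec hy v]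
  simp [mul_comm]

/-- Holomorphy of a section of the bundle near a point. -/
abbrev HolSecAt (E : Type*) [NormedAddCommGroup E] [NormedSpace ℂ E] {X : Type*}
    [TopologicalSpace X] [ChartedSpace E X]
    (F : Type*) [NormedAddCommGroup F] [NormedSpace ℂ F] {V : X → Type*}
    [TopologicalSpace (TotalSpace F V)] [∀ x, AddCommGroup (V x)] [∀ x, Module ℂ (V x)]
    [∀ x, TopologicalSpace (V x)] [FiberBundle F V] (s : Π y, V y) (y : X) : Prop :=
  ContMDiffAt 𝓘(ℂ, E) (𝓘(ℂ, E).prod 𝓘(ℂ, F)) ω (fun x => TotalSpace.mk' F x (s x)) y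

/-- Holomorphic sections are real analytic. -/
theorem HolSecAt.sectionAnalyticAt {s : Π y, V y} {x : X} (h : HolSecAt E F s x) :
    SectionAnalyticAt E F s x := by
  have : CompleteSpace F := FiniteDimensional.complete ℂ F
  rw [HolSecAt, contMDiffAt_section, contMDiffAt_iff_source, modelWithCornersSelf_coe,
    Set.range_id, contMDiffWithinAt_univ, contMDiffAt_iff_contDiffAt, ← contDiffWithinAt_univ,
    contDiffWithinAt_omega_iff_analyticWithinAt, analyticWithinAt_univ] at h
  rw [SectionAnalyticAt, contMDiffAt_section, contMDiffAt_iff_source, modelWithCornersSelf_coe,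
    Set.range_id, contMDiffWithinAt_univ, contMDiffAt_iff_contDiffAt]
  exact (h.restrictScalars (𝕜 := ℝ)).contDiffAt

variable [ContMDiffVectorBundle ω F V 𝓘(ℂ, E)]

theorem holSecAt_iff {s : Π y, V y} {x y : X} (hy : y ∈ frameSet F V x) :
    HolSecAt E F s y ↔
      ContMDiffAt 𝓘(ℂ, E) 𝓘(ℂ, F) ω (fun y => (trivializationAt F V x ⟨y, s y⟩).2) y :=
  (trivializationAt F V x).contMDiffAt_section_iff hy

theorem holSecAt_sec {x y : X} (hy : y ∈ frameSet F V x) (i : Fin (Module.finrank ℂ F)) :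
    HolSecAt E F ((bundleFrames F).sec x i : Π y, V y) y := by
  rw [holSecAt_iff hy]
  refine (contMDiffAt_const (c := Module.finBasis ℂ F i)).congr_of_eventuallyEq ?_
  filter_upwards [eventually_frameSet hy] with y' hy'
  rw [sec_eq hy']
  exact (fibreEquiv hy').apply_symm_apply _

theorem HolSecAt.coord {s : Π y, V y} {x y : X} (hs : HolSecAt E F s y)
    (hy : y ∈ frameSet F V x) (i : Fin (Module.finrank ℂ F)) :
    HolAt E (fun y => (bundleFrames F).coord x i y (s y)) y := by
  rw [holSecAt_iff hy] at hs
  have h1 : ContMDiffAt 𝓘(ℂ, F) 𝓘(ℂ, ℂ) ω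
      (LinearMap.toContinuousLinearMap ((Module.finBasis ℂ F).coord i))
      (trivializationAt F V x ⟨y, s y⟩).2 := ContinuousLinearMap.contMDiffAt _
  refine (h1.comp y hs).congr_of_eventuallyEq ?_
  filter_upwards [eventually_frameSet hy] with y' hy'
  exact coord_eq hy' i _

theorem HolSecAt.smul {f : X → ℂ} {s : Π y, V y} {y : X} (hf : HolAt E f y)
    (hs : HolSecAt E F s y) : HolSecAt E F (fun y => f y • s y) y :=
  ContMDiffAt.smul_section hf hs

theorem HolSecAt.sum {ι : Type*} {u : Finset ι} {s : ι → Π y, V y} {y : X}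
    (hs : ∀ i ∈ u, HolSecAt E F (s i) y) : HolSecAt E F (fun y => ∑ i ∈ u, s i y) y :=
  ContMDiffAt.sum_section hs

/-- The pairing of a holomorphic section of the dual bundle with a holomorphic section is
holomorphic. -/
theorem HolSecAt.apply {s : Π y, V y} {y : X} (hs : HolSecAt E F s y) {τ : Π y, V y →L[ℂ] ℂ}
    (hτ : ContMDiff 𝓘(ℂ, E) (𝓘(ℂ, E).prod 𝓘(ℂ, F →L[ℂ] ℂ)) ω
      (fun x => (TotalSpace.mk' (F →L[ℂ] ℂ) x (τ x) :
        TotalSpace (F →L[ℂ] ℂ) (fun y => V y →L[ℂ] Trivial X ℂ y)))) :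
    HolAt E (fun y => τ y (s y)) y := by
  have h := ContMDiffAt.clm_bundle_apply (IM := 𝓘(ℂ, E)) (F₁ := F) (F₂ := ℂ) (E₁ := V)
    (E₂ := Trivial X ℂ) (b := id) (hτ y) hs
  exact (contMDiffAt_section (F := ℂ) (E := Trivial X ℂ) (s := fun y => τ y (s y)) y).mp h

end Frames

/-! ### Calculus of forms on the manifold -/

section FormCalculus

set_option linter.unusedSectionVars false

variable {E : Type*} [NormedAddCommGroup E] [NormedSpace ℂ E] [FiniteDimensional ℂ E]
  {X : Type*} [TopologicalSpace X] [ChartedSpace E X]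

theorem flatDel_congr {f g : E → Forms E} {z : E} (h : f =ᶠ[nhds z] g) :
    flatDel f z = flatDel g z := by
  simp only [flatDel, dirDeriv_congr h]

theorem flatDel_neg {f : E → Forms E} {z : E} (hf : RealAnalyticAt f z) :
    flatDel (fun y => -f y) z = -flatDel f z := by
  have h := fun v => dirDeriv_linear hf (-LinearMap.id) v
  simp only [LinearMap.neg_apply, LinearMap.id_apply] at h
  rw [flatDel, flatDel, ← Finset.sum_neg_distrib]
  refine Finset.sum_congr rfl fun k _ => ?_
  rw [h, h, ← mul_neg, ← smul_neg, smul_neg Complex.I, neg_sub, sub_neg_eq_add, neg_add_eq_sub]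

theorem inChart_congr {η θ : Π y : X, FormAt E y} {x y : X}
    (hy : y ∈ (extChartAt 𝓘(ℂ, E) x).source) (h : ∀ᶠ y' in nhds y, η y' = θ y') :
    inChart E η x =ᶠ[nhds (extChartAt 𝓘(ℂ, E) x y)] inChart E θ x := by
  filter_upwards [eventually_chart hy h] with z hz
  exact congrArg (ExteriorAlgebra.map (pullCovector (symmDeriv E x z))) hz.2

theorem inChart_smul (f : X → ℂ) (η : Π y : X, FormAt E y) (x : X) (z : E) :
    inChart E (fun y => f y • η y) x z =
      f ((extChartAt 𝓘(ℂ, E) x).symm z) • inChart E η x z :=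
  map_smul (ExteriorAlgebra.map (pullCovector (symmDeriv E x z))) _ _

theorem inChart_sum {ι : Type*} (u : Finset ι) (η : ι → Π y : X, FormAt E y) (x : X) (z : E) :
    inChart E (fun y => ∑ i ∈ u, η i y) x z = ∑ i ∈ u, inChart E (η i) x z :=
  map_sum (ExteriorAlgebra.map (pullCovector (symmDeriv E x z))) _ _

theorem inChart_neg (η : Π y : X, FormAt E y) (x : X) (z : E) :
    inChart E (fun y => -η y) x z = -inChart E η x z :=
  map_neg (ExteriorAlgebra.map (pullCovector (symmDeriv E x z))) _

theorem FormAnalyticAt.congr {η θ : Π y : X, FormAt E y} {y : X} (hη : FormAnalyticAt E η y)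
    (h : ∀ᶠ y' in nhds y, η y' = θ y') : FormAnalyticAt E θ y :=
  RealAnalyticAt.congr hη (inChart_congr (mem_extChartAt_source y) h)

theorem FormAnalyticAt.sum {ι : Type*} {u : Finset ι} {η : ι → Π y : X, FormAt E y} {y : X}
    (hη : ∀ i ∈ u, FormAnalyticAt E (η i) y) : FormAnalyticAt E (fun y => ∑ i ∈ u, η i y) y :=
  RealAnalyticAt.congr (RealAnalyticAt.sum hη)
    (Filter.Eventually.of_forall fun z => (inChart_sum u η y z).symm)

theorem FormAnalyticAt.add {η θ : Π y : X, FormAt E y} {y : X} (hη : FormAnalyticAt E η y)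
    (hθ : FormAnalyticAt E θ y) : FormAnalyticAt E (fun y => η y + θ y) y := by
  have h := FormAnalyticAt.sum (u := Finset.univ) (η := fun i : Fin 2 => ![η, θ] i) (y := y)
    (fun i _ => by fin_cases i <;> assumption)
  simpa [Fin.sum_univ_two] using h

theorem FormAnalyticAt.neg {η : Π y : X, FormAt E y} {y : X} (hη : FormAnalyticAt E η y) :
    FormAnalyticAt E (fun y => -η y) y :=
  RealAnalyticAt.congr (RealAnalyticAt.linear hη (-LinearMap.id))
    (Filter.Eventually.of_forall fun z => (inChart_neg η y z).symm)

section Manifold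

variable [IsManifold 𝓘(ℂ, E) ω X]

theorem realAnalyticAt_inChart_smul {f : X → ℂ} {η : Π y : X, FormAt E y} {x y : X}
    (hy : y ∈ (extChartAt 𝓘(ℂ, E) x).source) (hf : HolAt E f y)
    (hη : RealAnalyticAt (inChart E η x) (extChartAt 𝓘(ℂ, E) x y)) :
    RealAnalyticAt (inChart E (fun y => f y • η y) x) (extChartAt 𝓘(ℂ, E) x y) :=
  RealAnalyticAt.congr
    ((hf.holomorphicAt hy).realAnalyticAt.bilinear hη (LinearMap.lsmul ℂ (Forms E)))
    (Filter.Eventually.of_forall fun z => (inChart_smul f η x z).symm)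

theorem FormAnalyticAt.smul {f : X → ℂ} {η : Π y : X, FormAt E y} {y : X} (hf : HolAt E f y)
    (hη : FormAnalyticAt E η y) : FormAnalyticAt E (fun y => f y • η y) y :=
  realAnalyticAt_inChart_smul (mem_extChartAt_source y) hf hη

theorem delbar_congr {η θ : Π y : X, FormAt E y} {y : X} (h : ∀ᶠ y' in nhds y, η y' = θ y') :
    delbar E η y = delbar E θ y := by
  rw [delbar_eq, delbar_eq]
  exact flatDelbar_congr (inChart_congr (mem_extChartAt_source y) h)

theorem delbar_sum {ι : Type*} {u : Finset ι} {η : ι → Π y : X, FormAt E y} {y : X}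
    (hη : ∀ i ∈ u, FormAnalyticAt E (η i) y) :
    delbar E (fun y => ∑ i ∈ u, η i y) y = ∑ i ∈ u, delbar E (η i) y := by
  simp only [delbar_eq]
  rw [funext fun z => inChart_sum u η y z]
  exact flatDelbar_sum hη

theorem delbar_add {η θ : Π y : X, FormAt E y} {y : X} (hη : FormAnalyticAt E η y)
    (hθ : FormAnalyticAt E θ y) :
    delbar E (fun y => η y + θ y) y = delbar E η y + delbar E θ y := by
  have h := delbar_sum (u := Finset.univ) (η := fun i : Fin 2 => ![η, θ] i) (y := y)
    (fun i _ => by fin_cases i <;> assumption)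
  simpa [Fin.sum_univ_two] using h

theorem delbar_smul {f : X → ℂ} {η : Π y : X, FormAt E y} {y : X} (hf : HolAt E f y)
    (hη : FormAnalyticAt E η y) : delbar E (fun y => f y • η y) y = f y • delbar E η y := by
  simp only [delbar_eq]
  rw [funext fun z => inChart_smul f η y z]
  refine (flatDelbar_holomorphic_smul (hf.holomorphicAt (mem_extChartAt_source y)) hη).trans ?_
  rw [extChartAt_to_inv]
  rfl

theorem delbar_neg {η : Π y : X, FormAt E y} {y : X} (hη : FormAnalyticAt E η y) :
    delbar E (fun y => -η y) y = -delbar E η y := by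
  simp only [delbar_eq]
  rw [funext fun z => inChart_neg η y z]
  exact flatDelbar_neg hη

theorem del_congr {η θ : Π y : X, FormAt E y} {y : X} (h : ∀ᶠ y' in nhds y, η y' = θ y') :
    del E η y = del E θ y := by
  rw [del_eq, del_eq]
  exact flatDel_congr (inChart_congr (mem_extChartAt_source y) h)

theorem del_neg {η : Π y : X, FormAt E y} {y : X} (hη : FormAnalyticAt E η y) :
    del E (fun y => -η y) y = -del E η y := by
  simp only [del_eq]
  rw [funext fun z => inChart_neg η y z]
  exact flatDel_neg hη

theorem delbar_mem {p q : ℕ} {η : Π y : X, FormAt E y} {y : X} (hη : FormAnalyticAt E η y)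
    (h : ∀ᶠ y' in nhds y, η y' ∈ formType E p q y') :
    delbar E η y ∈ formType E p (q + 1) y := by
  have h1 : flatDelbar (inChart E η y) (extChartAt 𝓘(ℂ, E) y y) ∈ flatType E p (q + 1) :=
    flatDelbar_mem hη ((eventually_chart (mem_extChartAt_source y) h).mono
      fun z hz => inChart_mem hz.2)
  rw [delbar_eq]
  exact h1

end Manifold

end FormCalculus

/-! ### Connection matrices -/

section Connection

set_option linter.unusedSectionVars false

open Bundle

variable {E : Type*} [NormedAddCommGroup E] [NormedSpace ℂ E] [FiniteDimensional ℂ E]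
  {X : Type*} [TopologicalSpace X] [ChartedSpace E X] [IsManifold 𝓘(ℂ, E) ω X]
  {F : Type*} [NormedAddCommGroup F] [NormedSpace ℂ F] [FiniteDimensional ℂ F]
  {V : X → Type*} [TopologicalSpace (TotalSpace F V)]
  [∀ x, AddCommGroup (V x)] [∀ x, Module ℂ (V x)] [∀ x, TopologicalSpace (V x)]
  [FiberBundle F V] [VectorBundle ℂ F V] [ContMDiffVectorBundle ω F V 𝓘(ℂ, E)]
  {D : (Π y, V y) → Π y : X, FormAt E y ⊗[ℂ] V y}

/-- A connection is a local operator. -/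
theorem IsConnection.congr (hD : IsConnection F D) {s t : Π y, V y} {y : X}
    (hs : HolSecAt E F s y) (h : ∀ᶠ y' in nhds y, s y' = t y') : D s y = D t y := by
  classical
  have ht : HolSecAt E F t y := hs.congr_of_eventuallyEq (h.mono fun y' hy' => by simp only [hy'])
  -- compare `s` and `t` after multiplication with the indicator function of the set where they
  -- agree, which is constant near `y`
  set f : X → ℂ := fun y' => if s y' = t y' then 1 else 0 with hf
  have hf1 : f =ᶠ[nhds y] fun _ => 1 := h.mono fun y' hy' => by simp [hf, hy']
  have hfh : HolAt E f y := contMDiffAt_const.congr_of_eventuallyEq hf1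
  have e : (fun y' => f y' • s y') = fun y' => f y' • t y' := by
    funext y'
    by_cases hy' : s y' = t y' <;> simp [hf, hy']
  have h1 := hD.leibniz f s y hfh.real hs.sectionAnalyticAt
  rw [e, hD.leibniz f t y hfh.real ht.sectionAnalyticAt, h.self_of_nhds, hf1.self_of_nhds, one_smul,
    one_smul] at h1
  exact (add_left_cancel h1).symm

theorem IsConnection.zero (hD : IsConnection F D) (y : X) : D (fun _ => 0) y = 0 := by
  have h0 : HolSecAt E F (fun y => (0 : V y)) y := by
    have := HolSecAt.sum (E := E) (F := F) (V := V) (u := (∅ : Finset ℕ)) (s := fun _ y => 0)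
      (y := y) (by simp)
    simpa using this
  have h := hD.add (fun _ => 0) (fun _ => 0) y h0.sectionAnalyticAt h0.sectionAnalyticAt
  simpa using h

/-- The Leibniz rule for a combination of sections with holomorphic coefficients. -/
theorem IsConnection.sum (hD : IsConnection F D) {ι : Type*} (u : Finset ι) {f : ι → X → ℂ}
    {s : ι → Π y, V y} {y : X} (hf : ∀ i, HolAt E (f i) y) (hs : ∀ i, HolSecAt E F (s i) y) :
    D (fun y => ∑ i ∈ u, f i y • s i y) y =
      ∑ i ∈ u, (delFun E (f i) y ⊗ₜ[ℂ] s i y + f i y • D (s i) y) := by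
  classical
  induction u using Finset.induction_on with
  | empty => simpa using hD.zero y
  | insert a u ha ih =>
    rw [Finset.sum_insert ha, ← ih]
    simp only [Finset.sum_insert ha]
    rw [hD.add (fun y => f a y • s a y) (fun y => ∑ i ∈ u, f i y • s i y) y
      (HolSecAt.smul (hf a) (hs a)).sectionAnalyticAt
      (HolSecAt.sum fun i _ => HolSecAt.smul (hf i) (hs i)).sectionAnalyticAt,
      hD.leibniz _ _ _ (hf a).real (hs a).sectionAnalyticAt]

/-- The entry `(i, j)` of the connection matrix of `D` in the frame at `x`. -/
def connMatrix (D : (Π y, V y) → Π y : X, FormAt E y ⊗[ℂ] V y) (x : X)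
    (i j : Fin (Module.finrank ℂ F)) (y : X) : FormAt E y :=
  evalAt ((bundleFrames F).coord x i y) (D ((bundleFrames F).sec x j) y)

theorem sum_connMatrix {x y : X} (hy : y ∈ frameSet F V x) (j : Fin (Module.finrank ℂ F)) :
    ∑ i, connMatrix D x i j y ⊗ₜ[ℂ] ((bundleFrames F).sec x i y : V y) =
      D ((bundleFrames F).sec x j) y :=
  sum_evalAt_tmul _ _ (sum_coord_smul_sec hy) _

theorem IsConnection.connMatrix_mem (hD : IsConnection F D) {x y : X} (hy : y ∈ frameSet F V x)
    (i j : Fin (Module.finrank ℂ F)) :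
    connMatrix (V := V) D x i j y ∈ formType E 1 0 y :=
  evalAt_mem _ (hD.type _ y (holSecAt_sec hy j).sectionAnalyticAt)

/-- The connection matrices in two frames. -/
theorem IsConnection.connMatrix_eq (hD : IsConnection F D) {x x' y : X} (hy : y ∈ frameSet F V x)
    (hy' : y ∈ frameSet F V x') (i j : Fin (Module.finrank ℂ F)) :
    connMatrix (V := V) D x i j y =
      ∑ l, ((bundleFrames F).coord x i y ((bundleFrames F).sec x' l y : V y) •
          delFun E (fun y => (bundleFrames F).coord x' l y ((bundleFrames F).sec x j y : V y)) y +
        (bundleFrames F).coord x' l y ((bundleFrames F).sec x j y : V y) •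
          ∑ k, (bundleFrames F).coord x i y ((bundleFrames F).sec x' k y : V y) •
            connMatrix (V := V) D x' k l y) := by
  have h1 : D ((bundleFrames F).sec x j) y = D (fun y => ∑ l,
      (bundleFrames F).coord x' l y ((bundleFrames F).sec x j y : V y) •
        ((bundleFrames F).sec x' l y : V y)) y :=
    hD.congr (holSecAt_sec hy j) ((eventually_frameSet hy').mono fun y' h =>
      (sum_coord_smul_sec h _).symm)
  rw [connMatrix, h1, hD.sum _ (fun l => (holSecAt_sec hy j).coord hy' l)
    (fun l => holSecAt_sec hy' l), map_sum]
  refine Finset.sum_congr rfl fun l _ => ?_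
  rw [map_add, evalAt_tmul, map_smul, ← sum_connMatrix (D := D) hy', map_sum]
  simp only [evalAt_tmul]

end Connection

/-! ### The dual connection -/

section DualConnection

set_option linter.unusedSectionVars false

open Bundle

variable {E : Type*} [NormedAddCommGroup E] [NormedSpace ℂ E] [FiniteDimensional ℂ E]
  {X : Type*} [TopologicalSpace X] [ChartedSpace E X] [IsManifold 𝓘(ℂ, E) ω X]
  {F : Type*} [NormedAddCommGroup F] [NormedSpace ℂ F] [FiniteDimensional ℂ F]
  {V : X → Type*} [TopologicalSpace (TotalSpace F V)]
  [∀ x, AddCommGroup (V x)] [∀ x, Module ℂ (V x)] [∀ x, TopologicalSpace (V x)]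
  [FiberBundle F V] [VectorBundle ℂ F V] [ContMDiffVectorBundle ω F V 𝓘(ℂ, E)]
  {D : (Π y, V y) → Π y : X, FormAt E y ⊗[ℂ] V y}

theorem evalAt_smul {L W : Type*} [Ring L] [Algebra ℂ L] [AddCommGroup W] [Module ℂ W]
    (f : Module.Dual ℂ W) (a : L) (x : L ⊗[ℂ] W) : evalAt f (a • x) = a * evalAt f x := by
  induction x using TensorProduct.induction_on with
  | zero => simp
  | add x y hx hy => simp only [smul_add, map_add, mul_add, hx, hy]
  | tmul η v => rw [TensorProduct.smul_tmul', evalAt_tmul, evalAt_tmul, smul_eq_mul, mul_smul_comm]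

theorem IsConnection.connMatrix_analytic (hD : IsConnection F D) {x y : X}
    (hy : y ∈ frameSet F V x) (i j : Fin (Module.finrank ℂ F)) :
    FormAnalyticAt E (connMatrix (V := V) D x i j) y := by
  have hyy := mem_frameSet (F := F) (V := V) y
  refine FormAnalyticAt.congr (FormAnalyticAt.sum (u := Finset.univ) fun k _ =>
    FormAnalyticAt.smul ((holSecAt_sec hyy k).coord hy i)
      (hD.analytic _ y (holSecAt_sec hy j).sectionAnalyticAt k)) ?_
  filter_upwards [eventually_frameSet hyy] with y' hy'
  conv_rhs => rw [connMatrix, ← sum_evalAt_tmul _ _ (sum_coord_smul_sec hy')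
    (D ((bundleFrames F).sec x j) y'), map_sum]
  simp only [evalAt_tmul]

/-- The `(0,1)`-derivative of the connection matrix transforms as a tensor. -/
theorem IsConnection.delbar_connMatrix (hD : IsConnection F D) {x x' y : X}
    (hy : y ∈ frameSet F V x) (hy' : y ∈ frameSet F V x') (i j : Fin (Module.finrank ℂ F)) :
    delbar E (connMatrix (V := V) D x i j) y =
      ∑ l, (bundleFrames F).coord x' l y ((bundleFrames F).sec x j y : V y) •
        ∑ k, (bundleFrames F).coord x i y ((bundleFrames F).sec x' k y : V y) •
          delbar E (connMatrix (V := V) D x' k l) y := by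
  have hg : ∀ l, HolAt E (fun y =>
      (bundleFrames F).coord x' l y ((bundleFrames F).sec x j y : V y)) y :=
    fun l => (holSecAt_sec hy j).coord hy' l
  have hh : ∀ k, HolAt E (fun y =>
      (bundleFrames F).coord x i y ((bundleFrames F).sec x' k y : V y)) y :=
    fun k => (holSecAt_sec hy' k).coord hy i
  have hA := fun k l => hD.connMatrix_analytic hy' k l
  have h1 : ∀ l, FormAnalyticAt E (fun y =>
      (bundleFrames F).coord x i y ((bundleFrames F).sec x' l y : V y) •
        delFun E (fun y => (bundleFrames F).coord x' l y
          ((bundleFrames F).sec x j y : V y)) y) y := fun l =>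
    FormAnalyticAt.smul (hh l) (formAnalyticAt_delFun (hg l))
  have h2 : ∀ l, FormAnalyticAt E (fun y => ∑ k,
      (bundleFrames F).coord x i y ((bundleFrames F).sec x' k y : V y) •
        connMatrix (V := V) D x' k l y) y := fun l =>
    FormAnalyticAt.sum fun k _ => FormAnalyticAt.smul (hh k) (hA k l)
  have h3 : ∀ l, FormAnalyticAt E (fun y =>
      (bundleFrames F).coord x' l y ((bundleFrames F).sec x j y : V y) • ∑ k,
        (bundleFrames F).coord x i y ((bundleFrames F).sec x' k y : V y) •
          connMatrix (V := V) D x' k l y) y := fun l => FormAnalyticAt.smul (hg l) (h2 l)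
  have e : delbar E (connMatrix (V := V) D x i j) y = delbar E (fun y =>
      ∑ l, (bundleFrames F).coord x i y ((bundleFrames F).sec x' l y : V y) •
          delFun E (fun y => (bundleFrames F).coord x' l y ((bundleFrames F).sec x j y : V y)) y +
        ∑ l, (bundleFrames F).coord x' l y ((bundleFrames F).sec x j y : V y) •
          ∑ k, (bundleFrames F).coord x i y ((bundleFrames F).sec x' k y : V y) •
            connMatrix (V := V) D x' k l y) y := by
    refine delbar_congr ?_
    filter_upwards [eventually_frameSet hy, eventually_frameSet hy'] with y₁ h h'
    rw [hD.connMatrix_eq h h', Finset.sum_add_distrib]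
  -- the inhomogeneous term of the transformation law consists of the forms `∂g` with `g`
  -- holomorphic, which are annihilated by `∂̄`
  rw [e, delbar_add (FormAnalyticAt.sum fun l _ => h1 l) (FormAnalyticAt.sum fun l _ => h3 l),
    delbar_sum fun l _ => h1 l, delbar_sum fun l _ => h3 l,
    Finset.sum_eq_zero fun l _ => by
      rw [delbar_smul (hh l) (formAnalyticAt_delFun (hg l)), delbar_delFun (hg l), smul_zero],
    zero_add]
  refine Finset.sum_congr rfl fun l _ => ?_
  rw [delbar_smul (hg l) (h2 l), delbar_sum fun k _ => FormAnalyticAt.smul (hh k) (hA k l)]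
  simp only [delbar_smul (hh _) (hA _ l)]

/-- The defining formula of the dual connection, for all holomorphic sections. -/
theorem IsConnection.evalAt_dualConnection (hD : IsConnection F D) {t : Π y, Module.Dual ℂ (V y)}
    {y : X} (ht : ∀ i, HolAt E (fun y' => t y' ((bundleFrames F).sec y i y')) y) {s : Π y, V y}
    (hs : HolSecAt E F s y) :
    evalAt (Module.Dual.eval ℂ (V y) (s y)) (dualConnection (bundleFrames F) D t y) =
      delFun E (fun y' => t y' (s y')) y - evalAt (t y) (D s y) := by
  have hyy := mem_frameSet (F := F) (V := V) y
  have hf := fun i => hs.coord hyy i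
  have hm : ∀ i, HolAt E (fun y' => (bundleFrames F).coord y i y' (s y') *
      t y' ((bundleFrames F).sec y i y')) y := fun i => ContMDiffAt.mul (hf i) (ht i)
  have h1 : D s y = D (fun y' => ∑ i, (bundleFrames F).coord y i y' (s y') •
      (bundleFrames F).sec y i y') y :=
    hD.congr hs ((eventually_frameSet hyy).mono fun y' h => (sum_coord_smul_sec h _).symm)
  have h2 : delFun E (fun y' => t y' (s y')) y = delFun E (fun y' => ∑ i,
      (bundleFrames F).coord y i y' (s y') * t y' ((bundleFrames F).sec y i y')) y := by
    refine (delFun_congr (ContMDiffAt.sum fun i _ => hm i) ?_).symm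
    filter_upwards [eventually_frameSet hyy] with y' h
    conv_rhs => rw [← sum_coord_smul_sec h (s y')]
    simp
  rw [h1, h2, delFun_sum fun i _ => hm i,
    hD.sum _ hf fun i => holSecAt_sec hyy i, dualConnection, map_sum, map_sum,
    ← Finset.sum_sub_distrib]
  refine Finset.sum_congr rfl fun i _ => ?_
  rw [delFun_mul (hf i) (ht i), map_add, evalAt_tmul, evalAt_tmul, map_smul,
    Module.Dual.eval_apply, smul_sub]
  abel

/-- The dual connection in the frame at `x`. -/
theorem IsConnection.dualConnection_eq (hD : IsConnection F D) {t : Π y, Module.Dual ℂ (V y)}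
    {x y : X} (hy : y ∈ frameSet F V x)
    (ht : ∀ i, HolAt E (fun y' => t y' ((bundleFrames F).sec y i y')) y) :
    dualConnection (bundleFrames F) D t y =
      ∑ i, (delFun E (fun y' => t y' ((bundleFrames F).sec x i y')) y -
        evalAt (t y) (D ((bundleFrames F).sec x i) y)) ⊗ₜ[ℂ] (bundleFrames F).coord x i y := by
  rw [← sum_evalAt_tmul (fun i => (bundleFrames F).coord x i y)
    (fun i => Module.Dual.eval ℂ (V y) ((bundleFrames F).sec x i y))
    (fun t => sum_sec_smul_coord hy t) (dualConnection (bundleFrames F) D t y)]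
  exact Finset.sum_congr rfl fun i _ => by rw [hD.evalAt_dualConnection ht (holSecAt_sec hy i)]

/-- On sections of the dual bundle that are holomorphic, `∂̄` vanishes, and the total connection is
the dual connection. -/
theorem totalConnection_dual {t : Π y, Module.Dual ℂ (V y)} {y : X}
    (ht : ∀ i, HolAt E (fun y' => t y' ((bundleFrames F).sec y i y')) y) :
    totalConnection (bundleFrames F).dual (dualConnection (bundleFrames F) D) t y =
      dualConnection (bundleFrames F) D t y := by
  rw [totalConnection, delbarSection, Finset.sum_eq_zero fun i _ => ?_, add_zero]
  exact (congrArg (· ⊗ₜ[ℂ] _) (delbar_funForm (ht i))).trans (TensorProduct.zero_tmul _ _)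

theorem IsConnection.evalAt_total_coord (hD : IsConnection F D) {x y : X}
    (hy : y ∈ frameSet F V x) (i j : Fin (Module.finrank ℂ F)) :
    evalAt (Module.Dual.eval ℂ (V y) ((bundleFrames F).sec x j y))
      (totalConnection (bundleFrames F).dual (dualConnection (bundleFrames F) D)
        ((bundleFrames F).coord x i) y) = -connMatrix D x i j y := by
  have ht : ∀ k, HolAt E (fun y' =>
      (bundleFrames F).coord x i y' ((bundleFrames F).sec y k y' : V y')) y := fun k =>
    (holSecAt_sec (mem_frameSet y) k).coord hy i
  have h0 : delFun E (fun y' =>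
      (bundleFrames F).coord x i y' ((bundleFrames F).sec x j y' : V y')) y = 0 := by
    rw [delFun_congr (g := fun _ => if i = j then 1 else 0) ((holSecAt_sec hy j).coord hy i),
      delFun_const]
    filter_upwards [eventually_frameSet hy] with y' hy'
    exact coord_sec hy' i j
  rw [totalConnection_dual ht, hD.evalAt_dualConnection ht (holSecAt_sec hy j), h0, zero_sub]
  rfl

/-- The connection matrix of the dual bundle, in the dual frame, is `-A`, transposed. -/
theorem IsConnection.total_coord (hD : IsConnection F D) {x y : X}
    (hy : y ∈ frameSet F V x) (i : Fin (Module.finrank ℂ F)) :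
    totalConnection (bundleFrames F).dual (dualConnection (bundleFrames F) D)
        ((bundleFrames F).coord x i : Π y, Module.Dual ℂ (V y)) y =
      -∑ j, connMatrix D x i j y ⊗ₜ[ℂ] (bundleFrames F).coord x j y := by
  refine (sum_evalAt_tmul (fun i => (bundleFrames F).coord x i y)
    (fun i => Module.Dual.eval ℂ (V y) ((bundleFrames F).sec x i y))
    (fun t => sum_sec_smul_coord hy t) _).symm.trans ?_
  rw [← Finset.sum_neg_distrib]
  refine Finset.sum_congr rfl fun j _ => ?_
  rw [hD.evalAt_total_coord hy, TensorProduct.neg_tmul]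

end DualConnection

/-! ### The curvature of the dual bundle -/

section Curvature

set_option linter.unusedSectionVars false

open Bundle

variable {E : Type*} [NormedAddCommGroup E] [NormedSpace ℂ E] [FiniteDimensional ℂ E]

/-- The algebra in the computation of the curvature: the terms without `∂̄` cancel. -/
theorem sum_structure_equation {L W ι : Type*} [Ring L] [Algebra ℂ L] [AddCommGroup W] [Module ℂ W]
    [Fintype ι] {a b d : ι → L} {c : ι → ι → L} (w : ι → W)
    (hd : ∀ l, d l = ∑ j, c j l * a j) (hac : ∀ j l, a j * c j l = -(c j l * a j)) :
    ∑ j, ((-d j - b j) ⊗ₜ[ℂ] w j + a j • -∑ l, c j l ⊗ₜ[ℂ] w l) = -∑ j, b j ⊗ₜ[ℂ] w j := by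
  have e : ∑ j, a j • -∑ l, c j l ⊗ₜ[ℂ] w l = ∑ l, d l ⊗ₜ[ℂ] w l := by
    simp only [hd, smul_neg, Finset.smul_sum, TensorProduct.smul_tmul', smul_eq_mul,
      TensorProduct.sum_tmul, hac, TensorProduct.neg_tmul, Finset.sum_neg_distrib, neg_neg]
    exact Finset.sum_comm
  rw [Finset.sum_add_distrib, e]
  simp only [sub_eq_add_neg, TensorProduct.add_tmul, TensorProduct.neg_tmul,
    Finset.sum_add_distrib, Finset.sum_neg_distrib]
  abel

variable {X : Type*} [TopologicalSpace X] [ChartedSpace E X]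

theorem exists_ι_of_mem_formType {y : X} {a : FormAt E y} (ha : a ∈ formType E 1 0 y) :
    ∃ c, a = ExteriorAlgebra.ι ℂ c := by
  rw [formType, pow_one, pow_zero, mul_one] at ha
  induction ha using Submodule.span_induction with
  | mem a h => exact h.imp fun c hc => hc.2
  | zero => exact ⟨0, (map_zero _).symm⟩
  | add a b _ _ ha hb =>
    obtain ⟨c, rfl⟩ := ha
    obtain ⟨d, rfl⟩ := hb
    exact ⟨c + d, (map_add _ _ _).symm⟩
  | smul r a _ ha =>
    obtain ⟨c, rfl⟩ := ha
    exact ⟨r • c, (map_smul _ _ _).symm⟩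

theorem involute_of_mem_formType {y : X} {a : FormAt E y} (ha : a ∈ formType E 1 0 y) :
    CliffordAlgebra.involute a = -a := by
  obtain ⟨c, rfl⟩ := exists_ι_of_mem_formType ha
  exact involute_ι' c

theorem mul_eq_neg_mul_of_mem_formType {y : X} {a b : FormAt E y} (ha : a ∈ formType E 1 0 y)
    (hb : b ∈ formType E 1 0 y) : a * b = -(b * a) := by
  obtain ⟨c, rfl⟩ := exists_ι_of_mem_formType ha
  obtain ⟨d, rfl⟩ := exists_ι_of_mem_formType hb
  exact eq_neg_of_add_eq_zero_left (ExteriorAlgebra.ι_add_mul_swap c d)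

theorem formType_one_one_le (y : X) : formType E 1 1 y ≤ centre (FormAt E y) :=
  flatType_one_one_le (E := E)

variable [IsManifold 𝓘(ℂ, E) ω X]
  {F : Type*} [NormedAddCommGroup F] [NormedSpace ℂ F] [FiniteDimensional ℂ F]
  {V : X → Type*} [TopologicalSpace (TotalSpace F V)]
  [∀ x, AddCommGroup (V x)] [∀ x, Module ℂ (V x)] [∀ x, TopologicalSpace (V x)]
  [FiberBundle F V] [VectorBundle ℂ F V] [ContMDiffVectorBundle ω F V 𝓘(ℂ, E)]
  {D : (Π y, V y) → Π y : X, FormAt E y ⊗[ℂ] V y}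

theorem involute_connMatrix (hD : IsConnection F D) {x y : X}
    (hy : y ∈ frameSet F V x) (i j : Fin (Module.finrank ℂ F)) :
    CliffordAlgebra.involute (connMatrix (V := V) D x i j y) = -connMatrix (V := V) D x i j y :=
  involute_of_mem_formType (hD.connMatrix_mem hy i j)

/-- Flatness of `D`, in terms of the connection matrix `A`: the equation `∂A + A ∧ A = 0`, written
with the transposed product. -/
theorem IsFlat.del_connMatrix (hflat : IsFlat F D) (hD : IsConnection F D) (y : X)
    (i j : Fin (Module.finrank ℂ F)) :
    del E (connMatrix (V := V) D y i j) y =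
      ∑ l, connMatrix (V := V) D y l j y * connMatrix (V := V) D y i l y := by
  have hy := mem_frameSet (F := F) (V := V) y
  have h := hflat ((bundleFrames F).sec y j) y (holSecAt_sec hy j).sectionAnalyticAt
  have h2 := congrArg (evalAt ((bundleFrames F).coord y i y)) h
  rw [extendToForms, map_sum, map_zero] at h2
  have e : ∀ l, evalAt ((bundleFrames F).coord y i y)
      (del E (fun y' => evalAt ((bundleFrames F).coord y l y') (D ((bundleFrames F).sec y j) y')) y
          ⊗ₜ[ℂ] ((bundleFrames F).sec y l y : V y) +
        CliffordAlgebra.involute (evalAt ((bundleFrames F).coord y l y)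
          (D ((bundleFrames F).sec y j) y)) • D ((bundleFrames F).sec y l) y) =
      (if i = l then del E (connMatrix (V := V) D y l j) y else 0) -
        connMatrix (V := V) D y l j y * connMatrix (V := V) D y i l y := by
    intro l
    rw [map_add, evalAt_tmul, coord_sec hy, ite_smul, one_smul, zero_smul]
    have h3 := involute_connMatrix hD hy l j
    rw [connMatrix] at h3
    rw [h3, sub_eq_add_neg, ← neg_mul]
    congr 1
    exact evalAt_smul _ _ _
  rw [Finset.sum_congr rfl fun l _ => e l, Finset.sum_sub_distrib,
    Finset.sum_ite_eq Finset.univ i, if_pos (Finset.mem_univ i), sub_eq_zero] at h2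
  exact h2

/-- The curvature of the dual bundle, in the frame at the point itself. -/
theorem dualCurvature_coord_self (hD : IsConnection F D) (hflat : IsFlat F D) (y : X)
    (i : Fin (Module.finrank ℂ F)) :
    dualCurvature F D y ((bundleFrames F).coord y i y : Module.Dual ℂ (V y)) =
      -∑ j, delbar E (connMatrix (V := V) D y i j) y ⊗ₜ[ℂ] (bundleFrames F).coord y j y := by
  have hy := mem_frameSet (F := F) (V := V) y
  have h1 : dualCurvature F D y ((bundleFrames F).coord y i y : Module.Dual ℂ (V y)) =
      extendToForms (bundleFrames F).dual (extD E)
        (totalConnection (bundleFrames F).dual (dualConnection (bundleFrames F) D))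
        (totalConnection (bundleFrames F).dual (dualConnection (bundleFrames F) D)
          ((bundleFrames F).coord y i)) y := by
    rw [dualCurvature, curvature, LinearMap.sum_apply, Finset.sum_eq_single i]
    · refine (LinearMap.smulRight_apply _ _ _).trans ?_
      have : (bundleFrames F).dual.coord y i y ((bundleFrames F).coord y i y) = (1 : ℂ) :=
        (coord_sec hy i i).trans (if_pos rfl)
      rw [this, one_smul]
      rfl
    · intro l _ hl
      refine (LinearMap.smulRight_apply _ _ _).trans ?_
      have : (bundleFrames F).dual.coord y l y ((bundleFrames F).coord y i y) = (0 : ℂ) :=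
        (coord_sec hy i l).trans (if_neg (Ne.symm hl))
      rw [this, zero_smul]
    · simp
  rw [h1, extendToForms]
  have hev : ∀ j, ∀ᶠ y' in nhds y, evalAt ((bundleFrames F).dual.coord y j y')
      (totalConnection (bundleFrames F).dual (dualConnection (bundleFrames F) D)
        ((bundleFrames F).coord y i) y') = -connMatrix D y i j y' := fun j =>
    (eventually_frameSet hy).mono fun y' hy' => hD.evalAt_total_coord hy' i j
  have hA := fun j => hD.connMatrix_analytic hy i j
  have e : ∀ j, extD E (fun y' => evalAt ((bundleFrames F).dual.coord y j y')
      (totalConnection (bundleFrames F).dual (dualConnection (bundleFrames F) D)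
        ((bundleFrames F).coord y i) y')) y =
      -del E (connMatrix (V := V) D y i j) y - delbar E (connMatrix (V := V) D y i j) y := by
    intro j
    rw [extD, del_congr (hev j), delbar_congr (hev j), del_neg (hA j), delbar_neg (hA j),
      sub_eq_add_neg]
  have e2 : ∀ j, CliffordAlgebra.involute (evalAt ((bundleFrames F).dual.coord y j y)
      (totalConnection (bundleFrames F).dual (dualConnection (bundleFrames F) D)
        ((bundleFrames F).coord y i) y)) = connMatrix (V := V) D y i j y := by
    intro j
    rw [(hev j).self_of_nhds, map_neg, involute_connMatrix hD hy, neg_neg]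
  have e3 : ∀ j, totalConnection (bundleFrames F).dual (dualConnection (bundleFrames F) D)
      ((bundleFrames F).dual.sec y j) y = -∑ l, connMatrix (V := V) D y j l y ⊗ₜ[ℂ]
        (bundleFrames F).coord y l y := fun j => hD.total_coord hy j
  simp only [e, e2, e3]
  exact sum_structure_equation _ (fun l => hflat.del_connMatrix hD y i l) fun j l =>
    mul_eq_neg_mul_of_mem_formType (hD.connMatrix_mem hy i j) (hD.connMatrix_mem hy j l)

/-- The curvature of the dual bundle, in any frame: its matrix is `-∂̄A`, with `A` the connection
matrix. -/
theorem dualCurvature_coord (hD : IsConnection F D) (hflat : IsFlat F D) {x y : X}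
    (hy : y ∈ frameSet F V x) (i : Fin (Module.finrank ℂ F)) :
    dualCurvature F D y ((bundleFrames F).coord x i y : Module.Dual ℂ (V y)) =
      -∑ j, delbar E (connMatrix (V := V) D x i j) y ⊗ₜ[ℂ] (bundleFrames F).coord x j y := by
  have hyy := mem_frameSet (F := F) (V := V) y
  conv_lhs => rw [← sum_sec_smul_coord hyy ((bundleFrames F).coord x i y)]
  simp only [map_sum, map_smul, dualCurvature_coord_self hD hflat]
  simp only [hD.delbar_connMatrix hy hyy, TensorProduct.sum_tmul, smul_neg]
  rw [Finset.sum_neg_distrib]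
  congr 1
  have e : ∀ k l, (bundleFrames F).coord x i y ((bundleFrames F).sec y k y : V y) •
      delbar E (connMatrix (V := V) D y k l) y ⊗ₜ[ℂ]
        ((bundleFrames F).coord y l y : Module.Dual ℂ (V y)) =
      ∑ j, ((bundleFrames F).coord y l y ((bundleFrames F).sec x j y : V y) •
        (bundleFrames F).coord x i y ((bundleFrames F).sec y k y : V y) •
          delbar E (connMatrix (V := V) D y k l) y) ⊗ₜ[ℂ] (bundleFrames F).coord x j y := by
    intro k l
    conv_lhs => rw [← sum_sec_smul_coord hy ((bundleFrames F).coord y l y)]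
    rw [TensorProduct.tmul_sum, Finset.smul_sum]
    refine Finset.sum_congr rfl fun j _ => ?_
    rw [TensorProduct.tmul_smul, ← TensorProduct.smul_tmul', ← TensorProduct.smul_tmul', smul_comm]
  simp only [Finset.smul_sum, e, TensorProduct.sum_tmul]
  rw [Finset.sum_comm, Finset.sum_congr rfl fun l _ => Finset.sum_comm, Finset.sum_comm]

/-- The curvature is a form of type `(1, 1)`. -/
theorem dualCurvature_mem (hD : IsConnection F D) (hflat : IsFlat F D) (y : X)
    (t : Module.Dual ℂ (V y)) :
    dualCurvature F D y t ∈ coeffIn (formType E 1 1 y) (Module.Dual ℂ (V y)) := by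
  have hyy := mem_frameSet (F := F) (V := V) y
  rw [← sum_sec_smul_coord hyy t, map_sum]
  refine Submodule.sum_mem _ fun i _ => ?_
  rw [map_smul, dualCurvature_coord_self hD hflat]
  refine Submodule.smul_mem _ _ (Submodule.neg_mem _ (Submodule.sum_mem _ fun j _ => ?_))
  exact tmul_mem_coeffIn (delbar_mem (hD.connMatrix_analytic hyy i j)
    ((eventually_frameSet hyy).mono fun y' hy' => hD.connMatrix_mem hy' i j)) _

theorem dualCurvature_mem_centre (hD : IsConnection F D) (hflat : IsFlat F D) (y : X)
    (t : Module.Dual ℂ (V y)) :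
    dualCurvature F D y t ∈ coeffIn (centre (FormAt E y)) (Module.Dual ℂ (V y)) :=
  coeffIn_mono (S := formType E 1 1 y) (formType_one_one_le y)
    (dualCurvature_mem hD hflat y t)

end Curvature

/-! ### Naturality of the fibrewise construction -/

section Transport

variable {V V' : Type*} [AddCommGroup V] [Module ℂ V] [AddCommGroup V'] [Module ℂ V']
  {L L' : Type*} [Ring L] [Algebra ℂ L] [Ring L'] [Algebra ℂ L']

theorem coe_exteriorPower_map (T : V →ₗ[ℂ] V') (n : ℕ) (x : ⋀[ℂ]^n V) :
    (exteriorPower.map n T x : ExteriorAlgebra ℂ V') =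
      ExteriorAlgebra.map T (x : ExteriorAlgebra ℂ V) := by
  have h : (⋀[ℂ]^n V').subtype ∘ₗ exteriorPower.map n T =
      (ExteriorAlgebra.map T).toLinearMap ∘ₗ (⋀[ℂ]^n V).subtype := by
    apply exteriorPower.linearMap_ext
    ext v
    simp [ExteriorAlgebra.map_apply_ιMulti, Function.comp_def]
  exact LinearMap.congr_fun h x

theorem map_contractList (T : V →ₗ[ℂ] V') (l : List (Module.Dual ℂ V')) (x : ExteriorAlgebra ℂ V) :
    ExteriorAlgebra.map T (contractList (l.map fun f => f ∘ₗ T) x) =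
      contractList l (ExteriorAlgebra.map T x) := by
  induction l with
  | nil => rfl
  | cons f l ih => exact (contractLeft_map T f _).trans (congrArg _ ih)

/-- Powers of a contraction commute with a change of the coefficient algebra and of the vector
space. -/
theorem map_contractForm_pow (h : L →ₐ[ℂ] L') (T : V →ₗ[ℂ] V') (Θ : L ⊗[ℂ] Module.Dual ℂ V')
    (x : L ⊗[ℂ] ExteriorAlgebra ℂ V) (p : ℕ) :
    TensorProduct.map h.toLinearMap (ExteriorAlgebra.map T).toLinearMap
        ((contractForm (LinearMap.lTensor L T.dualMap Θ) ^ p) x) =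
      (contractForm (LinearMap.rTensor _ h.toLinearMap Θ) ^ p)
        (TensorProduct.map h.toLinearMap (ExteriorAlgebra.map T).toLinearMap x) := by
  induction p with
  | zero => rfl
  | succ p ih =>
    rw [pow_succ', pow_succ', Module.End.mul_apply, Module.End.mul_apply, map_contractForm, ih]

/-- The operators which define `ψ_p` commute with a change of the coefficient algebra and an
isomorphism of vector spaces. -/
theorem map_contractPow_twist [Module.Finite ℂ V] (h : L →ₐ[ℂ] L') (T : V ≃ₗ[ℂ] V')
    (Θ : L ⊗[ℂ] Module.Dual ℂ V') {R : Module.Dual ℂ V →ₗ[ℂ] L ⊗[ℂ] Module.Dual ℂ V}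
    (hR : ∀ f, R f ∈ coeffIn (centre L) (Module.Dual ℂ V))
    {R' : Module.Dual ℂ V' →ₗ[ℂ] L' ⊗[ℂ] Module.Dual ℂ V'}
    (hRR' : ∀ f, ∃ ξ : L ⊗[ℂ] Module.Dual ℂ V',
      R (f ∘ₗ T.toLinearMap) = LinearMap.lTensor L T.toLinearMap.dualMap ξ ∧
        LinearMap.rTensor _ h.toLinearMap ξ = R' f)
    {r : ℕ} (hV : Module.finrank ℂ V = r) (l : List (Module.Dual ℂ V')) (w : ⋀[ℂ]^r V')
    {p q : ℕ} (hpq : q + p = r) (hl : l.length = q) (α : ⋀[ℂ]^p V)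
    (hα : ExteriorAlgebra.map T.toLinearMap (α : ExteriorAlgebra ℂ V) =
      contractList l (w : ExteriorAlgebra ℂ V')) :
    h (contractPow (LinearMap.lTensor L T.toLinearMap.dualMap Θ) p (twist R p q r hpq hV α)) =
      (p.factorial : ℂ)⁻¹ • degreeZero ((contractForm (LinearMap.rTensor _ h.toLinearMap Θ) ^ p)
        (contractFormList (l.map R') (1 ⊗ₜ[ℂ] (w : ExteriorAlgebra ℂ V')))) := by
  have hTT : ∀ x,
      ExteriorAlgebra.map T.toLinearMap (ExteriorAlgebra.map T.symm.toLinearMap x) = x :=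
    fun x => by
      rw [← AlgHom.comp_apply, ExteriorAlgebra.map_comp_map, LinearEquiv.comp_symm,
        ExteriorAlgebra.map_id]
      rfl
  have hTT' : ∀ x,
      ExteriorAlgebra.map T.symm.toLinearMap (ExteriorAlgebra.map T.toLinearMap x) = x :=
    fun x => by
      rw [← AlgHom.comp_apply, ExteriorAlgebra.map_comp_map, LinearEquiv.symm_comp,
        ExteriorAlgebra.map_id]
      rfl
  set w₀ : ⋀[ℂ]^r V := exteriorPower.map r T.symm.toLinearMap w with hw₀
  have hw : (w₀ : ExteriorAlgebra ℂ V) =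
      ExteriorAlgebra.map T.symm.toLinearMap (w : ExteriorAlgebra ℂ V') := by
    rw [hw₀, coe_exteriorPower_map]
  have hα' : (α : ExteriorAlgebra ℂ V) =
      contractList (l.map fun f => f ∘ₗ T.toLinearMap) (w₀ : ExteriorAlgebra ℂ V) := by
    rw [← hTT' (contractList _ _), map_contractList, hw, hTT, ← hα, hTT']
  rw [contractPow_twist R hR hV _ _ w₀ p q hpq (by rw [List.length_map, hl]) α hα', map_smul,
    ← degreeZero_map h T.toLinearMap, map_contractForm_pow]
  congr 3
  clear hl hα hα'
  induction l with
  | nil =>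
    simp only [List.map_nil, contractFormList, List.foldr_nil, TensorProduct.map_tmul, hw]
    exact congrArg₂ (· ⊗ₜ[ℂ] ·) (map_one h) (hTT _)
  | cons f l ih =>
    obtain ⟨ξ, h1, h2⟩ := hRR' f
    simp only [List.map_cons, contractFormList, List.foldr_cons] at ih ⊢
    rw [h1, map_contractForm, h2, ih]

end Transport

/-! ### The ladder in a chart and a frame -/

section FlatPsi

set_option linter.unusedSectionVars false

variable {E : Type*} [NormedAddCommGroup E] [NormedSpace ℂ E] [FiniteDimensional ℂ E]
  {F : Type*} [AddCommGroup F] [Module ℂ F] [Module.Finite ℂ F] {r : ℕ}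
  (b : Module.Basis (Fin r) ℂ F)

/-- The curvature `-∂̄A` with connection matrix `A`, on the dual of the trivial bundle with fibre
`F`. -/
def flatCurvature (A : Fin r → Fin r → E → Forms E) (z : E) :
    Module.Dual ℂ F →ₗ[ℂ] Forms E ⊗[ℂ] Module.Dual ℂ F :=
  ∑ i, (Module.Dual.eval ℂ F (b i)).smulRight (-∑ j, flatDelbar (A i j) z ⊗ₜ[ℂ] b.coord j)

/-- The expression of `ψ_p` in a chart and a frame, on the contraction with the list `l` of the
multivector `w` of top degree. -/
def flatPsi (A : Fin r → Fin r → E → Forms E) (θ : Fin r → E → Forms E) (p : ℕ)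
    (l : List (Module.Dual ℂ F)) (w : ExteriorAlgebra ℂ F) (z : E) : Forms E :=
  (p.factorial : ℂ)⁻¹ • degreeZero ((contractForm (∑ j, θ j z ⊗ₜ[ℂ] b.coord j) ^ p)
    (contractFormList (l.map (flatCurvature b A z)) (1 ⊗ₜ[ℂ] w)))

theorem flatCurvature_apply (A : Fin r → Fin r → E → Forms E) (z : E) (f : Module.Dual ℂ F) :
    flatCurvature b A z f =
      ∑ j, (-∑ i, f (b i) • flatDelbar (A i j) z) ⊗ₜ[ℂ] b.coord j := by
  simp only [flatCurvature, LinearMap.sum_apply, LinearMap.smulRight_apply,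
    Module.Dual.eval_apply, smul_neg, Finset.smul_sum, TensorProduct.neg_tmul,
    TensorProduct.sum_tmul, Finset.sum_neg_distrib, TensorProduct.smul_tmul']
  rw [Finset.sum_comm]

variable {b} {A : Fin r → Fin r → E → Forms E} {θ : Fin r → E → Forms E} {z : E}

theorem flatCurvature_mem (hA : ∀ i j, RealAnalyticAt (A i j) z)
    (hA' : ∀ i j, ∀ᶠ w in nhds z, A i j w ∈ flatType E 1 0) (f : Module.Dual ℂ F) :
    flatCurvature b A z f ∈ coeffIn (flatType E 1 1) (Module.Dual ℂ F) := by
  rw [flatCurvature_apply]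
  exact Submodule.sum_mem _ fun j _ => tmul_mem_coeffIn (Submodule.neg_mem _
    (Submodule.sum_mem _ fun i _ => Submodule.smul_mem _ _ (flatDelbar_mem (hA i j) (hA' i j)))) _

/-- The curvature is `∂̄`-closed and of even degree. -/
theorem flatCurvature_closed (hA : ∀ i j, RealAnalyticAt (A i j) z)
    (hA' : ∀ i j, ∀ᶠ w in nhds z, A i j w ∈ flatType E 1 0) (f : Module.Dual ℂ F) :
    RealAnalyticAt (fun w => flatCurvature b A w f) z ∧
      tensorDelbar (fun w => flatCurvature b A w f) z = 0 ∧
      coeffInvolute _ (flatCurvature b A z f) = flatCurvature b A z f := by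
  have h1 : ∀ i j, RealAnalyticAt (fun w => f (b i) • flatDelbar (A i j) w) z := fun i j =>
    (hA i j).flatDelbar.linear (LinearMap.lsmul ℂ (Forms E) (f (b i)))
  have h2 : ∀ j, RealAnalyticAt (fun w => ∑ i, f (b i) • flatDelbar (A i j) w) z := fun j =>
    RealAnalyticAt.sum fun i _ => h1 i j
  have h3 : ∀ j, RealAnalyticAt (fun w => -∑ i, f (b i) • flatDelbar (A i j) w) z := fun j =>
    (h2 j).linear (-LinearMap.id)
  simp only [flatCurvature_apply]
  refine ⟨realAnalyticAt_sum_tmul _ h3, ?_, ?_⟩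
  · rw [tensorDelbar_sum_tmul _ h3]
    refine Finset.sum_eq_zero fun j _ => ?_
    rw [flatDelbar_neg (h2 j), flatDelbar_sum fun i _ => h1 i j, Finset.sum_eq_zero, neg_zero,
      TensorProduct.zero_tmul]
    intro i _
    have hc : HolomorphicAt (fun _ : E => f (b i)) z := holomorphicAt_of_analyticAt analyticAt_const
    rw [flatDelbar_holomorphic_smul hc (hA i j).flatDelbar, flatDelbar_flatDelbar (hA i j),
      smul_zero]
  · have := coeffInvolute_of_mem (flatCurvature_mem (b := b) hA hA' f)
    rwa [flatCurvature_apply, show (-1 : ℂ) ^ (1 + 1) = 1 by norm_num, one_smul] at this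

theorem contractFormList_flatCurvature_mem (hA : ∀ i j, RealAnalyticAt (A i j) z)
    (hA' : ∀ i j, ∀ᶠ w in nhds z, A i j w ∈ flatType E 1 0) (l : List (Module.Dual ℂ F))
    (w : ExteriorAlgebra ℂ F) :
    contractFormList (l.map (flatCurvature b A z)) (1 ⊗ₜ[ℂ] w) ∈
      coeffIn (flatType E l.length l.length) (ExteriorAlgebra ℂ F) := by
  induction l with
  | nil =>
    refine tmul_mem_coeffIn ?_ w
    rw [List.length_nil, flatType, pow_zero, pow_zero, mul_one]
    exact Submodule.one_le.mp le_rfl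
  | cons f l ih =>
    have := contractForm_mem ih (flatCurvature_mem (b := b) hA hA' f)
    rwa [flatType_mul] at this

/-- Each of the contractions with the curvature raises the type by `(1, 1)`, each of the
contractions with `∇τ` by `(1, 0)`. -/
theorem flatPsi_mem (hA : ∀ i j, RealAnalyticAt (A i j) z)
    (hA' : ∀ i j, ∀ᶠ w in nhds z, A i j w ∈ flatType E 1 0) (hθ : ∀ j, θ j z ∈ flatType E 1 0)
    (p : ℕ) (l : List (Module.Dual ℂ F)) (w : ExteriorAlgebra ℂ F) :
    flatPsi b A θ p l w z ∈ flatType E (l.length + p) l.length := by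
  refine Submodule.smul_mem _ _ (degreeZero_mem ?_)
  induction p with
  | zero => exact contractFormList_flatCurvature_mem hA hA' l w
  | succ p ih =>
    have hΘ : ∑ j, θ j z ⊗ₜ[ℂ] b.coord j ∈ coeffIn (flatType E 1 0) (Module.Dual ℂ F) :=
      Submodule.sum_mem _ fun j _ => tmul_mem_coeffIn (hθ j) _
    have := contractForm_mem ih hΘ
    rwa [flatType_mul, add_zero, add_assoc, ← Module.End.mul_apply, ← pow_succ'] at this

theorem flatPsi_analytic (hA : ∀ i j, RealAnalyticAt (A i j) z)
    (hA' : ∀ i j, ∀ᶠ w in nhds z, A i j w ∈ flatType E 1 0) (hθ : ∀ j, RealAnalyticAt (θ j) z)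
    (p : ℕ) (l : List (Module.Dual ℂ F)) (w : ExteriorAlgebra ℂ F) :
    RealAnalyticAt (flatPsi b A θ p l w) z := by
  have hΨ := (contractFormList_closed (l := l.map fun f z => flatCurvature b A z f) (z := z) (by
    simp only [List.mem_map, forall_exists_index, and_imp, forall_apply_eq_imp_iff₂]
    exact fun f _ => flatCurvature_closed hA hA' f) w).1
  simp only [List.map_map, Function.comp_def] at hΨ
  exact (realAnalyticAt_contractPow (realAnalyticAt_sum_tmul _ hθ) hΨ p).linear
    ((p.factorial : ℂ)⁻¹ • degreeZero)

/-- The ladder in a chart: if `∂̄θ = -∑ t_i ∂̄A_i`, then `∂̄` of `ψ_{p+1}` is `ψ_p` after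
contraction with the covector with coordinates `t_i`. -/
theorem flatDelbar_flatPsi (hA : ∀ i j, RealAnalyticAt (A i j) z)
    (hA' : ∀ i j, ∀ᶠ w in nhds z, A i j w ∈ flatType E 1 0) (hθ : ∀ j, RealAnalyticAt (θ j) z)
    (hθ' : ∀ j, θ j z ∈ flatType E 1 0) {t : Module.Dual ℂ F}
    (ht : ∀ j, flatDelbar (θ j) z = -∑ i, t (b i) • flatDelbar (A i j) z)
    (p : ℕ) (l : List (Module.Dual ℂ F)) (w : ExteriorAlgebra ℂ F) :
    flatDelbar (flatPsi b A θ (p + 1) l w) z = flatPsi b A θ p (t :: l) w z := by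
  have hΨ := contractFormList_closed (l := l.map fun f z => flatCurvature b A z f) (z := z) (by
    simp only [List.mem_map, forall_exists_index, and_imp, forall_apply_eq_imp_iff₂]
    exact fun f _ => flatCurvature_closed hA hA' f) w
  simp only [List.map_map, Function.comp_def] at hΨ
  have hΘ := realAnalyticAt_sum_tmul b.coord hθ
  have hd : tensorDelbar (fun z => ∑ j, θ j z ⊗ₜ[ℂ] b.coord j) z = flatCurvature b A z t := by
    rw [tensorDelbar_sum_tmul _ hθ, flatCurvature_apply]
    simp only [ht]
  have hodd : coeffInvolute _ (∑ j, θ j z ⊗ₜ[ℂ] b.coord j) = -∑ j, θ j z ⊗ₜ[ℂ] b.coord j := by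
    have hm : ∑ j, θ j z ⊗ₜ[ℂ] b.coord j ∈ coeffIn (flatType E 1 0) (Module.Dual ℂ F) :=
      Submodule.sum_mem _ fun j _ => tmul_mem_coeffIn (hθ' j) _
    rw [coeffInvolute_of_mem hm, add_zero, pow_one]
    exact neg_one_smul ℂ (∑ j, θ j z ⊗ₜ[ℂ] b.coord j)
  have hmain := tensorDelbar_contractForm_pow hΘ hΨ.1 hodd hΨ.2.2 hΨ.2.1
    (by rw [hd]; exact coeffIn_mono flatType_one_one_le (flatCurvature_mem hA hA' t)) p
  rw [hd] at hmain
  have hc : HolomorphicAt (fun _ : E => ((p + 1).factorial : ℂ)⁻¹) z :=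
    holomorphicAt_of_analyticAt analyticAt_const
  have han := realAnalyticAt_contractPow hΘ hΨ.1 (p + 1)
  refine (flatDelbar_holomorphic_smul hc (han.linear (degreeZero (L := Forms E) (V := F)))).trans ?_
  rw [flatDelbar_degreeZero han, hmain, map_smul, smul_smul, flatPsi]
  congr 1
  have : (p : ℂ) + 1 ≠ 0 := Nat.cast_add_one_ne_zero p
  rw [Nat.factorial_succ, Nat.cast_mul, Nat.cast_add_one, mul_inv, mul_comm _⁻¹, mul_assoc,
    inv_mul_cancel₀ this, mul_one]

end FlatPsi

section Induction

variable {V : Type*} [AddCommGroup V] [Module ℂ V]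

/-- What is linear in a multivector has to be checked only on iterated contractions of multivectors
of top degree. -/
theorem multivector_induction {p q r : ℕ} (h : q + p = r) (hV : Module.finrank ℂ V = r)
    {Q : ⋀[ℂ]^p V → Prop} (zero : Q 0) (add : ∀ a b, Q a → Q b → Q (a + b))
    (smul : ∀ (k : ℂ) a, Q a → Q (k • a))
    (contract : ∀ (l : List (Module.Dual ℂ V)) (w : ⋀[ℂ]^r V) (a : ⋀[ℂ]^p V), l.length = q →
      (a : ExteriorAlgebra ℂ V) = contractList l (w : ExteriorAlgebra ℂ V) → Q a)
    (a : ⋀[ℂ]^p V) : Q a := by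
  have key : ∀ u ∈ Submodule.span ℂ {y | ∃ (l : List (Module.Dual ℂ V)) (w : ⋀[ℂ]^r V),
      l.length = q ∧ y = contractList l (w : ExteriorAlgebra ℂ V)},
      ∃ a : ⋀[ℂ]^p V, (a : ExteriorAlgebra ℂ V) = u ∧ Q a := by
    intro u hu
    induction hu using Submodule.span_induction with
    | mem u hu =>
      obtain ⟨l, w, hl, rfl⟩ := hu
      have hm : contractList l (w : ExteriorAlgebra ℂ V) ∈ ⋀[ℂ]^p V :=
        contractList_mem l p _ (by rw [hl, h]; exact w.2)
      exact ⟨⟨_, hm⟩, rfl, contract l w _ hl rfl⟩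
    | zero => exact ⟨0, rfl, zero⟩
    | add u v _ _ hu hv =>
      obtain ⟨a, rfl, ha⟩ := hu
      obtain ⟨b, rfl, hb⟩ := hv
      exact ⟨a + b, rfl, add a b ha hb⟩
    | smul k u _ hu =>
      obtain ⟨a, rfl, ha⟩ := hu
      exact ⟨k • a, rfl, smul k a ha⟩
  obtain ⟨a', ha', hQ⟩ := key a (mem_span_contractList h hV _ a.2)
  rwa [← Subtype.ext ha']

end Induction

/-! ### The maps `ψ_p` in a chart and a frame -/

section Psi

set_option linter.unusedSectionVars false

open Bundle

variable {E : Type*} [NormedAddCommGroup E] [NormedSpace ℂ E] [FiniteDimensional ℂ E]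
  {X : Type*} [TopologicalSpace X] [ChartedSpace E X] [IsManifold 𝓘(ℂ, E) ω X]
  {F : Type*} [NormedAddCommGroup F] [NormedSpace ℂ F] [FiniteDimensional ℂ F]
  {V : X → Type*} [TopologicalSpace (TotalSpace F V)]
  [∀ x, AddCommGroup (V x)] [∀ x, Module ℂ (V x)] [∀ x, TopologicalSpace (V x)]
  [FiberBundle F V] [VectorBundle ℂ F V] [ContMDiffVectorBundle ω F V 𝓘(ℂ, E)]
  {D : (Π y, V y) → Π y : X, FormAt E y ⊗[ℂ] V y}

/-- The coefficient of `∇τ` at the `j`-th member of the dual of the frame at `x`. -/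
def thetaForm (D : (Π y, V y) → Π y : X, FormAt E y ⊗[ℂ] V y) (τ : Π y, V y →L[ℂ] ℂ) (x : X)
    (j : Fin (Module.finrank ℂ F)) (y : X) : FormAt E y :=
  delFun E (fun y' => τ y' ((bundleFrames F).sec x j y')) y -
    evalAt (τ y : V y →ₗ[ℂ] ℂ) (D ((bundleFrames F).sec x j) y)

/-- The multivector field which is constant in the trivialisation at `x`. -/
def constMulti (V : X → Type*) [TopologicalSpace (TotalSpace F V)]
    [∀ x, AddCommGroup (V x)] [∀ x, Module ℂ (V x)] [∀ x, TopologicalSpace (V x)]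
    [FiberBundle F V] [VectorBundle ℂ F V] (x : X) (p : ℕ) (y : X) :
    ⋀[ℂ]^p F →ₗ[ℂ] ⋀[ℂ]^p (V y) :=
  exteriorPower.map p ((trivializationAt F V x).symmₗ ℂ y)

/-- In the trivialisation, the multivector field `constMulti` is the constant from which it is made.
-/
theorem map_constMulti {x y : X} (hy : y ∈ frameSet F V x) (p : ℕ) (c : ⋀[ℂ]^p F) :
    ExteriorAlgebra.map (fibreEquiv (V := V) hy).toLinearMap
      (constMulti V x p y c : ExteriorAlgebra ℂ (V y)) = c := by
  rw [constMulti, coe_exteriorPower_map, ← AlgHom.comp_apply, ExteriorAlgebra.map_comp_map]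
  have e : (fibreEquiv (V := V) hy).toLinearMap ∘ₗ (trivializationAt F V x).symmₗ ℂ y =
      LinearMap.id := by
    ext v
    exact ((trivializationAt F V x).coe_linearMapAt_of_mem (R := ℂ) hy ▸
      (trivializationAt F V x).linearMapAt_symmₗ (R := ℂ) hy v :)
  rw [e, ExteriorAlgebra.map_id]
  rfl

theorem thetaForm_eq (τ : Π y, V y →L[ℂ] ℂ) {x y : X} (hy : y ∈ frameSet F V x)
    (j : Fin (Module.finrank ℂ F)) :
    thetaForm D τ x j y = delFun E (fun y' => τ y' ((bundleFrames F).sec x j y')) y +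
      -∑ i, τ y ((bundleFrames F).sec x i y) • connMatrix (V := V) D x i j y := by
  rw [thetaForm, sub_eq_add_neg, ← sum_connMatrix (D := D) hy, map_sum]
  simp only [evalAt_tmul]
  rfl

variable {τ : Π y, V y →L[ℂ] ℂ}

theorem thetaForm_mem (hD : IsConnection F D)
    (hτ : ∀ (s : Π y, V y) (y : X), HolSecAt E F s y → HolAt E (fun y => τ y (s y)) y) {x y : X}
    (hy : y ∈ frameSet F V x) (j : Fin (Module.finrank ℂ F)) :
    thetaForm D τ x j y ∈ formType E 1 0 y := by
  rw [thetaForm_eq τ hy]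
  exact Submodule.add_mem _ (delFun_mem (hτ _ y (holSecAt_sec hy j))) (Submodule.neg_mem _
    (Submodule.sum_mem _ fun i _ => Submodule.smul_mem _ _ (hD.connMatrix_mem hy i j)))

/-- `∂̄(∇τ) = R τ`: since `∂̄∂⟨τ, s_j⟩ = 0` for the holomorphic section `s_j` of the frame, only the
term with the connection matrix contributes. -/
theorem thetaForm_analytic (hD : IsConnection F D)
    (hτ : ∀ (s : Π y, V y) (y : X), HolSecAt E F s y → HolAt E (fun y => τ y (s y)) y) {x y : X}
    (hy : y ∈ frameSet F V x) (j : Fin (Module.finrank ℂ F)) :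
    FormAnalyticAt E (thetaForm D τ x j) y ∧ delbar E (thetaForm D τ x j) y =
      -∑ i, τ y ((bundleFrames F).sec x i y) • delbar E (connMatrix (V := V) D x i j) y := by
  have h1 := hτ _ y (holSecAt_sec hy j)
  have h2 : ∀ i, FormAnalyticAt E (fun y => τ y ((bundleFrames F).sec x i y) •
      connMatrix (V := V) D x i j y) y := fun i =>
    FormAnalyticAt.smul (hτ _ y (holSecAt_sec hy i)) (hD.connMatrix_analytic hy i j)
  have h3 := FormAnalyticAt.sum (u := Finset.univ) fun i _ => h2 i
  have e : ∀ᶠ y in nhds y, delFun E (fun y' => τ y' ((bundleFrames F).sec x j y')) y +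
      -∑ i, τ y ((bundleFrames F).sec x i y) • connMatrix (V := V) D x i j y =
        thetaForm D τ x j y :=
    (eventually_frameSet hy).mono fun y' hy' => (thetaForm_eq τ hy' j).symm
  have h4 := formAnalyticAt_delFun h1
  refine ⟨(h4.add h3.neg).congr e, ?_⟩
  rw [← delbar_congr e, delbar_add h4 h3.neg, delbar_delFun h1, zero_add, delbar_neg h3,
    delbar_sum fun i _ => h2 i]
  congr 1
  exact Finset.sum_congr rfl fun i _ => delbar_smul (hτ _ y (holSecAt_sec hy i))
    (hD.connMatrix_analytic hy i j)

theorem coord_eq_comp {x y : X} (hy : y ∈ frameSet F V x) (i : Fin (Module.finrank ℂ F)) :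
    ((bundleFrames F).coord x i y : V y →ₗ[ℂ] ℂ) =
      (fibreEquiv hy).toLinearMap.dualMap ((Module.finBasis ℂ F).coord i) :=
  LinearMap.ext fun v => coord_eq hy i v

/-- The section `∇τ` in the frame at `x`. -/
theorem nablaDual_eq (hD : IsConnection F D)
    (hτ : ∀ (s : Π y, V y) (y : X), HolSecAt E F s y → HolAt E (fun y => τ y (s y)) y) {x y : X}
    (hy : y ∈ frameSet F V x) :
    nablaDual F D τ y = LinearMap.lTensor (FormAt E y) (fibreEquiv hy).toLinearMap.dualMap
      (∑ j, thetaForm D τ x j y ⊗ₜ[ℂ] (Module.finBasis ℂ F).coord j) := by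
  rw [nablaDual, hD.dualConnection_eq (t := fun y => (τ y : V y →ₗ[ℂ] ℂ)) hy
    (fun i => hτ _ y (holSecAt_sec (mem_frameSet y) i)), map_sum]
  refine Finset.sum_congr rfl fun j _ => ?_
  rw [LinearMap.lTensor_tmul, ← coord_eq_comp hy]
  rfl

/-- The pullback of forms at a point to the chart at `x`. -/
def toModel (E : Type*) [NormedAddCommGroup E] [NormedSpace ℂ E] {X : Type*}
    [TopologicalSpace X] [ChartedSpace E X] (x : X) (z : E) :
    FormAt E ((extChartAt 𝓘(ℂ, E) x).symm z) →ₐ[ℂ] Forms E :=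
  ExteriorAlgebra.map (pullCovector (E₁ := E)
    (mfderiv 𝓘(ℂ, E) 𝓘(ℂ, E) (extChartAt 𝓘(ℂ, E) x).symm z))

/-- The connection matrix has type `(1, 0)`, so its `∂̄` may be computed in any chart. -/
theorem inChart_connMatrix (hD : IsConnection F D) {x y : X}
    (hx : y ∈ (extChartAt 𝓘(ℂ, E) x).source) (hy : y ∈ frameSet F V x)
    (i j : Fin (Module.finrank ℂ F)) :
    RealAnalyticAt (inChart E (connMatrix (V := V) D x i j) x) (extChartAt 𝓘(ℂ, E) x y) ∧
      inChart E (delbar E (connMatrix (V := V) D x i j)) x (extChartAt 𝓘(ℂ, E) x y) =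
        flatDelbar (inChart E (connMatrix (V := V) D x i j) x) (extChartAt 𝓘(ℂ, E) x y) :=
  inChart_delbar hx ((eventually_frameSet hy).mono fun _ hy' => hD.connMatrix_mem hy' i j)
    (hD.connMatrix_analytic hy i j)

/-- In a chart and a frame, `ψ_p` of a contraction of a constant multivector of top degree is given
by the explicit formula `flatPsi`. -/
theorem inChart_psi (hD : IsConnection F D) (hflat : IsFlat F D)
    (hτ : ∀ (s : Π y, V y) (y : X), HolSecAt E F s y → HolAt E (fun y => τ y (s y)) y) {x : X}
    {z : E} (hz : z ∈ (extChartAt 𝓘(ℂ, E) x).target)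
    (hy : (extChartAt 𝓘(ℂ, E) x).symm z ∈ frameSet F V x) {p : ℕ} (hp : p ≤ Module.finrank ℂ F)
    (l : List (Module.Dual ℂ F)) (hl : l.length = Module.finrank ℂ F - p)
    (w : ⋀[ℂ]^(Module.finrank ℂ F) F) (c : ⋀[ℂ]^p F)
    (hc : (c : ExteriorAlgebra ℂ F) = contractList l (w : ExteriorAlgebra ℂ F)) :
    inChart E (fun y => psi F D τ p hp y (constMulti V x p y c)) x z =
      flatPsi (Module.finBasis ℂ F) (fun i j => inChart E (connMatrix (V := V) D x i j) x)
        (fun j => inChart E (thetaForm D τ x j) x) p l w z := by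
  set y := (extChartAt 𝓘(ℂ, E) x).symm z with hydef
  have hysrc : y ∈ (extChartAt 𝓘(ℂ, E) x).source := (extChartAt 𝓘(ℂ, E) x).map_target hz
  have hyz : extChartAt 𝓘(ℂ, E) x y = z := (extChartAt 𝓘(ℂ, E) x).right_inv hz
  have : Module.Finite ℂ (V y) := (finite_fibre F y).1
  have hRR' : ∀ f : Module.Dual ℂ F, ∃ ξ : FormAt E y ⊗[ℂ] Module.Dual ℂ F,
      dualCurvature F D y (f ∘ₗ (fibreEquiv hy).toLinearMap) =
        LinearMap.lTensor (FormAt E y) (fibreEquiv hy).toLinearMap.dualMap ξ ∧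
      LinearMap.rTensor _ (toModel E x z).toLinearMap ξ =
        flatCurvature (Module.finBasis ℂ F)
          (fun i j => inChart E (connMatrix (V := V) D x i j) x) z f := by
    intro f
    refine ⟨∑ i, f (Module.finBasis ℂ F i) • -∑ j, delbar E (connMatrix (V := V) D x i j) y ⊗ₜ[ℂ]
      (Module.finBasis ℂ F).coord j, ?_, ?_⟩
    · have hf : f ∘ₗ (fibreEquiv hy).toLinearMap =
          ∑ i, f (Module.finBasis ℂ F i) • ((bundleFrames F).coord x i y : V y →ₗ[ℂ] ℂ) := by
        refine (sum_sec_smul_coord hy _).symm.trans (Finset.sum_congr rfl fun i _ => ?_)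
        rw [sec_eq hy]
        simp
      rw [hf]
      simp only [map_sum, map_smul, map_neg, LinearMap.lTensor_tmul]
      refine Finset.sum_congr rfl fun i _ => ?_
      rw [dualCurvature_coord hD hflat hy]
      simp only [coord_eq_comp hy]
    · have hA : ∀ i j : Fin (Module.finrank ℂ F),
          toModel E x z (delbar E (connMatrix (V := V) D x i j) y) =
            flatDelbar (inChart E (connMatrix (V := V) D x i j) x) z := by
        intro i j
        have := (inChart_connMatrix hD hysrc hy i j).2
        rw [hyz] at this
        exact this
      simp only [map_sum, map_smul, map_neg, LinearMap.rTensor_tmul, AlgHom.toLinearMap_apply, hA,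
        flatCurvature, LinearMap.sum_apply, LinearMap.smulRight_apply, Module.Dual.eval_apply]
  have hmain := map_contractPow_twist (toModel E x z) (fibreEquiv hy)
    (∑ j, thetaForm D τ x j y ⊗ₜ[ℂ] (Module.finBasis ℂ F).coord j)
    (dualCurvature_mem_centre hD hflat y) hRR' (finite_fibre F y).2 l w (Nat.sub_add_cancel hp) hl
    (constMulti V x p y c) ((map_constMulti hy p c).trans hc)
  rw [← nablaDual_eq hD hτ hy, map_sum] at hmain
  exact hmain

end Psi

/-! ### The ladder on the manifold -/

section Ladder

set_option linter.unusedSectionVars false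

open Bundle

variable {E : Type*} [NormedAddCommGroup E] [NormedSpace ℂ E] [FiniteDimensional ℂ E]
  {X : Type*} [TopologicalSpace X] [ChartedSpace E X] [IsManifold 𝓘(ℂ, E) ω X]
  {F : Type*} [NormedAddCommGroup F] [NormedSpace ℂ F] [FiniteDimensional ℂ F]
  {V : X → Type*} [TopologicalSpace (TotalSpace F V)]
  [∀ x, AddCommGroup (V x)] [∀ x, Module ℂ (V x)] [∀ x, TopologicalSpace (V x)]
  [FiberBundle F V] [VectorBundle ℂ F V] [ContMDiffVectorBundle ω F V 𝓘(ℂ, E)]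
  {D : (Π y, V y) → Π y : X, FormAt E y ⊗[ℂ] V y} {τ : Π y, V y →L[ℂ] ℂ}

theorem eventually_inChart_psi (hD : IsConnection F D) (hflat : IsFlat F D)
    (hτ : ∀ (s : Π y, V y) (y : X), HolSecAt E F s y → HolAt E (fun y => τ y (s y)) y) (x : X)
    {p : ℕ} (hp : p ≤ Module.finrank ℂ F)
    (l : List (Module.Dual ℂ F)) (hl : l.length = Module.finrank ℂ F - p)
    (w : ⋀[ℂ]^(Module.finrank ℂ F) F) (c : ⋀[ℂ]^p F)
    (hc : (c : ExteriorAlgebra ℂ F) = contractList l (w : ExteriorAlgebra ℂ F)) :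
    inChart E (fun y => psi F D τ p hp y (constMulti V x p y c)) x
      =ᶠ[nhds (extChartAt 𝓘(ℂ, E) x x)]
      flatPsi (Module.finBasis ℂ F) (fun i j => inChart E (connMatrix (V := V) D x i j) x)
        (fun j => inChart E (thetaForm D τ x j) x) p l w :=
  (eventually_chart (mem_extChartAt_source x) (eventually_frameSet (mem_frameSet x))).mono
    fun _ hz => inChart_psi hD hflat hτ hz.1 hz.2 hp l hl w c hc

theorem eventually_inChart_connMatrix_mem (hD : IsConnection F D) (x : X)
    (i j : Fin (Module.finrank ℂ F)) :
    ∀ᶠ z in nhds (extChartAt 𝓘(ℂ, E) x x),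
      inChart E (connMatrix (V := V) D x i j) x z ∈ flatType E 1 0 :=
  (eventually_chart (mem_extChartAt_source x) (eventually_frameSet (mem_frameSet x))).mono
    fun _ hz => inChart_mem (hD.connMatrix_mem hz.2 i j)

theorem inChart_thetaForm_mem (hD : IsConnection F D)
    (hτ : ∀ (s : Π y, V y) (y : X), HolSecAt E F s y → HolAt E (fun y => τ y (s y)) y) (x : X)
    (j : Fin (Module.finrank ℂ F)) :
    inChart E (thetaForm D τ x j) x (extChartAt 𝓘(ℂ, E) x x) ∈ flatType E 1 0 := by
  refine inChart_mem ?_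
  rw [extChartAt_to_inv]
  exact thetaForm_mem hD hτ (mem_frameSet x) j

/-- The form `ψ_p` of a multivector field which is constant in a trivialisation is real analytic and
of type `(r, r - p)`. -/
theorem psi_constMulti (hD : IsConnection F D) (hflat : IsFlat F D)
    (hτ : ∀ (s : Π y, V y) (y : X), HolSecAt E F s y → HolAt E (fun y => τ y (s y)) y) (x : X)
    {p : ℕ} (hp : p ≤ Module.finrank ℂ F) (c : ⋀[ℂ]^p F) :
    FormAnalyticAt E (fun y => psi F D τ p hp y (constMulti V x p y c)) x ∧
      psi F D τ p hp x (constMulti V x p x c) ∈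
        formType E (Module.finrank ℂ F) (Module.finrank ℂ F - p) x := by
  have hx := mem_frameSet (F := F) (V := V) x
  induction c using multivector_induction (Nat.sub_add_cancel hp) rfl with
  | zero =>
    simp only [map_zero]
    refine ⟨?_, Submodule.zero_mem _⟩
    have := FormAnalyticAt.sum (E := E) (X := X) (y := x) (u := (∅ : Finset ℕ))
      (η := fun _ _ => 0) (by simp)
    simpa using this
  | add a b ha hb =>
    simp only [map_add]
    exact ⟨ha.1.add hb.1, Submodule.add_mem _ ha.2 hb.2⟩
  | smul k a ha =>
    simp only [map_smul]
    exact ⟨FormAnalyticAt.smul (f := fun _ => k) contMDiffAt_const ha.1,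
      Submodule.smul_mem _ _ ha.2⟩
  | contract l w c hl hc =>
    have hev := eventually_inChart_psi hD hflat hτ x hp l hl w c hc
    have hA := fun i j => (hD.connMatrix_analytic hx i j)
    have hA' := eventually_inChart_connMatrix_mem hD x
    refine ⟨(flatPsi_analytic hA hA' (fun j => (thetaForm_analytic hD hτ hx j).1) p l
      (w : ExteriorAlgebra ℂ F)).congr hev.symm, ?_⟩
    have hm := flatPsi_mem (b := Module.finBasis ℂ F) hA hA' (inChart_thetaForm_mem hD hτ x) p l
      (w : ExteriorAlgebra ℂ F)
    rw [← hev.self_of_nhds, hl, Nat.sub_add_cancel hp, inChart_self] at hm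
    exact hm

theorem constMulti_koszul (τ : Π y, V y →L[ℂ] ℂ) (x : X) (p : ℕ) (c : ⋀[ℂ]^(p + 1) F) :
    constMulti V x p x (koszul ((τ x : V x →ₗ[ℂ] ℂ) ∘ₗ
        (fibreEquiv (mem_frameSet x)).symm.toLinearMap) p c) =
      koszul (τ x : V x →ₗ[ℂ] ℂ) p (constMulti V x (p + 1) x c) := by
  have hx := mem_frameSet (F := F) (V := V) x
  apply Subtype.ext
  have hinj : Function.Injective (ExteriorAlgebra.map (R := ℂ) (fibreEquiv hx).toLinearMap) :=
    ExteriorAlgebra.map_injective ⟨(fibreEquiv hx).symm.toLinearMap, by simp⟩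
  apply hinj
  have hτ : (τ x : V x →ₗ[ℂ] ℂ) = ((τ x : V x →ₗ[ℂ] ℂ) ∘ₗ
      (fibreEquiv hx).symm.toLinearMap) ∘ₗ (fibreEquiv hx).toLinearMap := by
    rw [LinearMap.comp_assoc]; simp
  conv_rhs => rw [coe_koszul, hτ]
  rw [contractLeft_map, map_constMulti, map_constMulti, coe_koszul]

/-- A square of the ladder, on multivector fields which are constant in a trivialisation. -/
theorem delbar_psi_constMulti (hD : IsConnection F D) (hflat : IsFlat F D)
    (hτ : ∀ (s : Π y, V y) (y : X), HolSecAt E F s y → HolAt E (fun y => τ y (s y)) y) (x : X)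
    {p : ℕ} (hp : p + 1 ≤ Module.finrank ℂ F) (c : ⋀[ℂ]^(p + 1) F) :
    delbar E (fun y => psi F D τ (p + 1) hp y (constMulti V x (p + 1) y c)) x =
      psi F D τ p (Nat.le_of_succ_le hp) x
        (koszul (τ x : V x →ₗ[ℂ] ℂ) p (constMulti V x (p + 1) x c)) := by
  have hx := mem_frameSet (F := F) (V := V) x
  have han := fun c => (psi_constMulti hD hflat hτ x hp c).1
  induction c using multivector_induction (Nat.sub_add_cancel hp) rfl with
  | zero =>
    simp only [map_zero]
    have := delbar_sum (E := E) (X := X) (y := x) (u := (∅ : Finset ℕ))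
      (η := fun _ _ => 0) (by simp)
    simpa using this
  | add a b ha hb =>
    simp only [map_add, ← ha, ← hb]
    exact delbar_add (han a) (han b)
  | smul k a ha =>
    simp only [map_smul, ← ha]
    exact delbar_smul (f := fun _ => k) contMDiffAt_const (han a)
  | contract l w c hl hc =>
    set t : Module.Dual ℂ F := (τ x : V x →ₗ[ℂ] ℂ) ∘ₗ (fibreEquiv hx).symm.toLinearMap with ht
    have hev := eventually_inChart_psi hD hflat hτ x hp l hl w c hc
    have hA := fun i j => (hD.connMatrix_analytic hx i j)
    have hA' := eventually_inChart_connMatrix_mem hD x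
    have hθ : ∀ j, flatDelbar (inChart E (thetaForm D τ x j) x) (extChartAt 𝓘(ℂ, E) x x) =
        -∑ i, t (Module.finBasis ℂ F i) • flatDelbar
          (inChart E (connMatrix (V := V) D x i j) x) (extChartAt 𝓘(ℂ, E) x x) := by
      intro j
      have h := (thetaForm_analytic hD hτ hx j).2
      simp only [delbar_eq, sec_eq hx] at h
      exact h
    rw [← constMulti_koszul, ← ht, ← inChart_self (fun y => psi F D τ p (Nat.le_of_succ_le hp) y
      (constMulti V x p y (koszul t p c))) x, delbar_eq, flatDelbar_congr hev,
      flatDelbar_flatPsi hA hA' (fun j => (thetaForm_analytic hD hτ hx j).1)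
        (inChart_thetaForm_mem hD hτ x) hθ]
    refine (Filter.EventuallyEq.eq_of_nhds (eventually_inChart_psi hD hflat hτ x
      (Nat.le_of_succ_le hp) (t :: l) ?_ w (koszul t p c) ?_)).symm
    · rw [List.length_cons, hl]; omega
    · rw [coe_koszul, hc]; rfl

/-- A holomorphic multivector field is, near every point, a combination of multivector fields which
are constant in a trivialisation, with holomorphic functions as coefficients. -/
theorem HolMultiSection.exists_eq_sum {p : ℕ} {U : Set X} {α : Π x, ⋀[ℂ]^p (V x)}
    (hα : HolMultiSection E F p α U) {x : X} (hx : x ∈ U) :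
    ∃ (ι : Type) (_ : Fintype ι) (f : ι → X → ℂ) (c : ι → ⋀[ℂ]^p F),
      (∀ i, HolAt E (f i) x) ∧
        ∀ᶠ y in nhds x, α y = ∑ i, f i y • constMulti V x p y (c i) := by
  obtain ⟨U', hU', hxU', m, g, s, hg, hs, he⟩ := hα x hx
  have hxx := mem_frameSet (F := F) (V := V) x
  have hn := hU'.mem_nhds hxU'
  refine ⟨Fin m × (Fin p → Fin (Module.finrank ℂ F)), inferInstance, fun i y => g i.1 y *
    ∏ j, (bundleFrames F).coord x (i.2 j) y (s i.1 j y),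
    fun i => exteriorPower.ιMulti ℂ p fun j => Module.finBasis ℂ F (i.2 j), ?_, ?_⟩
  · intro i
    refine ContMDiffAt.mul ((hg i.1).contMDiffAt hn) (ContMDiffAt.prod fun j _ => ?_)
    exact HolSecAt.coord ((hs i.1 j).contMDiffAt hn) hxx (i.2 j)
  · filter_upwards [hn, eventually_frameSet hxx] with y hy hyx
    rw [he y hy, Fintype.sum_prod_type]
    refine Finset.sum_congr rfl fun i _ => ?_
    have h1 : (fun j => s i j y) = fun j => ∑ k, (bundleFrames F).coord x k y (s i j y) •
        ((bundleFrames F).sec x k y : V y) := funext fun j => (sum_coord_smul_sec hyx _).symm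
    have h2 := (exteriorPower.ιMulti ℂ p (M := V y)).toMultilinearMap.map_sum
      (fun j k => (bundleFrames F).coord x k y (s i j y) • ((bundleFrames F).sec x k y : V y))
    rw [h1]
    refine (congrArg (g i y • ·) h2).trans ?_
    rw [Finset.smul_sum]
    refine Finset.sum_congr rfl fun κ _ => ?_
    rw [MultilinearMap.map_smul_univ, smul_smul, constMulti, exteriorPower.map_apply_ιMulti]
    rfl

/-- The Koszul differential preserves holomorphic multivector fields. -/
theorem HolMultiSection.koszul
    (hτ : ∀ (s : Π y, V y) (y : X), HolSecAt E F s y → HolAt E (fun y => τ y (s y)) y)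
    {p : ℕ} {U : Set X} {α : Π x, ⋀[ℂ]^(p + 1) (V x)} (hα : HolMultiSection E F (p + 1) α U) :
    HolMultiSection E F p
      (fun x => KoszulDolbeault.koszul (τ x : V x →ₗ[ℂ] ℂ) p (α x)) U := by
  intro x hx
  obtain ⟨U', hU', hxU', m, g, s, hg, hs, he⟩ := hα x hx
  let e : Fin (m * (p + 1)) ≃ Fin m × Fin (p + 1) := finProdFinEquiv.symm
  refine ⟨U', hU', hxU', m * (p + 1),
    fun n y => g (e n).1 y * ((-1 : ℂ) ^ ((e n).2 : ℕ) * τ y (s (e n).1 (e n).2 y)),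
    fun n j => s (e n).1 ((e n).2.succAbove j), fun n => ?_, fun n j => hs _ _, fun y hy => ?_⟩
  · refine (hg _).mul (contMDiffOn_const.mul fun y hy => ContMDiffAt.contMDiffWithinAt ?_)
    exact hτ _ y ((hs _ _).contMDiffAt (hU'.mem_nhds hy))
  · have h1 : KoszulDolbeault.koszul (τ y : V y →ₗ[ℂ] ℂ) p (α y) =
        ∑ n : Fin m × Fin (p + 1), (g n.1 y * ((-1 : ℂ) ^ (n.2 : ℕ) * τ y (s n.1 n.2 y))) •
          exteriorPower.ιMulti ℂ p fun j => s n.1 (n.2.succAbove j) y := by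
      rw [he y hy, map_sum, Fintype.sum_prod_type]
      refine Finset.sum_congr rfl fun i _ => ?_
      rw [map_smul, koszul_ιMulti, Finset.smul_sum]
      exact Finset.sum_congr rfl fun k _ => smul_smul _ _ _
    exact h1.trans (e.sum_comp fun n => (g n.1 y * ((-1 : ℂ) ^ (n.2 : ℕ) *
      τ y (s n.1 n.2 y))) • exteriorPower.ιMulti ℂ p fun j => s n.1 (n.2.succAbove j) y).symm

/-- In degree zero, the contraction operator is scalar multiplication. -/
theorem contractPow_zero_tmul {W L : Type*} [AddCommGroup W] [Module ℂ W] [Ring L] [Algebra ℂ L]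
    (Θ : L ⊗[ℂ] Module.Dual ℂ W) (a : L) (c : ℂ) :
    contractPow Θ 0 (a ⊗ₜ[ℂ] (exteriorPower.zeroEquiv (R := ℂ) (M := W)).symm c) = c • a := by
  simp [contractPow, degreeZero, exteriorPower.zeroEquiv_symm_apply]

end Ladder

end KoszulDolbeault

end

theorem mainTheorem7
    {E : Type*} [NormedAddCommGroup E] [NormedSpace ℂ E] [FiniteDimensional ℂ E]
    {X : Type*} [TopologicalSpace X] [ChartedSpace E X] [IsManifold 𝓘(ℂ, E) ω X]
    {F : Type*} [NormedAddCommGroup F] [NormedSpace ℂ F] [FiniteDimensional ℂ F]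
    {V : X → Type*} [TopologicalSpace (Bundle.TotalSpace F V)]
    [∀ x, AddCommGroup (V x)] [∀ x, Module ℂ (V x)] [∀ x, TopologicalSpace (V x)]
    [FiberBundle F V] [VectorBundle ℂ F V] [ContMDiffVectorBundle ω F V 𝓘(ℂ, E)]
    (D : (Π y, V y) → Π y : X, KoszulDolbeault.FormAt E y ⊗[ℂ] V y)
    (hD : KoszulDolbeault.IsConnection F D) (hflat : KoszulDolbeault.IsFlat F D)
    (τ : Π y, V y →L[ℂ] ℂ)
    (hτ : ContMDiff 𝓘(ℂ, E) (𝓘(ℂ, E).prod 𝓘(ℂ, F →L[ℂ] ℂ)) ω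
      (fun x => (Bundle.TotalSpace.mk' (F →L[ℂ] ℂ) x (τ x) :
        Bundle.TotalSpace (F →L[ℂ] ℂ) (fun y => V y →L[ℂ] Bundle.Trivial X ℂ y)))) :
    -- `⋀^q R` sends `e₁ ∧ ... ∧ e_q` to `R e₁ ∧ ... ∧ R e_q`
    (∀ (x : X) (q : ℕ) (e : Fin q → Module.Dual ℂ (V x)),
      LinearMap.lTensor (KoszulDolbeault.FormAt E x) (⋀[ℂ]^q (Module.Dual ℂ (V x))).subtype
          (KoszulDolbeault.wedgePow (KoszulDolbeault.dualCurvature F D x) q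
            (exteriorPower.ιMulti ℂ q e)) =
        (List.ofFn fun i =>
          KoszulDolbeault.inclOne (KoszulDolbeault.dualCurvature F D x (e i))).prod) ∧
    -- `ψ_p` maps holomorphic sections of `⋀^p V` to real analytic forms of type `(r, r - p)`
    (∀ (p : ℕ) (hp : p ≤ Module.finrank ℂ F) (U : Set X) (α : Π x, ⋀[ℂ]^p (V x)), IsOpen U →
      KoszulDolbeault.HolMultiSection E F p α U → ∀ x ∈ U,
        KoszulDolbeault.psi F D τ p hp x (α x) ∈
          KoszulDolbeault.formType E (Module.finrank ℂ F) (Module.finrank ℂ F - p) x ∧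
        KoszulDolbeault.FormAnalyticAt E (fun y => KoszulDolbeault.psi F D τ p hp y (α y)) x) ∧
    -- every square of the ladder commutes
    (∀ (p : ℕ) (hp : p + 1 ≤ Module.finrank ℂ F) (U : Set X) (α : Π x, ⋀[ℂ]^(p + 1) (V x)),
      IsOpen U → KoszulDolbeault.HolMultiSection E F (p + 1) α U →
        KoszulDolbeault.HolMultiSection E F p
          (fun x => KoszulDolbeault.koszul (τ x : V x →ₗ[ℂ] ℂ) p (α x)) U ∧
        ∀ x ∈ U,
          KoszulDolbeault.delbar E (fun y => KoszulDolbeault.psi F D τ (p + 1) hp y (α y)) x =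
            KoszulDolbeault.psi F D τ p (Nat.le_of_succ_le hp) x
              (KoszulDolbeault.koszul (τ x : V x →ₗ[ℂ] ℂ) p (α x))) ∧
    -- `ψ_r = (1/r!) (ι_{∇τ})^r`
    (∀ (x : X) (α : ⋀[ℂ]^(Module.finrank ℂ F) (V x)),
      KoszulDolbeault.psi F D τ (Module.finrank ℂ F) le_rfl x α =
        KoszulDolbeault.contractPow (KoszulDolbeault.nablaDual F D τ x) (Module.finrank ℂ F)
          (1 ⊗ₜ[ℂ] α)) ∧
    -- `ψ_0` is multiplication by `det R`
    (∀ (x : X) (b : Module.Basis (Fin (Module.finrank ℂ F)) ℂ (Module.Dual ℂ (V x))) (c : ℂ),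
      KoszulDolbeault.psi F D τ 0 (Nat.zero_le _) x
          ((exteriorPower.zeroEquiv (R := ℂ) (M := V x)).symm c) =
        c • KoszulDolbeault.detForm (Matrix.of fun i j =>
          KoszulDolbeault.evalAt (b.coord j) (KoszulDolbeault.dualCurvature F D x (b i)))) := by
  have hτ' : ∀ (s : Π y, V y) (y : X), KoszulDolbeault.HolSecAt E F s y →
      KoszulDolbeault.HolAt E (fun y => τ y (s y)) y :=
    fun s y hs => KoszulDolbeault.HolSecAt.apply hs hτ
  refine ⟨fun x q e => KoszulDolbeault.coe_wedgePow_ιMulti _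
    (KoszulDolbeault.dualCurvature_mem_centre hD hflat x) q e, ?_, ?_, ?_, ?_⟩
  · intro p hp U α _ hα x hx
    obtain ⟨ι, _, f, c, hf, he⟩ := KoszulDolbeault.HolMultiSection.exists_eq_sum hα hx
    -- `ψ_p` is linear, so the multivector fields that are constant in the trivialisation suffice
    have key := fun c => KoszulDolbeault.psi_constMulti hD hflat hτ' x hp c
    constructor
    · rw [he.self_of_nhds, map_sum]
      refine Submodule.sum_mem _ fun i _ => ?_
      rw [map_smul]
      exact Submodule.smul_mem _ _ (key (c i)).2
    · refine KoszulDolbeault.FormAnalyticAt.congr (KoszulDolbeault.FormAnalyticAt.sum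
        (u := Finset.univ) fun i _ =>
          KoszulDolbeault.FormAnalyticAt.smul (hf i) (key (c i)).1) ?_
      filter_upwards [he] with y hy
      rw [hy, map_sum]
      exact Finset.sum_congr rfl fun i _ => (map_smul _ _ _).symm
  · intro p hp U α _ hα
    refine ⟨KoszulDolbeault.HolMultiSection.koszul hτ' hα, fun x hx => ?_⟩
    obtain ⟨ι, _, f, c, hf, he⟩ := KoszulDolbeault.HolMultiSection.exists_eq_sum hα hx
    have key := fun c => (KoszulDolbeault.psi_constMulti hD hflat hτ' x hp c).1
    have h1 : ∀ᶠ y in nhds x, KoszulDolbeault.psi F D τ (p + 1) hp y (α y) =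
        ∑ i, f i y • KoszulDolbeault.psi F D τ (p + 1) hp y
          (KoszulDolbeault.constMulti V x (p + 1) y (c i)) := by
      filter_upwards [he] with y hy
      rw [hy, map_sum]
      exact Finset.sum_congr rfl fun i _ => map_smul _ _ _
    rw [KoszulDolbeault.delbar_congr h1, KoszulDolbeault.delbar_sum fun i _ =>
      KoszulDolbeault.FormAnalyticAt.smul (hf i) (key (c i)), he.self_of_nhds]
    simp only [map_sum, map_smul]
    refine Finset.sum_congr rfl fun i _ => ?_
    rw [KoszulDolbeault.delbar_smul (hf i) (key (c i)),
      KoszulDolbeault.delbar_psi_constMulti hD hflat hτ' x hp (c i)]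
  · intro x α
    have : Module.Finite ℂ (V x) := (KoszulDolbeault.finite_fibre F x).1
    have h := KoszulDolbeault.twist_top (KoszulDolbeault.dualCurvature F D x)
      (KoszulDolbeault.dualCurvature_mem_centre hD hflat x)
      (Nat.sub_add_cancel le_rfl) (KoszulDolbeault.finite_fibre F x).2 α
    exact congrArg (KoszulDolbeault.contractPow (KoszulDolbeault.nablaDual F D τ x)
      (Module.finrank ℂ F)) h
  · intro x b c
    have : Module.Finite ℂ (V x) := (KoszulDolbeault.finite_fibre F x).1
    have h := KoszulDolbeault.twist_zero (KoszulDolbeault.dualCurvature F D x)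
      (KoszulDolbeault.dualCurvature_mem_centre hD hflat x)
      (Nat.sub_add_cancel (Nat.zero_le _)) (KoszulDolbeault.finite_fibre F x).2 b
      ((exteriorPower.zeroEquiv (R := ℂ) (M := V x)).symm c)
    refine (congrArg (KoszulDolbeault.contractPow (KoszulDolbeault.nablaDual F D τ x) 0) h).trans ?_
    exact KoszulDolbeault.contractPow_zero_tmul _ _ _
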